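/- All manifolds, maps and forms are smooth and real; $n\ge 2$; Latin indices run from $1$ to $n$; $N=\tfrac12(n+1)(n+2)$; "$\mathrm{mod}\ \theta$" means $\mathrm{mod}\ \theta_1,\dots,\theta_n$, and similarly for $\Theta$. Let $Y$ be a $(2n+1)$-dimensional contact manifold, let $Z\to Y$ be (an open subset of) the bundle of Legendrian $n$-planes of $Y$, and let $Z$ be foliated by $n$-dimensional submanifolds that are canonical lifts of Legendrian submanifolds of $Y$. Let $\mathcal I$ be the Frobenius system on $Z$ generated by the $1$-forms that vanish on the leaves. Assume that the space of leaves (the space of solutions) $X$ is an $N$-dimensional manifold, with $Z\to X$ a submersion whose fibres are the (connected) leaves. Let $F_1\to Z$ be the bundle of all coframes $(\theta_0,\theta=(\theta_i),\Theta=(\Theta_{ij})=\Theta^t,\omega=(\omega^i))$ of $Z$ such that $\theta_0$ is a contact form pulled back from $Y$ (up to a factor), $\theta_0,\theta$ generate the canonical system of the bundle of Legendrian $n$-planes (the first prolongation of the contact system), $\theta_0,\theta,\Theta$ generate $\mathcal I$, and $$d\theta_0\equiv-\sum_k\theta_k\wedge\omega^k\ \mathrm{mod}\ \theta_0,\quad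 d\theta_i\equiv-\sum_k\Theta_{ik}\wedge\omega^k\ \mathrm{mod}\ \theta_0,\theta,\quad d\Theta_{ij}\equiv0\ \mathrm{mod}\ \theta_0,\theta,\Theta .$$ Denote the tautological forms on $F_1$ by the same letters. Let $\rho$ (scalar), $\alpha$ ($n\times n$ matrix), $\beta,\mu$ (columns), $\pi^k,\epsilon,\gamma$ (symmetric $n\times n$ matrices) be $1$-forms on $F_1$ (a pseudo connection) with $$\begin{aligned} d\theta_0&=-\rho\wedge\theta_0-\theta^t\wedge\omega,\\ d\theta&=-\beta\wedge\theta_0-\alpha\wedge\theta-\Theta\wedge\omega,\\ d\Theta&=-\epsilon\wedge\theta_0-\sum_k\pi^k\wedge\theta_k-(\alpha-\tfrac{\rho}{2})\wedge\Theta+\Theta\wedge(\alpha-\tfrac{\rho}{2})^t+T_0,\\ d\omega&=-\mu\wedge\theta_0-\gamma\wedge\theta+(\alpha^t-\rho)\wedge\omega,\end{aligned}$$ where $T_0=\sum_{ij}\Theta_{ij}\wedge\tau^{ij}$, with $\tau^{ij}=\tau^{ji}$ symmetric matrices of $1$-forms such that $\tau^{ij}\wedge\omega=0$. Suppose that $F_1\to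 Z$ admits a reduction to a (principal) subbundle $F\subset F_1$ on which, all forms being restricted to $F$, $$T_0=0,\qquad \pi^k_{ij}\equiv\tfrac12(\delta_{ik}\beta_j+\delta_{jk}\beta_i)\ \text{ and }\ \epsilon\equiv0\quad \mathrm{mod}\ \theta_0,\theta,\Theta .$$ Then: 1. The conformal class of the symmetric $(n+1)$-differential $\det\begin{pmatrix}2\theta_0&\theta^t\\ \theta&\Theta\end{pmatrix}$ is well defined on $X$: there is a unique conformal class of symmetric $(n+1)$-differentials on $X$ (a field of lines, locally spanned by a smooth nowhere zero symmetric $(n+1)$-differential) such that at each point of $F$ the above determinant is the pull-back, under $F\to Z\to X$, of an element of the class. 2. On $F$ the structure equations become $$\begin{aligned} d\theta_0&=-\rho\wedge\theta_0-\theta^t\wedge\omega,\\ d\theta&=-\beta\wedge\theta_0-\alpha\wedge\theta-\Theta\wedge\omega,\\ d\Theta&=-\tfrac12(\beta\wedge\theta^t-\theta\wedge\beta^t)-(\alpha-\tfrac{\rho}{2})\wedge\Theta+\Theta\wedge(\alpha-\tfrac{\rho}{2})^t+T,\\ d\omega&=-\mu\wedge\theta_0-\gamma\wedge\theta+(\alpha^t-\rho)\wedge\omega,\end{aligned}$$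 where $T=T^t$ is quadratic in $\{\theta_0,\theta,\Theta\}$ and $T\equiv0\ \mathrm{mod}\ \theta_0,\theta$. -/

import Mathlib

open scoped Manifold ContDiff Topology

noncomputable section

namespace LegPath

/-! ### Differential forms of degree one and two on manifolds

All manifolds are smooth, real, without boundary, and modelled on a normed space `E` through
`𝓘(ℝ, E)`. -/

section Forms

variable {E : Type*} [NormedAddCommGroup E] [NormedSpace ℝ E]
  {M : Type*} [TopologicalSpace M] [ChartedSpace E M]
  {E' : Type*} [NormedAddCommGroup E'] [NormedSpace ℝ E']
  {M' : Type*} [TopologicalSpace M'] [ChartedSpace E' M']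
  {G : Type*} [NormedAddCommGroup G] [NormedSpace ℝ G]
  {G' : Type*} [NormedAddCommGroup G'] [NormedSpace ℝ G']

/-- A (not necessarily smooth) `1`-form on `M` with values in `G`. -/
abbrev VForm (E M G : Type*) [NormedAddCommGroup E] [NormedSpace ℝ E] [TopologicalSpace M]
    [ChartedSpace E M] [NormedAddCommGroup G] [NormedSpace ℝ G] :=
  ∀ x : M, TangentSpace 𝓘(ℝ, E) x →L[ℝ] G

/-- A (not necessarily smooth) scalar `1`-form on `M`. -/
abbrev OneForm (E M : Type*) [NormedAddCommGroup E] [NormedSpace ℝ E] [TopologicalSpace M]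
    [ChartedSpace E M] :=
  VForm E M ℝ

/-- A `2`-form on `M`, given by its values on pairs of tangent vectors. -/
abbrev TwoForm (E M : Type*) [NormedAddCommGroup E] [NormedSpace ℝ E] [TopologicalSpace M]
    [ChartedSpace E M] :=
  ∀ x : M, TangentSpace 𝓘(ℝ, E) x → TangentSpace 𝓘(ℝ, E) x → ℝ

/-- The `1`-form `φ` written in the preferred chart at `x₀`: the pull-back of `φ` under the inverse
of that chart. -/
def coordForm (x₀ : M) (φ : VForm E M G) : E → (E →L[ℝ] G) := fun y =>
  (φ ((extChartAt 𝓘(ℝ, E) x₀).symm y)).comp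
    (mfderiv 𝓘(ℝ, E) 𝓘(ℝ, E) (extChartAt 𝓘(ℝ, E) x₀).symm y)

/-- Smoothness of a `1`-form at a point. -/
def SmoothFormAt (φ : VForm E M G) (x : M) : Prop :=
  ContDiffAt ℝ ∞ (coordForm x φ) (extChartAt 𝓘(ℝ, E) x x)

/-- Smooth `1`-forms. -/
def SmoothForm (φ : VForm E M G) : Prop := ∀ x, SmoothFormAt φ x

/-- The exterior derivative of a scalar `1`-form. At `x` it is computed in the preferred chart at
`x`, through which `TangentSpace 𝓘(ℝ, E) x` is identified with `E`. Convention: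
`dφ(V, W) = V(φ(W)) - W(φ(V)) - φ([V, W])`. -/
def extD (φ : OneForm E M) : TwoForm E M := fun x v w =>
  fderiv ℝ (coordForm x φ) (extChartAt 𝓘(ℝ, E) x x) v w
    - fderiv ℝ (coordForm x φ) (extChartAt 𝓘(ℝ, E) x x) w v

/-- The wedge product of two scalar `1`-forms. -/
def wedge (φ ψ : OneForm E M) : TwoForm E M := fun x v w => φ x v * ψ x w - φ x w * ψ x v

/-- The component of a vector valued `1`-form along a continuous linear map. -/
def VForm.comp (l : G →L[ℝ] G') (φ : VForm E M G) : VForm E M G' := fun x => l.comp (φ x)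

/-- The pull-back of a `1`-form by a map. -/
def pullForm (g : M → M') (φ : VForm E' M' G) : VForm E M G := fun x =>
  (φ (g x)).comp (mfderiv 𝓘(ℝ, E) 𝓘(ℝ, E') g x)

/-- The wedge product of two covectors. -/
def wedgeAt {V : Type*} [TopologicalSpace V] [AddCommGroup V] [Module ℝ V]
    (a b : V →L[ℝ] ℝ) : V → V → ℝ := fun v w => a v * b w - a w * b v

/-- `Ω ≡ 0` modulo the covectors in `S`: the alternating form `Ω` lies in the ideal of the exterior
algebra that `S` generates. -/
def InIdeal {V : Type*} [TopologicalSpace V] [AddCommGroup V] [Module ℝ V]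
    (S : Set (V →L[ℝ] ℝ)) (Ω : V → V → ℝ) : Prop :=
  Ω ∈ Submodule.span ℝ {η : V → V → ℝ | ∃ a : V →L[ℝ] ℝ, ∃ s ∈ S, η = wedgeAt a s}

/-- `Ω` is quadratic in the covectors in `S`. -/
def IsQuadraticIn {V : Type*} [TopologicalSpace V] [AddCommGroup V] [Module ℝ V]
    (S : Set (V →L[ℝ] ℝ)) (Ω : V → V → ℝ) : Prop :=
  Ω ∈ Submodule.span ℝ {η : V → V → ℝ | ∃ s ∈ S, ∃ t ∈ S, η = wedgeAt s t}

end Forms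

/-- The wedge product of `1`-forms. -/
local infixl:70 " ⩓ " => wedge

/-! ### Contact manifolds and Legendrian planes -/

section Contact

variable {E : Type*} [NormedAddCommGroup E] [NormedSpace ℝ E]
  {M : Type*} [TopologicalSpace M] [ChartedSpace E M]

/-- A field of tangent subspaces. -/
abbrev PlaneField (E M : Type*) [NormedAddCommGroup E] [NormedSpace ℝ E] [TopologicalSpace M]
    [ChartedSpace E M] :=
  ∀ x : M, Submodule ℝ (TangentSpace 𝓘(ℝ, E) x)

/-- A positive multiple of the value of `θ ∧ (dθ)ⁿ` on the tangent vectors `v 0, …, v (2n)`. -/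
def contactVolume (n : ℕ) (θ : OneForm E M) (x : M)
    (v : Fin (2 * n + 1) → TangentSpace 𝓘(ℝ, E) x) : ℝ :=
  ∑ σ : Equiv.Perm (Fin (2 * n + 1)), ((Equiv.Perm.sign σ : ℤ) : ℝ) *
    (θ x (v (σ ⟨0, by omega⟩)) *
      ∏ i : Fin n, extD θ x (v (σ ⟨2 * i + 1, by omega⟩)) (v (σ ⟨2 * i + 2, by omega⟩)))

/-- `θ` is, near `x`, a smooth `1`-form with kernel `D`. -/
def IsLocalDefiningForm (D : PlaneField E M) (θ : OneForm E M) (x : M) : Prop :=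
  ∀ᶠ y in 𝓝 x, SmoothFormAt θ y ∧ D y = LinearMap.ker (θ y).toLinearMap

/-- `D` is a contact structure: it is locally the kernel of a smooth `1`-form `θ` with
`θ ∧ (dθ)ⁿ ≠ 0` everywhere. -/
def IsContact (n : ℕ) (D : PlaneField E M) : Prop :=
  ∀ x, ∃ θ : OneForm E M, IsLocalDefiningForm D θ x ∧
    ∀ᶠ y in 𝓝 x, ∃ v, contactVolume n θ y v ≠ 0

/-- `L` is a Legendrian `n`-plane at `x`: an `n`-dimensional integral element of the contact
differential system, that is, `θ` and `dθ` vanish on `L` for the local contact forms `θ`. -/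
def IsLegendrian (n : ℕ) (D : PlaneField E M) (x : M)
    (L : Submodule ℝ (TangentSpace 𝓘(ℝ, E) x)) : Prop :=
  Module.finrank ℝ L = n ∧ L ≤ D x ∧
    ∀ θ : OneForm E M, IsLocalDefiningForm D θ x → ∀ v ∈ L, ∀ w ∈ L, extD θ x v w = 0

end Contact

/-! ### Legendrian submanifold path geometries -/

section Geometry

/-- A Legendrian submanifold path geometry.

* `Y` is a contact manifold of dimension `2n+1`, with contact hyperplane field `D`.
* `Z` is (an open subset of) the bundle of Legendrian `n`-planes of `Y`: a point `z` is the
  Legendrian `n`-plane `L z` at the point `p z`, and the smooth structure of `Z` is the one for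
  which `z ↦ (p z, L z)` is an immersion to the Grassmann bundle of `n`-planes of `TY`; by
  the dimension of `Z` its image is then open in the bundle of Legendrian `n`-planes.
* `Z` is foliated by the fibres of `τ`, so that `X` is the space of leaves; the leaves are
  canonical lifts of Legendrian submanifolds of `Y`: the projection `p` is an immersion
  on each leaf, and the image of the tangent space of the leaf at `z` is the plane `L z`. -/
structure LegendrianPathGeometry (n : ℕ)
    {EY : Type*} [NormedAddCommGroup EY] [NormedSpace ℝ EY]
    {EZ : Type*} [NormedAddCommGroup EZ] [NormedSpace ℝ EZ]
    {EX : Type*} [NormedAddCommGroup EX] [NormedSpace ℝ EX]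
    (Y : Type*) [TopologicalSpace Y] [ChartedSpace EY Y]
    (Z : Type*) [TopologicalSpace Z] [ChartedSpace EZ Z]
    (X : Type*) [TopologicalSpace X] [ChartedSpace EX X] where
  dim_Y : Module.finrank ℝ EY = 2 * n + 1
  dim_Z : Module.finrank ℝ EZ = (n + 1) * (n + 2) / 2 + n
  dim_X : Module.finrank ℝ EX = (n + 1) * (n + 2) / 2
  /-- the contact structure of `Y` -/
  D : PlaneField EY Y
  contact : IsContact n D
  /-- the projection of `Z` to `Y` -/
  p : Z → Y
  p_submersion : Manifold.IsSubmersion 𝓘(ℝ, EZ) 𝓘(ℝ, EY) ∞ p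
  /-- the Legendrian plane that a point of `Z` is -/
  L : ∀ z : Z, Submodule ℝ (TangentSpace 𝓘(ℝ, EY) (p z))
  legendrian : ∀ z, IsLegendrian n D (p z) (L z)
  plane_injective : Function.Injective
    (fun z => (⟨p z, L z⟩ : Σ y : Y, Submodule ℝ (TangentSpace 𝓘(ℝ, EY) y)))
  /-- In the preferred chart of `Y` at `p z₀`, the planes near `L z₀` are graphs over `L z₀` along
  the kernel of some linear `pr`, so they are parametrized by linear maps `m z` with
  `pr ∘ m z = id`; these `m z` are coordinates on the Grassmannian. -/
  plane_immersion : ∀ z₀ : Z, ∃ (pr : EY →L[ℝ] (Fin n → ℝ)) (m : Z → ((Fin n → ℝ) →L[ℝ] EY)),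
    ContMDiffAt 𝓘(ℝ, EZ) 𝓘(ℝ, (Fin n → ℝ) →L[ℝ] EY) ∞ m z₀ ∧
    (∀ᶠ z in 𝓝 z₀, pr.comp (m z) = ContinuousLinearMap.id ℝ (Fin n → ℝ) ∧
      (L z).map (mfderiv 𝓘(ℝ, EY) 𝓘(ℝ, EY) (extChartAt 𝓘(ℝ, EY) (p z₀)) (p z)).toLinearMap
        = LinearMap.range (m z).toLinearMap) ∧
    Function.Injective (mfderiv 𝓘(ℝ, EZ) 𝓘(ℝ, EY × ((Fin n → ℝ) →L[ℝ] EY))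
      (fun z => (extChartAt 𝓘(ℝ, EY) (p z₀) (p z), m z)) z₀)
  /-- the projection of `Z` to the space of leaves -/
  τ : Z → X
  τ_submersion : Manifold.IsSubmersion 𝓘(ℝ, EZ) 𝓘(ℝ, EX) ∞ τ
  leaf_connected : ∀ x : X, IsConnected (τ ⁻¹' {x})
  leaf_lift : ∀ z, (LinearMap.ker (mfderiv 𝓘(ℝ, EZ) 𝓘(ℝ, EX) τ z).toLinearMap).map
    (mfderiv 𝓘(ℝ, EZ) 𝓘(ℝ, EY) p z).toLinearMap = L z

end Geometry

/-! ### Coframes -/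

/-- Symmetric `n × n` arrays. -/
def symArr (n : ℕ) : Submodule ℝ (Fin n → Fin n → ℝ) where
  carrier := {S | ∀ i j, S i j = S j i}
  add_mem' := fun ha hb i j => by simp [ha i j, hb i j]
  zero_mem' := fun _ _ => rfl
  smul_mem' := fun c _ ha i j => by simp [ha i j]

/-- The values `(θ₀, θ, Θ, ω)` of a coframe; `Θ` is symmetric. -/
def CoframeModel (n : ℕ) := ℝ × (Fin n → ℝ) × symArr n × (Fin n → ℝ)

instance (n : ℕ) : NormedAddCommGroup (CoframeModel n) :=
  inferInstanceAs (NormedAddCommGroup (ℝ × (Fin n → ℝ) × symArr n × (Fin n → ℝ)))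

instance (n : ℕ) : NormedSpace ℝ (CoframeModel n) :=
  inferInstanceAs (NormedSpace ℝ (ℝ × (Fin n → ℝ) × symArr n × (Fin n → ℝ)))

instance (n : ℕ) : FiniteDimensional ℝ (CoframeModel n) :=
  inferInstanceAs (FiniteDimensional ℝ (ℝ × (Fin n → ℝ) × symArr n × (Fin n → ℝ)))

section CoframeModel

variable (n : ℕ)

/-- The identification of `CoframeModel n` with the product that it is. -/
def coframeEquiv : CoframeModel n ≃L[ℝ] ℝ × (Fin n → ℝ) × symArr n × (Fin n → ℝ) :=
  ContinuousLinearEquiv.refl ℝ (ℝ × (Fin n → ℝ) × symArr n × (Fin n → ℝ))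

/-- The component `θ₀`. -/
def cTheta0 : CoframeModel n →L[ℝ] ℝ :=
  LinearMap.toContinuousLinearMap
    { toFun := fun u => (coframeEquiv n u).1
      map_add' := fun u v => by simp
      map_smul' := fun a u => by simp }

variable {n}

/-- The components `θ_i`. -/
def cTheta (i : Fin n) : CoframeModel n →L[ℝ] ℝ :=
  LinearMap.toContinuousLinearMap
    { toFun := fun u => (coframeEquiv n u).2.1 i
      map_add' := fun u v => by simp
      map_smul' := fun a u => by simp }

/-- The components `Θ_ij`. -/
def cTHETA (i j : Fin n) : CoframeModel n →L[ℝ] ℝ :=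
  LinearMap.toContinuousLinearMap
    { toFun := fun u => (coframeEquiv n u).2.2.1.1 i j
      map_add' := fun u v => by simp
      map_smul' := fun a u => by simp }

/-- The components `ω^i`. -/
def cOmega (i : Fin n) : CoframeModel n →L[ℝ] ℝ :=
  LinearMap.toContinuousLinearMap
    { toFun := fun u => (coframeEquiv n u).2.2.2 i
      map_add' := fun u v => by simp
      map_smul' := fun a u => by simp }

/-- The determinant of the symmetric `(n+1) × (n+1)` matrix with blocks `2θ₀, θᵗ, θ, Θ`. -/
def detEta (u : CoframeModel n) : ℝ :=
  (Matrix.fromBlocks (Matrix.of fun _ _ : Fin 1 => 2 * cTheta0 n u)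
    (Matrix.of fun _ j => cTheta j u) (Matrix.of fun i _ => cTheta i u)
    (Matrix.of fun i j => cTHETA i j u)).det

variable {V : Type*} [TopologicalSpace V] [AddCommGroup V] [Module ℝ V]

/-- `{θ₀}` for the coframe `u`. -/
def gen0 (u : V →L[ℝ] CoframeModel n) : Set (V →L[ℝ] ℝ) := {(cTheta0 n).comp u}

/-- `{θ₀, θ}` for the coframe `u`. -/
def gen1 (u : V →L[ℝ] CoframeModel n) : Set (V →L[ℝ] ℝ) :=
  gen0 u ∪ Set.range fun i => (cTheta i).comp u

/-- `{θ₀, θ, Θ}` for the coframe `u`. -/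
def gen2 (u : V →L[ℝ] CoframeModel n) : Set (V →L[ℝ] ℝ) :=
  gen1 u ∪ Set.range fun ij : Fin n × Fin n => (cTHETA ij.1 ij.2).comp u

/-- The common kernel of a set of covectors. -/
def annih (S : Set (V →L[ℝ] ℝ)) : Submodule ℝ V := ⨅ s ∈ S, LinearMap.ker s.toLinearMap

end CoframeModel

section Coframes

variable {n : ℕ}
  {EY : Type*} [NormedAddCommGroup EY] [NormedSpace ℝ EY]
  {EZ : Type*} [NormedAddCommGroup EZ] [NormedSpace ℝ EZ]
  {EX : Type*} [NormedAddCommGroup EX] [NormedSpace ℝ EX]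
  {Y : Type*} [TopologicalSpace Y] [ChartedSpace EY Y]
  {Z : Type*} [TopologicalSpace Z] [ChartedSpace EZ Z] [IsManifold 𝓘(ℝ, EZ) ∞ Z]
  {X : Type*} [TopologicalSpace X] [ChartedSpace EX X]

/-- The vector bundle `Hom(TZ, CoframeModel n)`; coframes of `Z` are points of it. -/
abbrev CoframeBundle (n : ℕ) (EZ Z : Type*) [NormedAddCommGroup EZ] [NormedSpace ℝ EZ]
    [TopologicalSpace Z] [ChartedSpace EZ Z] :=
  Bundle.TotalSpace (EZ →L[ℝ] CoframeModel n)
    (fun z : Z => TangentSpace 𝓘(ℝ, EZ) z →L[ℝ] CoframeModel n)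

/-- The model with corners of the bundle `CoframeBundle n EZ Z`. -/
abbrev coframeI (n : ℕ) (EZ : Type*) [NormedAddCommGroup EZ] [NormedSpace ℝ EZ] :=
  (𝓘(ℝ, EZ)).prod 𝓘(ℝ, EZ →L[ℝ] CoframeModel n)

/-- The field `c = (θ₀, θ, Θ, ω)` consists of coframes at `z`, is adapted to the geometry and
satisfies the first structure equations at `z`:
`θ₀` is a contact form; `{θ₀, θ}` generates the canonical system of the bundle of Legendrian
planes (the first prolongation of the contact system); `{θ₀, θ, Θ}` generates the Frobenius system
of the foliation; and `dθ₀ ≡ -∑ θ_k ∧ ω^k` mod `θ₀`, `dθ_i ≡ -∑ Θ_ik ∧ ω^k` mod `θ₀, θ`,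
`dΘ_ij ≡ 0` mod `θ₀, θ, Θ`. -/
structure IsAdaptedAt (𝒢 : LegendrianPathGeometry n (EY := EY) (EZ := EZ) (EX := EX) Y Z X)
    (c : VForm EZ Z (CoframeModel n)) (z : Z) : Prop where
  bijective : Function.Bijective (c z)
  contact_form : annih (gen0 (c z)) =
    (𝒢.D (𝒢.p z)).comap (mfderiv 𝓘(ℝ, EZ) 𝓘(ℝ, EY) 𝒢.p z).toLinearMap
  canonical_system : annih (gen1 (c z)) =
    (𝒢.L z).comap (mfderiv 𝓘(ℝ, EZ) 𝓘(ℝ, EY) 𝒢.p z).toLinearMap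
  frobenius_system : annih (gen2 (c z)) =
    LinearMap.ker (mfderiv 𝓘(ℝ, EZ) 𝓘(ℝ, EX) 𝒢.τ z).toLinearMap
  d_theta0 : InIdeal (gen0 (c z))
    ((extD (c.comp (cTheta0 n)) + ∑ k, c.comp (cTheta k) ⩓ c.comp (cOmega k)) z)
  d_theta : ∀ i, InIdeal (gen1 (c z))
    ((extD (c.comp (cTheta i)) + ∑ k, c.comp (cTHETA i k) ⩓ c.comp (cOmega k)) z)
  d_THETA : ∀ i j, InIdeal (gen2 (c z)) (extD (c.comp (cTHETA i j)) z)

/-- The bundle `F₁`, as a subset of the coframe bundle: the values of all local smooth coframe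
fields that are adapted at each point of their domains. -/
def adaptedCoframes (𝒢 : LegendrianPathGeometry n (EY := EY) (EZ := EZ) (EX := EX) Y Z X) :
    Set (CoframeBundle n EZ Z) :=
  {u | ∃ c : VForm EZ Z (CoframeModel n),
    (∀ᶠ z in 𝓝 u.1, SmoothFormAt c z ∧ IsAdaptedAt 𝒢 c z) ∧ c u.1 = u.2}

variable {EP : Type*} [NormedAddCommGroup EP] [NormedSpace ℝ EP]
  {P : Type*} [TopologicalSpace P] [ChartedSpace EP P]
  {EF : Type*} [NormedAddCommGroup EF] [NormedSpace ℝ EF]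
  {F : Type*} [TopologicalSpace F] [ChartedSpace EF F]

/-- The manifold `P` with the map `ι` is the bundle `F₁`, as an embedded submanifold of the coframe
bundle. -/
structure IsAdaptedBundle (𝒢 : LegendrianPathGeometry n (EY := EY) (EZ := EZ) (EX := EX) Y Z X)
    (ι : P → CoframeBundle n EZ Z) : Prop where
  embedding : Manifold.IsSmoothEmbedding 𝓘(ℝ, EP) (coframeI n EZ) ∞ ι
  range_eq : Set.range ι = adaptedCoframes 𝒢

/-- The map `j : F → P` is a reduction of the coframe bundle `ι : P → CoframeBundle n EZ Z` over
`Z` to a subbundle with some structure group `H`: an embedded submanifold that submerses onto `Z`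
and whose fibres over `Z` are orbits of a group `H` of linear transformations of the coframes. -/
structure IsReduction (ι : P → CoframeBundle n EZ Z) (j : F → P) : Prop where
  embedding : Manifold.IsSmoothEmbedding 𝓘(ℝ, EF) 𝓘(ℝ, EP) ∞ j
  submersion : Manifold.IsSubmersion 𝓘(ℝ, EF) 𝓘(ℝ, EZ) ∞ (fun f => (ι (j f)).1)
  surjective : Function.Surjective (fun f => (ι (j f)).1)
  orbits : ∃ H : Subgroup (CoframeModel n ≃L[ℝ] CoframeModel n),
    (∀ f : F, ∀ h ∈ H, ∃ f' : F, ι (j f') =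
      ⟨(ι (j f)).1, (h : CoframeModel n →L[ℝ] CoframeModel n).comp (ι (j f)).2⟩) ∧
    (∀ f f' : F, (ι (j f)).1 = (ι (j f')).1 → ∃ h ∈ H, ι (j f') =
      ⟨(ι (j f)).1, (h : CoframeModel n →L[ℝ] CoframeModel n).comp (ι (j f)).2⟩)

/-- The tautological `1`-form `(θ₀, θ, Θ, ω)` of a manifold `P` of coframes. -/
def taut (ι : P → CoframeBundle n EZ Z) : VForm EP P (CoframeModel n) := fun f =>
  (ι f).2.comp (mfderiv 𝓘(ℝ, EP) 𝓘(ℝ, EZ) (fun f' => (ι f').1) f)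

/-- A pseudo connection on a manifold `P` of coframes with which the structure equations

* `dθ₀ = -ρ ∧ θ₀ - θᵗ ∧ ω`,
* `dθ = -β ∧ θ₀ - α ∧ θ - Θ ∧ ω`,
* `dΘ = -ε ∧ θ₀ - ∑ πᵏ ∧ θ_k - (α - ρ/2) ∧ Θ + Θ ∧ (α - ρ/2)ᵗ + T₀`,
* `dω = -μ ∧ θ₀ - γ ∧ θ + (αᵗ - ρ) ∧ ω`

hold, where `T₀ = ∑ Θ_kl ∧ σ^kl`, the `σ^kl = σ^lk` are symmetric matrices of
`1`-forms, and `σ^kl ∧ ω = 0`. -/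
structure PseudoConnection (ι : P → CoframeBundle n EZ Z) where
  ρ : OneForm EP P
  α : Fin n → Fin n → OneForm EP P
  β : Fin n → OneForm EP P
  ε : Fin n → Fin n → OneForm EP P
  /-- `π k i j` is the entry `(i, j)` of the matrix `πᵏ`. -/
  π : Fin n → Fin n → Fin n → OneForm EP P
  μ : Fin n → OneForm EP P
  γ : Fin n → Fin n → OneForm EP P
  /-- `σ k l i j` is the entry `(i, j)` of the matrix `σ^kl`. -/
  σ : Fin n → Fin n → Fin n → Fin n → OneForm EP P
  ρ_smooth : SmoothForm ρ
  α_smooth : ∀ i j, SmoothForm (α i j)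
  β_smooth : ∀ i, SmoothForm (β i)
  ε_smooth : ∀ i j, SmoothForm (ε i j)
  π_smooth : ∀ k i j, SmoothForm (π k i j)
  μ_smooth : ∀ i, SmoothForm (μ i)
  γ_smooth : ∀ i j, SmoothForm (γ i j)
  σ_smooth : ∀ k l i j, SmoothForm (σ k l i j)
  ε_symm : ∀ i j, ε i j = ε j i
  π_symm : ∀ k i j, π k i j = π k j i
  γ_symm : ∀ i j, γ i j = γ j i
  σ_symm : ∀ k l i j, σ k l i j = σ k l j i
  σ_symm' : ∀ k l i j, σ k l i j = σ l k i j
  σ_omega : ∀ k l i, ∑ j, σ k l i j ⩓ (taut ι).comp (cOmega j) = 0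
  d_theta0 : extD ((taut ι).comp (cTheta0 n)) =
    - ρ ⩓ (taut ι).comp (cTheta0 n)
    - ∑ k, (taut ι).comp (cTheta k) ⩓ (taut ι).comp (cOmega k)
  d_theta : ∀ i, extD ((taut ι).comp (cTheta i)) =
    - β i ⩓ (taut ι).comp (cTheta0 n)
    - ∑ k, α i k ⩓ (taut ι).comp (cTheta k)
    - ∑ k, (taut ι).comp (cTHETA i k) ⩓ (taut ι).comp (cOmega k)
  d_THETA : ∀ i j, extD ((taut ι).comp (cTHETA i j)) =
    - ε i j ⩓ (taut ι).comp (cTheta0 n)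
    - ∑ k, π k i j ⩓ (taut ι).comp (cTheta k)
    - (∑ k, α i k ⩓ (taut ι).comp (cTHETA k j)
        - (1 / 2 : ℝ) • (ρ ⩓ (taut ι).comp (cTHETA i j)))
    + (∑ k, (taut ι).comp (cTHETA i k) ⩓ α j k
        - (1 / 2 : ℝ) • ((taut ι).comp (cTHETA i j) ⩓ ρ))
    + ∑ k, ∑ l, (taut ι).comp (cTHETA k l) ⩓ σ k l i j
  d_omega : ∀ i, extD ((taut ι).comp (cOmega i)) =
    - μ i ⩓ (taut ι).comp (cTheta0 n)
    - ∑ k, γ i k ⩓ (taut ι).comp (cTheta k)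
    + (∑ k, α k i ⩓ (taut ι).comp (cOmega k) - ρ ⩓ (taut ι).comp (cOmega i))

/-- The conditions on a reduction `j : F → P`: with all forms pulled back to `F`,
`T₀ = 0`, `πᵏ_ij ≡ ½ (δ_ik β_j + δ_jk β_i)` and `ε_ij ≡ 0` modulo `θ₀, θ, Θ`. -/
structure SatisfiesReductionConditions {ι : P → CoframeBundle n EZ Z} (ϖ : PseudoConnection (EP := EP) ι)
    (j : F → P) : Prop where
  T0_eq_zero : ∀ a b, ∑ k, ∑ l, (taut (EP := EF) (ι ∘ j)).comp (cTHETA k l)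
    ⩓ pullForm j (ϖ.σ k l a b) = 0
  π_congr : ∀ k a b, ∀ f : F,
    pullForm (E := EF) j (ϖ.π k a b) f
      - (1 / 2 : ℝ) • ((if a = k then pullForm (E := EF) j (ϖ.β b) f else 0)
        + (if b = k then pullForm (E := EF) j (ϖ.β a) f else 0))
      ∈ Submodule.span ℝ (gen2 (taut (EP := EF) (ι ∘ j) f))
  ε_congr : ∀ a b, ∀ f : F,
    pullForm (E := EF) j (ϖ.ε a b) f ∈ Submodule.span ℝ (gen2 (taut (EP := EF) (ι ∘ j) f))

/-- The structure equations of the reduced bundle, for the tautological form of a manifold `F` of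
coframes, `1`-forms `ρ, α, β, μ, γ` and a matrix `T` of `2`-forms:

* `dθ₀ = -ρ ∧ θ₀ - θᵗ ∧ ω`,
* `dθ = -β ∧ θ₀ - α ∧ θ - Θ ∧ ω`,
* `dΘ = -½ (β ∧ θᵗ - θ ∧ βᵗ) - (α - ρ/2) ∧ Θ + Θ ∧ (α - ρ/2)ᵗ + T`,
* `dω = -μ ∧ θ₀ - γ ∧ θ + (αᵗ - ρ) ∧ ω`. -/
structure ReducedStructureEquations (ι : F → CoframeBundle n EZ Z)
    (ρ : OneForm EF F) (α : Fin n → Fin n → OneForm EF F) (β : Fin n → OneForm EF F)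
    (μ : Fin n → OneForm EF F) (γ : Fin n → Fin n → OneForm EF F)
    (T : Fin n → Fin n → TwoForm EF F) : Prop where
  d_theta0 : extD ((taut ι).comp (cTheta0 n)) =
    - ρ ⩓ (taut ι).comp (cTheta0 n)
    - ∑ k, (taut ι).comp (cTheta k) ⩓ (taut ι).comp (cOmega k)
  d_theta : ∀ i, extD ((taut ι).comp (cTheta i)) =
    - β i ⩓ (taut ι).comp (cTheta0 n)
    - ∑ k, α i k ⩓ (taut ι).comp (cTheta k)
    - ∑ k, (taut ι).comp (cTHETA i k) ⩓ (taut ι).comp (cOmega k)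
  d_THETA : ∀ i j, extD ((taut ι).comp (cTHETA i j)) =
    - ((1 / 2 : ℝ) • (β i ⩓ (taut ι).comp (cTheta j) - (taut ι).comp (cTheta i) ⩓ β j))
    - (∑ k, α i k ⩓ (taut ι).comp (cTHETA k j)
        - (1 / 2 : ℝ) • (ρ ⩓ (taut ι).comp (cTHETA i j)))
    + (∑ k, (taut ι).comp (cTHETA i k) ⩓ α j k
        - (1 / 2 : ℝ) • ((taut ι).comp (cTHETA i j) ⩓ ρ))
    + T i j
  d_omega : ∀ i, extD ((taut ι).comp (cOmega i)) =
    - μ i ⩓ (taut ι).comp (cTheta0 n)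
    - ∑ k, γ i k ⩓ (taut ι).comp (cTheta k)
    + (∑ k, α k i ⩓ (taut ι).comp (cOmega k) - ρ ⩓ (taut ι).comp (cOmega i))

end Coframes

/-! ### Conformal classes of symmetric differentials -/

section Conformal

variable {E : Type*} [NormedAddCommGroup E] [NormedSpace ℝ E]
  {M : Type*} [TopologicalSpace M] [ChartedSpace E M]

/-- A field of `k`-linear forms on the tangent spaces of `M`. -/
abbrev MultiForm (k : ℕ) (E M : Type*) [NormedAddCommGroup E] [NormedSpace ℝ E]
    [TopologicalSpace M] [ChartedSpace E M] :=
  ∀ x : M, ContinuousMultilinearMap ℝ (fun _ : Fin k => TangentSpace 𝓘(ℝ, E) x) ℝ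

/-- Smoothness at a point of a field of `k`-linear forms, in the preferred chart at the point. -/
def SmoothMultiFormAt {k : ℕ} (q : MultiForm k E M) (x : M) : Prop :=
  ContDiffAt ℝ ∞ (fun y : E => ((q ((extChartAt 𝓘(ℝ, E) x).symm y)).compContinuousLinearMap
    (fun _ => mfderiv 𝓘(ℝ, E) 𝓘(ℝ, E) (extChartAt 𝓘(ℝ, E) x).symm y) :
      ContinuousMultilinearMap ℝ (fun _ : Fin k => E) ℝ)) (extChartAt 𝓘(ℝ, E) x x)

/-- A conformal class of symmetric `k`-differentials on `M`: a field `ℓ` of lines of `k`-linear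
forms that is locally spanned by a smooth, nowhere zero field of symmetric `k`-linear forms.
Two local spanning fields differ by a nowhere zero function. -/
def IsConformalClass (k : ℕ)
    (ℓ : ∀ x : M, Submodule ℝ
      (ContinuousMultilinearMap ℝ (fun _ : Fin k => TangentSpace 𝓘(ℝ, E) x) ℝ)) : Prop :=
  ∀ x₀ : M, ∃ q : MultiForm k E M, ∀ᶠ x in 𝓝 x₀,
    SmoothMultiFormAt q x ∧ q x ≠ 0 ∧
    (∀ (s : Equiv.Perm (Fin k)) (v : Fin k → TangentSpace 𝓘(ℝ, E) x),
      q x (fun i => v (s i)) = q x v) ∧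
    ℓ x = Submodule.span ℝ {q x}

end Conformal

end LegPath

end

/-!
Let `η` be the symmetric matrix with blocks `2θ₀, θᵗ, θ, Θ`, so that `detEta` is `det η`. The
reduction conditions leave the torsion `T` (`torsion`), the remainder of `-ε ∧ θ₀ - ∑ πᵏ ∧ θ_k`. It is
quadratic in `θ₀, θ, Θ`, because `ε` and the remainder of `πᵏ` are combinations of these forms, and it
lies in the ideal of `θ₀, θ` by its shape. The structure equations of the reduced bundle `F` are then
pull-backs of the given ones (`reducedStructureEquations_torsion`).

Along a vector `v` tangent to the preimages in `F` of the leaves, that is, with `η(v) = 0`, the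
quadratic torsion drops out and the structure equations say
`dη(v, ·) = -(A η + η Aᵗ)`, with `A` made of the blocks `ρ/2, -ω, β/2, α - ρ/2` evaluated at `v`
(`exists_etaMat_vextD_eq`). An infinitesimal congruence multiplies `det η` by a factor, so `det η` is
constant up to a factor along the leaves. This is used in coordinates adapted to the leaves, with a
local section of `F → Z` (`eventually_detEta_eq_mul`, `CoframeReduction.eventually_leafDetProp`).

Over a single point of `Z`, two coframes of `F` differ by an element `h` of the structure group, which
extends to a smooth symmetry of `F`. Since `h` preserves the filtration
`{θ₀} ⊆ {θ₀, θ} ⊆ {θ₀, θ, Θ}`, it acts on `η` by some linear map; since the symmetry preserves the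
tautological form up to `h`, this map intertwines infinitesimal congruences of the above kind with
arbitrary upper right block `-ω`. Linear algebra (`congruence_of_intertwining`) shows that such a map
is `η ↦ a⁻¹ M η Mᵗ`, so `h` rescales `det η` (`exists_detEta_eq_mul`). No connectedness or compactness
of the structure group is needed.

As the leaves are connected, the line spanned by `det η`, as a polynomial on the tangent space of the
space of leaves, depends on the leaf only (`CoframeReduction.leafDetProp_of_leaf_eq`). The
polarizations `polarDet` of `det η` along local sections of `F → X` are smooth spanning fields of the
conformal class. Symmetric multilinear forms are determined by their diagonals (`eq_of_diagonal_eq`),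
and `F → X` is a submersion, whence the uniqueness.
-/

noncomputable section

namespace LegPath

/-- The wedge product of `1`-forms. -/
local infixl:70 " ⩓ " => wedge

/-! ### Pull-back of forms -/

section Pullback

variable {E : Type*} [NormedAddCommGroup E] [NormedSpace ℝ E]
  {M : Type*} [TopologicalSpace M] [ChartedSpace E M]
  {E' : Type*} [NormedAddCommGroup E'] [NormedSpace ℝ E']
  {M' : Type*} [TopologicalSpace M'] [ChartedSpace E' M']
  {E'' : Type*} [NormedAddCommGroup E''] [NormedSpace ℝ E'']
  {M'' : Type*} [TopologicalSpace M''] [ChartedSpace E'' M'']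
  {G : Type*} [NormedAddCommGroup G] [NormedSpace ℝ G]
  {G' : Type*} [NormedAddCommGroup G'] [NormedSpace ℝ G']

theorem mdifferentiableAt_extChartAt_symm_of_mem_target [IsManifold 𝓘(ℝ, E) ∞ M] {x : M} {y : E}
    (hy : y ∈ (extChartAt 𝓘(ℝ, E) x).target) :
    MDifferentiableAt 𝓘(ℝ, E) 𝓘(ℝ, E) (extChartAt 𝓘(ℝ, E) x).symm y := by
  have := mdifferentiableWithinAt_extChartAt_symm (I := 𝓘(ℝ, E)) hy
  rwa [ModelWithCorners.range_eq_univ, mdifferentiableWithinAt_univ] at this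

/-- The chain rule for `g` written in the preferred charts, at all points near the base point. -/
theorem eventually_mfderiv_comp_extChartAt_symm [IsManifold 𝓘(ℝ, E) ∞ M]
    [IsManifold 𝓘(ℝ, E') ∞ M'] {g : M → M'} {x : M}
    (hg : ContMDiffAt 𝓘(ℝ, E) 𝓘(ℝ, E') ∞ g x) :
    ∀ᶠ y in 𝓝 (extChartAt 𝓘(ℝ, E) x x),
      g ((extChartAt 𝓘(ℝ, E) x).symm y) ∈ (extChartAt 𝓘(ℝ, E') (g x)).source ∧
      ∀ v : E, (mfderiv 𝓘(ℝ, E) 𝓘(ℝ, E') g ((extChartAt 𝓘(ℝ, E) x).symm y)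
          (mfderiv 𝓘(ℝ, E) 𝓘(ℝ, E) (extChartAt 𝓘(ℝ, E) x).symm y v) : E') =
        mfderiv 𝓘(ℝ, E') 𝓘(ℝ, E') (extChartAt 𝓘(ℝ, E') (g x)).symm
          (writtenInExtChartAt 𝓘(ℝ, E) 𝓘(ℝ, E') x g y)
            (fderiv ℝ (writtenInExtChartAt 𝓘(ℝ, E) 𝓘(ℝ, E') x g) y v) := by
  set χ := extChartAt 𝓘(ℝ, E) x with hχ
  set χ' := extChartAt 𝓘(ℝ, E') (g x) with hχ'
  have hg1 : ∀ᶠ z in 𝓝 x, MDifferentiableAt 𝓘(ℝ, E) 𝓘(ℝ, E') g z := by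
    have h1 : ContMDiffAt 𝓘(ℝ, E) 𝓘(ℝ, E') 1 g x := hg.of_le (by simp)
    filter_upwards [(contMDiffAt_iff_contMDiffAt_nhds (by simp)).1 h1] with z hz
    exact hz.mdifferentiableAt (by simp)
  have hcont : ContinuousAt χ.symm (χ x) := continuousAt_extChartAt_symm x
  have hxx : χ.symm (χ x) = x := extChartAt_to_inv x
  have hsrc : ∀ᶠ z in 𝓝 x, z ∈ χ.source ∧ g z ∈ χ'.source :=
    Filter.Eventually.and (extChartAt_source_mem_nhds x)
      (hg.continuousAt.eventually (extChartAt_source_mem_nhds (I := 𝓘(ℝ, E')) (g x)))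
  have htgt : ∀ᶠ y in 𝓝 (χ x), y ∈ χ.target := extChartAt_target_mem_nhds x
  have hpre : ∀ᶠ y in 𝓝 (χ x), MDifferentiableAt 𝓘(ℝ, E) 𝓘(ℝ, E') g (χ.symm y) ∧
      g (χ.symm y) ∈ χ'.source := by
    refine hcont.eventually (p := fun z => MDifferentiableAt 𝓘(ℝ, E) 𝓘(ℝ, E') g z ∧
      g z ∈ χ'.source) ?_
    rw [hxx]
    exact hg1.and (hsrc.mono fun z hz => hz.2)
  filter_upwards [hpre, htgt, hpre.eventually_nhds] with y hy hyt hyn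
  have hsymm := mdifferentiableAt_extChartAt_symm_of_mem_target (M := M) hyt
  have hgy : writtenInExtChartAt 𝓘(ℝ, E) 𝓘(ℝ, E') x g y = χ' (g (χ.symm y)) := rfl
  have hright : χ'.symm (writtenInExtChartAt 𝓘(ℝ, E) 𝓘(ℝ, E') x g y) = g (χ.symm y) := by
    rw [hgy]; exact χ'.left_inv hy.2
  have htgt' : writtenInExtChartAt 𝓘(ℝ, E) 𝓘(ℝ, E') x g y ∈ χ'.target := by
    rw [hgy]; exact χ'.map_source hy.2
  have hchart' : MDifferentiableAt 𝓘(ℝ, E') 𝓘(ℝ, E') χ' (g (χ.symm y)) :=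
    mdifferentiableAt_extChartAt (by rw [← extChartAt_source 𝓘(ℝ, E')]; exact hy.2)
  have hcomp : MDifferentiableAt 𝓘(ℝ, E) 𝓘(ℝ, E') (fun y => g (χ.symm y)) y :=
    MDifferentiableAt.comp (I' := 𝓘(ℝ, E)) (g := g) y hy.1 hsymm
  have hwr : MDifferentiableAt 𝓘(ℝ, E) 𝓘(ℝ, E')
      (writtenInExtChartAt 𝓘(ℝ, E) 𝓘(ℝ, E') x g) y :=
    MDifferentiableAt.comp (I' := 𝓘(ℝ, E')) (g := χ') y hchart' hcomp
  have hd1 : mfderiv 𝓘(ℝ, E) 𝓘(ℝ, E') (fun y => g (χ.symm y)) y =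
      (mfderiv 𝓘(ℝ, E) 𝓘(ℝ, E') g (χ.symm y)).comp (mfderiv 𝓘(ℝ, E) 𝓘(ℝ, E) χ.symm y) :=
    mfderiv_comp (I' := 𝓘(ℝ, E)) (g := g) y hy.1 hsymm
  have hd2 : mfderiv 𝓘(ℝ, E) 𝓘(ℝ, E')
        (fun y => χ'.symm (writtenInExtChartAt 𝓘(ℝ, E) 𝓘(ℝ, E') x g y)) y =
      (mfderiv 𝓘(ℝ, E') 𝓘(ℝ, E') χ'.symm (writtenInExtChartAt 𝓘(ℝ, E) 𝓘(ℝ, E') x g y)).comp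
        (mfderiv 𝓘(ℝ, E) 𝓘(ℝ, E') (writtenInExtChartAt 𝓘(ℝ, E) 𝓘(ℝ, E') x g) y) :=
    mfderiv_comp (I' := 𝓘(ℝ, E')) (g := χ'.symm) y
      (mdifferentiableAt_extChartAt_symm_of_mem_target (M := M') htgt') hwr
  have heq : (fun y => χ'.symm (writtenInExtChartAt 𝓘(ℝ, E) 𝓘(ℝ, E') x g y)) =ᶠ[𝓝 y]
      fun y => g (χ.symm y) := by
    filter_upwards [hyn] with w hw using χ'.left_inv hw.2
  have hd3 := heq.mfderiv_eq (I := 𝓘(ℝ, E)) (I' := 𝓘(ℝ, E'))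
  rw [mfderiv_eq_fderiv] at hd2
  exact ⟨hy.2, fun v => congrArg (fun l : E →L[ℝ] E' => l v)
    (hd1.symm.trans (hd3.symm.trans hd2))⟩

/-- In the preferred charts, the pull-back of a form is the usual one of vector calculus. -/
theorem coordForm_pullForm_eventuallyEq [IsManifold 𝓘(ℝ, E) ∞ M] [IsManifold 𝓘(ℝ, E') ∞ M']
    {g : M → M'} {x : M} (hg : ContMDiffAt 𝓘(ℝ, E) 𝓘(ℝ, E') ∞ g x) (φ : VForm E' M' G) :
    coordForm x (pullForm (E := E) g φ) =ᶠ[𝓝 (extChartAt 𝓘(ℝ, E) x x)] fun y =>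
      (coordForm (g x) φ (writtenInExtChartAt 𝓘(ℝ, E) 𝓘(ℝ, E') x g y)).comp
        (fderiv ℝ (writtenInExtChartAt 𝓘(ℝ, E) 𝓘(ℝ, E') x g) y) := by
  filter_upwards [eventually_mfderiv_comp_extChartAt_symm hg] with y hy
  have hright : (extChartAt 𝓘(ℝ, E') (g x)).symm (writtenInExtChartAt 𝓘(ℝ, E) 𝓘(ℝ, E') x g y) =
      g ((extChartAt 𝓘(ℝ, E) x).symm y) :=
    (extChartAt 𝓘(ℝ, E') (g x)).left_inv hy.1
  let φ' : M' → (E' →L[ℝ] G) := φ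
  let d₁ : E →L[ℝ] E' := (mfderiv 𝓘(ℝ, E) 𝓘(ℝ, E') g ((extChartAt 𝓘(ℝ, E) x).symm y)).comp
    (mfderiv 𝓘(ℝ, E) 𝓘(ℝ, E) (extChartAt 𝓘(ℝ, E) x).symm y)
  let d₂ : E' →L[ℝ] E' := mfderiv 𝓘(ℝ, E') 𝓘(ℝ, E') (extChartAt 𝓘(ℝ, E') (g x)).symm
    (writtenInExtChartAt 𝓘(ℝ, E) 𝓘(ℝ, E') x g y)
  have hd : d₁ = d₂.comp (fderiv ℝ (writtenInExtChartAt 𝓘(ℝ, E) 𝓘(ℝ, E') x g) y) :=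
    ContinuousLinearMap.ext hy.2
  change (φ' (g ((extChartAt 𝓘(ℝ, E) x).symm y))).comp d₁ =
    (φ' ((extChartAt 𝓘(ℝ, E') (g x)).symm (writtenInExtChartAt 𝓘(ℝ, E) 𝓘(ℝ, E') x g y))).comp
      (d₂.comp (fderiv ℝ (writtenInExtChartAt 𝓘(ℝ, E) 𝓘(ℝ, E') x g) y))
  rw [hright, hd]

theorem contDiffAt_writtenInExtChartAt {g : M → M'} {x : M}
    (hg : ContMDiffAt 𝓘(ℝ, E) 𝓘(ℝ, E') ∞ g x) :
    ContDiffAt ℝ ∞ (writtenInExtChartAt 𝓘(ℝ, E) 𝓘(ℝ, E') x g) (extChartAt 𝓘(ℝ, E) x x) := by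
  have := (contMDiffAt_iff.1 hg).2
  rwa [ModelWithCorners.range_eq_univ, contDiffWithinAt_univ] at this

theorem SmoothFormAt.pullForm [IsManifold 𝓘(ℝ, E) ∞ M] [IsManifold 𝓘(ℝ, E') ∞ M']
    {g : M → M'} {x : M} (hg : ContMDiffAt 𝓘(ℝ, E) 𝓘(ℝ, E') ∞ g x) {φ : VForm E' M' G}
    (hφ : SmoothFormAt φ (g x)) : SmoothFormAt (pullForm (E := E) g φ) x := by
  have hw := contDiffAt_writtenInExtChartAt hg
  have hval : writtenInExtChartAt 𝓘(ℝ, E) 𝓘(ℝ, E') x g (extChartAt 𝓘(ℝ, E) x x) =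
      extChartAt 𝓘(ℝ, E') (g x) (g x) := by
    simp [writtenInExtChartAt]
  refine ContDiffAt.congr_of_eventuallyEq ?_ (coordForm_pullForm_eventuallyEq hg φ)
  refine ContDiffAt.clm_comp ?_ (hw.fderiv_right (by simp))
  refine ContDiffAt.comp (g := coordForm (g x) φ) _ ?_ hw
  rw [hval]
  exact hφ

/-- The exterior derivative commutes with pull-backs. -/
theorem extD_pullForm [IsManifold 𝓘(ℝ, E) ∞ M] [IsManifold 𝓘(ℝ, E') ∞ M']
    {g : M → M'} {x : M} (hg : ContMDiffAt 𝓘(ℝ, E) 𝓘(ℝ, E') ∞ g x) {φ : OneForm E' M'}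
    (hφ : SmoothFormAt φ (g x)) (v w : TangentSpace 𝓘(ℝ, E) x) :
    extD (pullForm (E := E) g φ) x v w =
      extD φ (g x) (mfderiv 𝓘(ℝ, E) 𝓘(ℝ, E') g x v) (mfderiv 𝓘(ℝ, E) 𝓘(ℝ, E') g x w) := by
  have hw := contDiffAt_writtenInExtChartAt hg
  have hval : writtenInExtChartAt 𝓘(ℝ, E) 𝓘(ℝ, E') x g (extChartAt 𝓘(ℝ, E) x x) =
      extChartAt 𝓘(ℝ, E') (g x) (g x) := by
    simp [writtenInExtChartAt]
  have hmf : mfderiv 𝓘(ℝ, E) 𝓘(ℝ, E') g x =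
      fderiv ℝ (writtenInExtChartAt 𝓘(ℝ, E) 𝓘(ℝ, E') x g) (extChartAt 𝓘(ℝ, E) x x) := by
    have h1 := (hg.mdifferentiableAt (by simp)).mfderiv
    rwa [ModelWithCorners.range_eq_univ, fderivWithin_univ] at h1
  set γ := writtenInExtChartAt 𝓘(ℝ, E) 𝓘(ℝ, E') x g with hγ
  set y := extChartAt 𝓘(ℝ, E) x x with hy
  have hφ' : DifferentiableAt ℝ (coordForm (g x) φ) (γ y) := by
    rw [hval]; exact ContDiffAt.differentiableAt hφ (by simp)
  have hγd : DifferentiableAt ℝ γ y := hw.differentiableAt (by simp)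
  have hγ2 : DifferentiableAt ℝ (fderiv ℝ γ) y :=
    (hw.fderiv_right (m := ∞) (by simp)).differentiableAt (by simp)
  have hsymm : IsSymmSndFDerivAt ℝ γ y := hw.isSymmSndFDerivAt
    (by simpa using WithTop.coe_le_coe.2 (le_top : (2 : ℕ∞) ≤ ⊤))
  have key : ∀ v w : E, fderiv ℝ (coordForm x (pullForm (E := E) g φ)) y v w =
      fderiv ℝ (coordForm (g x) φ) (γ y) (fderiv ℝ γ y v) (fderiv ℝ γ y w)
        + coordForm (g x) φ (γ y) (fderiv ℝ (fderiv ℝ γ) y v w) := by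
    intro v w
    have h1 : HasFDerivAt (fun y => coordForm (g x) φ (γ y))
        ((fderiv ℝ (coordForm (g x) φ) (γ y)).comp (fderiv ℝ γ y)) y :=
      HasFDerivAt.comp (g := coordForm (g x) φ) y hφ'.hasFDerivAt hγd.hasFDerivAt
    have h2 := (h1.clm_comp hγ2.hasFDerivAt).fderiv
    rw [(coordForm_pullForm_eventuallyEq hg φ).fderiv_eq, h2]
    simp [add_comm]
  have key' : ∀ v w : E, fderiv ℝ (coordForm x (LegPath.pullForm (E := E) g φ)) y v w
      - fderiv ℝ (coordForm x (LegPath.pullForm (E := E) g φ)) y w v =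
      fderiv ℝ (coordForm (g x) φ) (γ y) (fderiv ℝ γ y v) (fderiv ℝ γ y w) -
      fderiv ℝ (coordForm (g x) φ) (γ y) (fderiv ℝ γ y w) (fderiv ℝ γ y v) := by
    intro v w
    -- the second derivative of `g` is symmetric, so it drops out of the alternation
    rw [key, key, hsymm w v]
    ring
  rw [hmf]
  refine (key' v w).trans ?_
  rw [hval]
  rfl

theorem SmoothFormAt.clm_comp (l : G →L[ℝ] G') {φ : VForm E M G} {x : M} (h : SmoothFormAt φ x) :
    SmoothFormAt (φ.comp l) x :=
  ContDiffAt.clm_comp (f := fun y => coordForm x φ y) contDiffAt_const h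

theorem fderiv_coordForm_comp (l : G →L[ℝ] G') {φ : VForm E M G} {x : M} (h : SmoothFormAt φ x)
    (v w : E) :
    fderiv ℝ (coordForm x (φ.comp l)) (extChartAt 𝓘(ℝ, E) x x) v w =
      l (fderiv ℝ (coordForm x φ) (extChartAt 𝓘(ℝ, E) x x) v w) := by
  have h1 : HasFDerivAt (fun y => l.comp (coordForm x φ y))
      _ (extChartAt 𝓘(ℝ, E) x x) :=
    (hasFDerivAt_const l _).clm_comp (ContDiffAt.differentiableAt h (by simp)).hasFDerivAt
  have h2 : coordForm x (φ.comp l) = fun y => l.comp (coordForm x φ y) := rfl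
  rw [h2, h1.fderiv]
  simp

/-- The exterior derivative of a vector valued `1`-form. -/
def vextD (φ : VForm E M G) (x : M) (v w : TangentSpace 𝓘(ℝ, E) x) : G :=
  fderiv ℝ (coordForm x φ) (extChartAt 𝓘(ℝ, E) x x) v w
    - fderiv ℝ (coordForm x φ) (extChartAt 𝓘(ℝ, E) x x) w v

theorem extD_comp (l : G →L[ℝ] ℝ) {φ : VForm E M G} {x : M} (h : SmoothFormAt φ x)
    (v w : TangentSpace 𝓘(ℝ, E) x) : extD (φ.comp l) x v w = l (vextD φ x v w) := by
  simp only [vextD, map_sub]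
  exact congrArg₂ (· - ·) (fderiv_coordForm_comp l h v w) (fderiv_coordForm_comp l h w v)

end Pullback

/-! ### Manifolds of coframes -/

section CoframeManifolds

variable {n : ℕ}
  {EZ : Type*} [NormedAddCommGroup EZ] [NormedSpace ℝ EZ]
  {Z : Type*} [TopologicalSpace Z] [ChartedSpace EZ Z] [IsManifold 𝓘(ℝ, EZ) ∞ Z]
  {EP : Type*} [NormedAddCommGroup EP] [NormedSpace ℝ EP]
  {P : Type*} [TopologicalSpace P] [ChartedSpace EP P]
  {EF : Type*} [NormedAddCommGroup EF] [NormedSpace ℝ EF]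
  {F : Type*} [TopologicalSpace F] [ChartedSpace EF F]

/-- A map to the coframe bundle is smooth at `x` when its base point is smooth and its coframe, read in
the tangent coordinates at `(ι x).1`, is smooth. -/
theorem contMDiffAt_coframeBundle_iff {ι : P → CoframeBundle n EZ Z} {x : P} :
    ContMDiffAt 𝓘(ℝ, EP) (coframeI n EZ) ∞ ι x ↔
      ContMDiffAt 𝓘(ℝ, EP) 𝓘(ℝ, EZ) ∞ (fun f => (ι f).1) x ∧
      ContMDiffAt 𝓘(ℝ, EP) 𝓘(ℝ, EZ →L[ℝ] CoframeModel n) ∞ (fun f =>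
        ((ι f).2 : EZ →L[ℝ] CoframeModel n).comp
          ((trivializationAt EZ (TangentSpace 𝓘(ℝ, EZ)) (ι x).1).symmL ℝ (ι f).1 :
            EZ →L[ℝ] EZ)) x := by
  rw [contMDiffAt_hom_bundle]
  refine and_congr_right fun _ => ?_
  have : (fun f => ContinuousLinearMap.inCoordinates EZ (TangentSpace 𝓘(ℝ, EZ)) (CoframeModel n)
        (fun _ : Z => CoframeModel n) (ι x).1 (ι f).1 (ι x).1 (ι f).1 (ι f).2) = (fun f =>
        ((ι f).2 : EZ →L[ℝ] CoframeModel n).comp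
          ((trivializationAt EZ (TangentSpace 𝓘(ℝ, EZ)) (ι x).1).symmL ℝ (ι f).1 :
            EZ →L[ℝ] EZ)) := by
    funext f
    unfold ContinuousLinearMap.inCoordinates
    ext v
    simp
  rw [this]

theorem smoothFormAt_taut [IsManifold 𝓘(ℝ, EP) ∞ P] {ι : P → CoframeBundle n EZ Z} {x : P}
    (hι : ContMDiffAt 𝓘(ℝ, EP) (coframeI n EZ) ∞ ι x) : SmoothFormAt (taut (EP := EP) ι) x := by
  obtain ⟨hπ, hu⟩ := contMDiffAt_coframeBundle_iff.1 hι
  have hcu := (contMDiffAt_iff.1 hu).2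
  rw [ModelWithCorners.range_eq_univ, contDiffWithinAt_univ] at hcu
  refine ContDiffAt.congr_of_eventuallyEq (hcu.clm_comp
    ((contDiffAt_writtenInExtChartAt hπ).fderiv_right (m := ∞) (by simp))) ?_
  filter_upwards [eventually_mfderiv_comp_extChartAt_symm hπ] with y hy
  have hsrc : (ι ((extChartAt 𝓘(ℝ, EP) x).symm y)).1 ∈ (chartAt EZ (ι x).1).source := by
    rw [← extChartAt_source 𝓘(ℝ, EZ)]; exact hy.1
  have hs : ((trivializationAt EZ (TangentSpace 𝓘(ℝ, EZ)) (ι x).1).symmL ℝ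
      (ι ((extChartAt 𝓘(ℝ, EP) x).symm y)).1 : EZ →L[ℝ] EZ) =
      mfderiv 𝓘(ℝ, EZ) 𝓘(ℝ, EZ) (extChartAt 𝓘(ℝ, EZ) (ι x).1).symm
        (writtenInExtChartAt 𝓘(ℝ, EP) 𝓘(ℝ, EZ) x (fun f => (ι f).1) y) := by
    have := TangentBundle.symmL_trivializationAt (I := 𝓘(ℝ, EZ)) hsrc
    rw [ModelWithCorners.range_eq_univ, mfderivWithin_univ] at this
    exact this
  refine ContinuousLinearMap.ext fun v => ?_
  refine Eq.trans (b := ((ι ((extChartAt 𝓘(ℝ, EP) x).symm y)).2 : EZ →L[ℝ] CoframeModel n) _)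
    (congrArg ((ι ((extChartAt 𝓘(ℝ, EP) x).symm y)).2 : EZ →L[ℝ] CoframeModel n) (hy.2 v)) ?_
  rw [← hs]
  rfl

omit [IsManifold 𝓘(ℝ, EZ) ∞ Z] in
theorem pullForm_taut {ι : P → CoframeBundle n EZ Z} {j : F → P} {x : F}
    (hι : MDifferentiableAt 𝓘(ℝ, EP) 𝓘(ℝ, EZ) (fun p => (ι p).1) (j x))
    (hj : MDifferentiableAt 𝓘(ℝ, EF) 𝓘(ℝ, EP) j x) :
    pullForm (E := EF) j (taut (EP := EP) ι) x = taut (EP := EF) (ι ∘ j) x := by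
  have h : mfderiv 𝓘(ℝ, EF) 𝓘(ℝ, EZ) (fun f' => ((ι ∘ j) f').1) x =
      (mfderiv 𝓘(ℝ, EP) 𝓘(ℝ, EZ) (fun p => (ι p).1) (j x)).comp (mfderiv 𝓘(ℝ, EF) 𝓘(ℝ, EP) j x) :=
    mfderiv_comp x hι hj
  simp only [taut, pullForm]
  rw [h]
  rfl

/-- A linear transformation of the coframes acts smoothly on the coframe bundle. -/
theorem contMDiffAt_coframeBundle_comp {ι : P → CoframeBundle n EZ Z} {x : P}
    (hι : ContMDiffAt 𝓘(ℝ, EP) (coframeI n EZ) ∞ ι x) (h : CoframeModel n →L[ℝ] CoframeModel n) :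
    ContMDiffAt 𝓘(ℝ, EP) (coframeI n EZ) ∞
      (fun f => (⟨(ι f).1, h.comp (ι f).2⟩ : CoframeBundle n EZ Z)) x := by
  obtain ⟨hπ, hu⟩ := contMDiffAt_coframeBundle_iff.1 hι
  refine contMDiffAt_coframeBundle_iff.2 ⟨hπ, ?_⟩
  exact ContMDiffAt.clm_comp (F₁ := CoframeModel n) (F₂ := EZ) (F₃ := CoframeModel n)
    (g := fun _ => h) contMDiffAt_const hu

end CoframeManifolds

/-! ### Submersions -/

section Submersions

universe u

variable {E : Type u} [NormedAddCommGroup E] [NormedSpace ℝ E]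
  {M : Type*} [TopologicalSpace M] [ChartedSpace E M]
  {E' : Type*} [NormedAddCommGroup E'] [NormedSpace ℝ E']
  {M' : Type*} [TopologicalSpace M'] [ChartedSpace E' M']

/-- Adapted coordinates near a point `x` at which `g : M → M'` is a submersion: mutually inverse
coordinate systems `Φ`, `Ψ` of `M` near `x` and `κ'`, `κ` of `M'` near `g x` in which `g` is the
first projection. -/
structure SubmersionCoords (g : M → M') (x : M) (C : Type u) [NormedAddCommGroup C]
    [NormedSpace ℝ C] where
  /-- the parametrization of `M` -/
  Φ : E' × C → M
  /-- the coordinates on `M` -/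
  Ψ : M → E' × C
  /-- the coordinates on `M'` -/
  κ : M' → E'
  /-- the parametrization of `M'` -/
  κ' : E' → M'
  contMDiffAt_Φ : ∀ᶠ q in 𝓝 (Ψ x), ContMDiffAt 𝓘(ℝ, E' × C) 𝓘(ℝ, E) ∞ Φ q
  continuousAt_Ψ : ContinuousAt Ψ x
  contMDiffAt_κ : ∀ᶠ y in 𝓝 (g x), ContMDiffAt 𝓘(ℝ, E') 𝓘(ℝ, E') ∞ κ y
  contMDiffAt_κ' : ∀ᶠ e in 𝓝 (κ (g x)), ContMDiffAt 𝓘(ℝ, E') 𝓘(ℝ, E') ∞ κ' e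
  Φ_Ψ : ∀ᶠ z in 𝓝 x, Φ (Ψ z) = z
  κ'_κ : ∀ᶠ y in 𝓝 (g x), κ' (κ y) = y
  κ_κ' : ∀ᶠ e in 𝓝 (κ (g x)), κ (κ' e) = e
  Ψ_fst : ∀ᶠ z in 𝓝 x, (Ψ z).1 = κ (g z)
  g_Φ : ∀ᶠ q in 𝓝 (Ψ x), g (Φ q) = κ' q.1

theorem exists_submersionCoords [IsManifold 𝓘(ℝ, E) ∞ M] [IsManifold 𝓘(ℝ, E') ∞ M']
    {g : M → M'} {x : M} (h : Manifold.IsSubmersionAt 𝓘(ℝ, E) 𝓘(ℝ, E') ∞ g x) :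
    ∃ (C : Type u) (_ : NormedAddCommGroup C) (_ : NormedSpace ℝ C),
      Nonempty (SubmersionCoords (E := E) (E' := E') g x C) := by
  refine ⟨h.complement, inferInstance, inferInstance, ⟨?_⟩⟩
  have hdsrc : h.domChart.source ∈ 𝓝 x := h.domChart.open_source.mem_nhds h.mem_domChart_source
  have hcsrc : h.codChart.source ∈ 𝓝 (g x) :=
    h.codChart.open_source.mem_nhds h.mem_codChart_source
  have hdt : h.domChart.target ∈ 𝓝 (h.domChart x) :=
    h.domChart.open_target.mem_nhds (h.domChart.map_source h.mem_domChart_source)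
  have hct : h.codChart.target ∈ 𝓝 (h.codChart (g x)) :=
    h.codChart.open_target.mem_nhds (h.codChart.map_source h.mem_codChart_source)
  have hwr : ∀ v ∈ h.domChart.target,
      h.codChart (g (h.domChart.symm v)) = (h.equiv v).1 := by
    intro v hv
    have hv' : v ∈ (h.domChart.extend 𝓘(ℝ, E)).target := by simpa using hv
    have := h.writtenInCharts hv'
    simpa using this
  have hwr' : ∀ v ∈ h.domChart.target,
      g (h.domChart.symm v) = h.codChart.symm (h.equiv v).1 := by
    intro v hv
    rw [← hwr v hv, h.codChart.left_inv]
    exact h.source_subset_preimage_source (h.domChart.map_target hv)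
  have hcontΨ : ContinuousAt (fun z => h.equiv (h.domChart z)) x :=
    h.equiv.continuous.continuousAt.comp (h.domChart.continuousAt h.mem_domChart_source)
  have hes : ContinuousAt h.equiv.symm (h.equiv (h.domChart x)) :=
    h.equiv.symm.continuous.continuousAt
  have hpre : ∀ᶠ q in 𝓝 (h.equiv (h.domChart x)), h.equiv.symm q ∈ h.domChart.target := by
    refine hes.eventually (p := fun v => v ∈ h.domChart.target) ?_
    simpa using hdt
  exact
    { Φ := fun q => h.domChart.symm (h.equiv.symm q)
      Ψ := fun z => h.equiv (h.domChart z)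
      κ := h.codChart
      κ' := h.codChart.symm
      contMDiffAt_Φ := by
        filter_upwards [hpre] with q hq
        have h1 := contMDiffAt_symm_of_mem_maximalAtlas h.domChart_mem_maximalAtlas hq
        exact h1.comp q h.equiv.symm.contDiff.contDiffAt.contMDiffAt
      continuousAt_Ψ := hcontΨ
      contMDiffAt_κ := by
        filter_upwards [hcsrc] with y hy
        exact contMDiffAt_of_mem_maximalAtlas h.codChart_mem_maximalAtlas hy
      contMDiffAt_κ' := by
        filter_upwards [hct] with y hy
        exact contMDiffAt_symm_of_mem_maximalAtlas h.codChart_mem_maximalAtlas hy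
      Φ_Ψ := by
        filter_upwards [hdsrc] with z hz
        simp [h.domChart.left_inv hz]
      κ'_κ := by
        filter_upwards [hcsrc] with y hy using h.codChart.left_inv hy
      κ_κ' := by
        filter_upwards [hct] with y hy using h.codChart.right_inv hy
      Ψ_fst := by
        filter_upwards [hdsrc] with z hz
        rw [← hwr _ (h.domChart.map_source hz), h.domChart.left_inv hz]
      g_Φ := by
        filter_upwards [hpre] with q hq
        rw [hwr' _ hq]
        simp }

namespace SubmersionCoords

variable {g : M → M'} {x : M} {C : Type u} [NormedAddCommGroup C] [NormedSpace ℝ C]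
  (S : SubmersionCoords (E := E) (E' := E') g x C)

include S in
theorem exists_section : ∃ s : M' → M,
    (∀ᶠ y in 𝓝 (g x), ContMDiffAt 𝓘(ℝ, E') 𝓘(ℝ, E) ∞ s y ∧ g (s y) = y) ∧ s (g x) = x := by
  have h1 : (S.κ (g x), (S.Ψ x).2) = S.Ψ x := by
    rw [← S.Ψ_fst.self_of_nhds]
  have hκ : ContMDiffAt 𝓘(ℝ, E') 𝓘(ℝ, E') ∞ S.κ (g x) := S.contMDiffAt_κ.self_of_nhds
  have hc : ContinuousAt (fun y => (S.κ y, (S.Ψ x).2)) (g x) :=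
    hκ.continuousAt.prodMk continuousAt_const
  refine ⟨fun y => S.Φ (S.κ y, (S.Ψ x).2), ?_, ?_⟩
  · have hΦ := S.contMDiffAt_Φ
    have hg := S.g_Φ
    rw [← h1] at hΦ hg
    filter_upwards [hc.eventually hΦ, hc.eventually hg, S.contMDiffAt_κ, S.κ'_κ] with y h1 h2 h3 h4
    refine ⟨?_, h2.trans h4⟩
    have h5 : ContMDiffAt 𝓘(ℝ, E') 𝓘(ℝ, E' × C) ∞ (fun y => (S.κ y, (S.Ψ x).2)) y :=
      h3.prodMk_space contMDiffAt_const
    exact h1.comp y h5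
  · change S.Φ (S.κ (g x), (S.Ψ x).2) = x
    rw [h1]
    exact S.Φ_Ψ.self_of_nhds

end SubmersionCoords

theorem exists_local_section [IsManifold 𝓘(ℝ, E) ∞ M] [IsManifold 𝓘(ℝ, E') ∞ M']
    {g : M → M'} {x : M} (h : Manifold.IsSubmersionAt 𝓘(ℝ, E) 𝓘(ℝ, E') ∞ g x) : ∃ s : M' → M,
    (∀ᶠ y in 𝓝 (g x), ContMDiffAt 𝓘(ℝ, E') 𝓘(ℝ, E) ∞ s y ∧ g (s y) = y) ∧ s (g x) = x := by
  obtain ⟨C, _, _, ⟨S⟩⟩ := exists_submersionCoords h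
  exact S.exists_section

theorem mfderiv_mfderiv_of_section {g : M → M'} {s : M' → M} {y : M'}
    (hg : MDifferentiableAt 𝓘(ℝ, E) 𝓘(ℝ, E') g (s y))
    (hs : MDifferentiableAt 𝓘(ℝ, E') 𝓘(ℝ, E) s y) (h : ∀ᶠ y' in 𝓝 y, g (s y') = y')
    (v : TangentSpace 𝓘(ℝ, E') y) :
    mfderiv 𝓘(ℝ, E) 𝓘(ℝ, E') g (s y) (mfderiv 𝓘(ℝ, E') 𝓘(ℝ, E) s y v) = v := by
  have h1 : mfderiv 𝓘(ℝ, E') 𝓘(ℝ, E') (fun y' => g (s y')) y =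
      (mfderiv 𝓘(ℝ, E) 𝓘(ℝ, E') g (s y)).comp (mfderiv 𝓘(ℝ, E') 𝓘(ℝ, E) s y) :=
    mfderiv_comp y hg hs
  have h2 : (fun y' => g (s y')) =ᶠ[𝓝 y] id := h
  have h3 := h2.mfderiv_eq (I := 𝓘(ℝ, E')) (I' := 𝓘(ℝ, E'))
  have h4 := h1.symm.trans (h3.trans mfderiv_id)
  exact congrArg (fun l : E' →L[ℝ] E' => l v) h4

theorem surjective_mfderiv_of_isSubmersionAt [IsManifold 𝓘(ℝ, E) ∞ M]
    [IsManifold 𝓘(ℝ, E') ∞ M'] {g : M → M'} {x : M}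
    (h : Manifold.IsSubmersionAt 𝓘(ℝ, E) 𝓘(ℝ, E') ∞ g x) :
    Function.Surjective (mfderiv 𝓘(ℝ, E) 𝓘(ℝ, E') g x) := by
  obtain ⟨s, hs, hsx⟩ := exists_local_section h
  intro v
  have hg : MDifferentiableAt 𝓘(ℝ, E) 𝓘(ℝ, E') g (s (g x)) := by
    rw [hsx]; exact h.contMDiffAt.mdifferentiableAt (by simp)
  have := mfderiv_mfderiv_of_section hg (hs.self_of_nhds.1.mdifferentiableAt (by simp))
    (hs.mono fun _ h => h.2) v
  rw [hsx] at this
  exact ⟨_, this⟩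

end Submersions

/-! ### Linear algebra of the change of coframe -/

section Algebra

open Matrix

variable {n : ℕ}

/-- A matrix `D` with `|u|² D = -c (D u uᵗ + u (D u)ᵗ)` for some `c > 0` and `u ≠ 0` vanishes:
applying both sides to `u`, twice, gives `D u = 0`. -/
theorem eq_zero_of_dotProduct_smul_eq {D : Matrix (Fin n) (Fin n) ℝ} {u : Fin n → ℝ} (hu : u ≠ 0)
    {c : ℝ} (hc : 0 < c)
    (h : (u ⬝ᵥ u) • D = -c • (vecMulVec (D *ᵥ u) u + vecMulVec u (D *ᵥ u))) : D = 0 := by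
  have hU : 0 < u ⬝ᵥ u := by
    have := dotProduct_star_self_pos_iff (v := u)
    simpa using this.2 hu
  have h1 : (u ⬝ᵥ u) • (D *ᵥ u) =
      -c • ((u ⬝ᵥ u) • (D *ᵥ u) + ((D *ᵥ u) ⬝ᵥ u) • u) := by
    have := congrArg (fun N : Matrix (Fin n) (Fin n) ℝ => N *ᵥ u) h
    rw [smul_mulVec, smul_mulVec, add_mulVec, vecMulVec_mulVec, vecMulVec_mulVec] at this
    simpa only [op_smul_eq_smul] using this
  have h2 : (u ⬝ᵥ u) * ((D *ᵥ u) ⬝ᵥ u) =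
      -c * ((u ⬝ᵥ u) * ((D *ᵥ u) ⬝ᵥ u) + ((D *ᵥ u) ⬝ᵥ u) * (u ⬝ᵥ u)) := by
    have := congrArg (fun z : Fin n → ℝ => z ⬝ᵥ u) h1
    simpa only [smul_dotProduct, add_dotProduct, smul_eq_mul] using this
  have h3 : (D *ᵥ u) ⬝ᵥ u = 0 := by
    have : ((1 + 2 * c) * (u ⬝ᵥ u)) * ((D *ᵥ u) ⬝ᵥ u) = 0 := by linear_combination h2
    exact (mul_eq_zero.1 this).resolve_left (by positivity)
  have h4 : D *ᵥ u = 0 := by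
    rw [h3, zero_smul, add_zero, smul_smul] at h1
    have : ((1 + c) * (u ⬝ᵥ u)) • (D *ᵥ u) = 0 := by
      have h5 := sub_eq_zero.2 h1
      rw [← sub_smul] at h5
      rw [← h5]
      congr 1
      ring
    exact (smul_eq_zero.1 this).resolve_left (by positivity)
  rw [h4] at h
  simp only [zero_vecMulVec, vecMulVec_zero, add_zero, smul_zero] at h
  exact (smul_eq_zero.1 h).resolve_left hU.ne'

/-- Let `g` be the linear map `(t, v, S) ↦ (a t, t b + B v, t c + C v + K S)` of symmetric
`(n+1) × (n+1)` matrices with blocks `2t, vᵗ, v, S`. Suppose that for every row `-yᵗ` there are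
matrices `A'` with this upper right block and `A` with `g (A η + η Aᵗ) = A' g(η) + g(η) A'ᵗ` for
all `η`. Then `g η = a⁻¹ M η Mᵗ` for the matrix `M` with blocks `a, 0, b/2, B`.

In the coordinates `(t, v, S)` the matrix `-(A η + η Aᵗ)` is the triple that occurs in `hE`, with
blocks `r, -wᵗ, β, α` of `A`. -/
theorem congruence_of_intertwining {a : ℝ} (ha : a ≠ 0) {b : Fin n → ℝ}
    {B : Matrix (Fin n) (Fin n) ℝ} {c : Matrix (Fin n) (Fin n) ℝ}
    {C : (Fin n → ℝ) →ₗ[ℝ] Matrix (Fin n) (Fin n) ℝ}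
    {K : Matrix (Fin n) (Fin n) ℝ →ₗ[ℝ] Matrix (Fin n) (Fin n) ℝ}
    (hn : 0 < n) (hB : ∀ v, B *ᵥ v = 0 → v = 0)
    (hE : ∀ y : Fin n → ℝ, ∃ (r r' : ℝ) (w β β' : Fin n → ℝ) (α α' : Matrix (Fin n) (Fin n) ℝ),
      ∀ (t : ℝ) (v : Fin n → ℝ) (S : Matrix (Fin n) (Fin n) ℝ), S.IsSymm →
        a * (-(2 * r * t) + w ⬝ᵥ v) = -(2 * r' * (a * t)) + y ⬝ᵥ (t • b + B *ᵥ v) ∧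
        (-(2 * r * t) + w ⬝ᵥ v) • b + B *ᵥ (-((2 * t) • β) - α *ᵥ v - r • v + S *ᵥ w) =
          -((2 * (a * t)) • β') - α' *ᵥ (t • b + B *ᵥ v) - r' • (t • b + B *ᵥ v)
            + (t • c + C v + K S) *ᵥ y ∧
        (-(2 * r * t) + w ⬝ᵥ v) • c + C (-((2 * t) • β) - α *ᵥ v - r • v + S *ᵥ w)
            + K (-(vecMulVec β v + vecMulVec v β + (α * S + S * αᵀ))) =
          -(vecMulVec β' (t • b + B *ᵥ v) + vecMulVec (t • b + B *ᵥ v) β'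
            + (α' * (t • c + C v + K S) + (t • c + C v + K S) * α'ᵀ))) :
    (∀ S : Matrix (Fin n) (Fin n) ℝ, S.IsSymm → K S = a⁻¹ • (B * S * Bᵀ)) ∧
    (∀ v, C v = (2 * a)⁻¹ • (vecMulVec b (B *ᵥ v) + vecMulVec (B *ᵥ v) b)) ∧
    c = (2 * a)⁻¹ • vecMulVec b b := by
  -- the middle components at `(0, v, 0)` and `(0, 0, S)` give `a w = Bᵗ y` and `K(S) y = B S w`
  have hK : ∀ S : Matrix (Fin n) (Fin n) ℝ, S.IsSymm → K S = a⁻¹ • (B * S * Bᵀ) := by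
    intro S hS
    refine Matrix.ext_of_mulVec_single fun k => ?_
    obtain ⟨r, r', w, β, β', α, α', hy⟩ := hE (Pi.single k 1)
    set y : Fin n → ℝ := Pi.single k 1
    have hw : a • w = Bᵀ *ᵥ y := by
      refine dotProduct_eq _ _ fun v => ?_
      have := (hy 0 v 0 isSymm_zero).1
      rw [mulVec_transpose, ← dotProduct_mulVec, smul_dotProduct, smul_eq_mul]
      simpa using this
    have h := (hy 0 0 S hS).2.1
    simp only [mul_zero, neg_zero, dotProduct_zero, add_zero, zero_smul, zero_add, mulVec_zero,
      sub_zero, smul_zero, map_zero] at h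
    rw [← h, smul_mulVec, ← mulVec_mulVec, ← hw, mulVec_smul, smul_smul, inv_mul_cancel₀ ha,
      one_smul, mulVec_mulVec]
  have hKs : ∀ x z : Fin n → ℝ, K (vecMulVec x z + vecMulVec z x) =
      a⁻¹ • (vecMulVec (B *ᵥ x) (B *ᵥ z) + vecMulVec (B *ᵥ z) (B *ᵥ x)) := by
    intro x z
    have hsymm : (vecMulVec x z + vecMulVec z x).IsSymm := by
      simp [Matrix.IsSymm, transpose_vecMulVec, add_comm]
    rw [hK _ hsymm, mul_add, add_mul, mul_vecMulVec, mul_vecMulVec, vecMulVec_mul, vecMulVec_mul,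
      vecMul_transpose, vecMul_transpose]
  have hKd : ∀ x : Fin n → ℝ, K (vecMulVec x x) = a⁻¹ • vecMulVec (B *ᵥ x) (B *ᵥ x) := by
    intro x
    rw [hK _ (by simp [Matrix.IsSymm, transpose_vecMulVec]), mul_vecMulVec, vecMulVec_mul,
      vecMul_transpose]
  have hk : a⁻¹ ≠ 0 := inv_ne_zero ha
  have ha2 : (2 * a)⁻¹ = a⁻¹ / 2 := by field_simp
  -- with `y = u = B v`, eliminating `α' u` from the middle component at `(0, v, 0)` and the last one
  -- at `(0, 0, v vᵗ)` gives the equation of `eq_zero_of_dotProduct_smul_eq` for the error `D` in `C v`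
  have hC : ∀ v, C v = (2 * a)⁻¹ • (vecMulVec b (B *ᵥ v) + vecMulVec (B *ᵥ v) b) := by
    intro v
    by_cases hv : v = 0
    · simp [hv]
    have hu : B *ᵥ v ≠ 0 := fun h => hv (hB v h)
    obtain ⟨r, r', w, β, β', α, α', hy⟩ := hE (B *ᵥ v)
    set u := B *ᵥ v with hudef
    have hs : w ⬝ᵥ v = a⁻¹ * (u ⬝ᵥ u) := by
      have h := (hy 0 v 0 isSymm_zero).1
      simp only [mul_zero, neg_zero, zero_add, zero_smul] at h
      rw [← hudef] at h
      rw [← h, inv_mul_cancel_left₀ ha]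
    have hr : r' = r + a⁻¹ * (u ⬝ᵥ b) / 2 := by
      have h := (hy 1 0 0 isSymm_zero).1
      simp only [mul_one, dotProduct_zero, add_zero, one_smul, mulVec_zero] at h
      field_simp
      linear_combination h
    have hq : ∀ i, (α' *ᵥ u) i = (B *ᵥ (α *ᵥ v)) i + (r - r') * u i - (w ⬝ᵥ v) * b i
        + (C v *ᵥ u) i := by
      intro i
      have h := congrFun (hy 0 v 0 isSymm_zero).2.1 i
      simp only [mul_zero, neg_zero, zero_add, zero_smul, map_zero, add_zero, zero_mulVec, zero_sub,
        mulVec_sub, mulVec_neg, mulVec_smul, Pi.add_apply, Pi.sub_apply, Pi.neg_apply,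
        Pi.smul_apply, smul_eq_mul] at h
      rw [← hudef] at h
      linear_combination h
    have hE2 : ∀ i j, (w ⬝ᵥ v) * C v i j
        - a⁻¹ * ((B *ᵥ (α *ᵥ v)) i * u j + u i * (B *ᵥ (α *ᵥ v)) j)
        = -(a⁻¹ * ((α' *ᵥ u) i * u j + u i * (α' *ᵥ u) j)) := by
      intro i j
      have h := (hy 0 0 (vecMulVec v v) (by simp [Matrix.IsSymm, transpose_vecMulVec])).2.2
      rw [map_neg, vecMulVec_mulVec, op_smul_eq_smul, mul_vecMulVec, vecMulVec_mul, vecMul_transpose] at h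
      simp only [mul_zero, neg_zero, dotProduct_zero, add_zero, zero_smul, zero_add, mulVec_zero,
        sub_zero, map_zero, vecMulVec_zero, zero_vecMulVec, map_smul, hKs, hKd, smul_zero] at h
      rw [← hudef, mul_smul_comm, smul_mul_assoc, mul_vecMulVec, vecMulVec_mul,
        vecMul_transpose] at h
      have h' := congrFun (congrFun h i) j
      simp only [Matrix.add_apply, Matrix.neg_apply, Matrix.smul_apply,
        vecMulVec_apply, smul_eq_mul, dotProduct_comm v w] at h'
      linear_combination h'
    set D := C v - (2 * a)⁻¹ • (vecMulVec b u + vecMulVec u b) with hD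
    have hDu : ∀ i, (D *ᵥ u) i = (C v *ᵥ u) i
        - a⁻¹ / 2 * (b i * (u ⬝ᵥ u) + u i * (u ⬝ᵥ b)) := by
      intro i
      simp only [hD, sub_mulVec, smul_mulVec, add_mulVec, vecMulVec_mulVec, op_smul_eq_smul,
        Pi.sub_apply, Pi.smul_apply, Pi.add_apply, smul_eq_mul, ha2, dotProduct_comm b u]
      ring
    have hD0 : D = 0 := by
      refine eq_zero_of_dotProduct_smul_eq hu one_pos ?_
      ext i j
      simp only [Matrix.smul_apply, Matrix.add_apply, vecMulVec_apply, smul_eq_mul, hDu]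
      simp only [hD, Matrix.sub_apply, Matrix.smul_apply, Matrix.add_apply, vecMulVec_apply,
        smul_eq_mul, ha2]
      have h := hE2 i j
      rw [hq i, hq j, hr, hs] at h
      refine mul_left_cancel₀ hk ?_
      linear_combination h
    exact sub_eq_zero.1 hD0
  refine ⟨hK, hC, ?_⟩
  -- the same argument for `c`, with the middle components at `(0, v, 0)` and `(1, 0, 0)`, which
  -- determine `α' u` and `β'`, and the last one at `(0, v, 0)`
  set v : Fin n → ℝ := Pi.single ⟨0, hn⟩ 1 with hvdef
  have hu : B *ᵥ v ≠ 0 := fun h => by simpa [hvdef] using hB v h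
  obtain ⟨r, r', w, β, β', α, α', hy⟩ := hE (B *ᵥ v)
  set u := B *ᵥ v with hudef
  have hs : w ⬝ᵥ v = a⁻¹ * (u ⬝ᵥ u) := by
    have h := (hy 0 v 0 isSymm_zero).1
    simp only [mul_zero, neg_zero, zero_add, zero_smul] at h
    rw [← hudef] at h
    rw [← h, inv_mul_cancel_left₀ ha]
  have hr : r' = r + a⁻¹ * (u ⬝ᵥ b) / 2 := by
    have h := (hy 1 0 0 isSymm_zero).1
    simp only [mul_one, dotProduct_zero, add_zero, one_smul, mulVec_zero] at h
    field_simp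
    linear_combination h
  have hCu : ∀ i, (C v *ᵥ u) i = a⁻¹ / 2 * (b i * (u ⬝ᵥ u) + u i * (u ⬝ᵥ b)) := by
    intro i
    simp only [hC, ← hudef, smul_mulVec, add_mulVec, vecMulVec_mulVec, op_smul_eq_smul,
      Pi.smul_apply, Pi.add_apply, smul_eq_mul, ha2, dotProduct_comm b u]
    ring
  have hq : ∀ i, (α' *ᵥ u) i = (B *ᵥ (α *ᵥ v)) i + (r - r') * u i - (w ⬝ᵥ v) * b i
      + a⁻¹ / 2 * (b i * (u ⬝ᵥ u) + u i * (u ⬝ᵥ b)) := by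
    intro i
    have h := congrFun (hy 0 v 0 isSymm_zero).2.1 i
    simp only [mul_zero, neg_zero, zero_add, zero_smul, map_zero, add_zero, zero_mulVec, zero_sub,
      mulVec_sub, mulVec_neg, mulVec_smul, Pi.add_apply, Pi.sub_apply, Pi.neg_apply,
      Pi.smul_apply, smul_eq_mul] at h
    rw [← hudef, hCu] at h
    linear_combination h
  have hβ : ∀ i, β' i = a⁻¹ / 2 * ((2 * r - r') * b i + 2 * (B *ᵥ β) i - (α' *ᵥ b) i
      + (c *ᵥ u) i) := by
    intro i
    have h := congrFun (hy 1 0 0 isSymm_zero).2.1 i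
    simp only [mul_one, dotProduct_zero, add_zero, one_smul, mulVec_zero, map_zero, sub_zero,
      smul_zero, zero_mulVec, mulVec_neg, mulVec_smul, Pi.add_apply, Pi.sub_apply, Pi.neg_apply,
      Pi.smul_apply, smul_eq_mul] at h
    field_simp
    linear_combination h
  have hE2 : ∀ i j, (w ⬝ᵥ v) * c i j
      - a⁻¹ / 2 * (b i * (B *ᵥ (α *ᵥ v)) j + (B *ᵥ (α *ᵥ v)) i * b j)
      - r * (a⁻¹ / 2) * (b i * u j + u i * b j)
      - a⁻¹ * ((B *ᵥ β) i * u j + u i * (B *ᵥ β) j)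
      = -(β' i * u j + u i * β' j) - a⁻¹ / 2 * ((α' *ᵥ b) i * u j + (α' *ᵥ u) i * b j
        + b i * (α' *ᵥ u) j + u i * (α' *ᵥ b) j) := by
    intro i j
    have h := (hy 0 v 0 isSymm_zero).2.2
    simp only [mul_zero, neg_zero, zero_add, zero_smul, map_zero, add_zero, zero_mulVec, zero_sub,
      mulVec_sub, mulVec_neg, mulVec_smul, map_neg, hKs, zero_mul, hC,
      mul_smul_comm, smul_mul_assoc, mul_add, add_mul, mul_vecMulVec, vecMulVec_mul,
      vecMul_transpose] at h
    rw [← hudef] at h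
    have h' := congrFun (congrFun h i) j
    simp only [Matrix.add_apply, Matrix.neg_apply, Matrix.smul_apply,
      vecMulVec_apply, smul_eq_mul, ha2, Pi.sub_apply, Pi.neg_apply, Pi.smul_apply] at h'
    linear_combination h'
  set D := c - (2 * a)⁻¹ • vecMulVec b b with hD
  have hDu : ∀ i, (D *ᵥ u) i = (c *ᵥ u) i - a⁻¹ / 2 * (b i * (u ⬝ᵥ b)) := by
    intro i
    simp only [hD, sub_mulVec, smul_mulVec, vecMulVec_mulVec, op_smul_eq_smul,
      Pi.sub_apply, Pi.smul_apply, smul_eq_mul, ha2, dotProduct_comm b u]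
    ring
  have hD0 : D = 0 := by
    refine eq_zero_of_dotProduct_smul_eq hu (c := 1 / 2) (by norm_num) ?_
    ext i j
    simp only [Matrix.smul_apply, Matrix.add_apply, vecMulVec_apply, smul_eq_mul, hDu]
    simp only [hD, Matrix.sub_apply, Matrix.smul_apply, vecMulVec_apply, smul_eq_mul, ha2]
    have h := hE2 i j
    rw [hβ i, hβ j, hq i, hq j, hr, hs] at h
    refine mul_left_cancel₀ hk ?_
    linear_combination h
  exact sub_eq_zero.1 hD0

end Algebra

/-! ### The symmetric matrix of a coframe -/

section EtaMatrix

open Matrix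

variable {n : ℕ}

/-- The column `θ` of the coframe values `u`. -/
def thetaVec (u : CoframeModel n) : Fin n → ℝ := fun i => cTheta i u

/-- The symmetric matrix `Θ` of the coframe values `u`. -/
def thetaMat (u : CoframeModel n) : Matrix (Fin n) (Fin n) ℝ := Matrix.of fun i j => cTHETA i j u

/-- The symmetric matrix with blocks `2θ₀, θᵗ, θ, Θ`, whose determinant is `detEta`. -/
def etaMat (u : CoframeModel n) : Matrix (Fin 1 ⊕ Fin n) (Fin 1 ⊕ Fin n) ℝ :=
  Matrix.fromBlocks (Matrix.of fun _ _ => 2 * cTheta0 n u)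
    (Matrix.of fun _ j => thetaVec u j) (Matrix.of fun i _ => thetaVec u i) (thetaMat u)

theorem detEta_eq_det_etaMat (u : CoframeModel n) : detEta u = (etaMat u).det := rfl

theorem etaMat_add (u v : CoframeModel n) : etaMat (u + v) = etaMat u + etaMat v := by
  ext (i | i) (j | j) <;> simp [etaMat, thetaVec, thetaMat, mul_add]

theorem etaMat_smul (a : ℝ) (u : CoframeModel n) : etaMat (a • u) = a • etaMat u := by
  ext (i | i) (j | j) <;> simp [etaMat, thetaVec, thetaMat, mul_left_comm]

theorem etaMat_sub (u v : CoframeModel n) : etaMat (u - v) = etaMat u - etaMat v := by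
  ext (i | i) (j | j) <;> simp [etaMat, thetaVec, thetaMat, mul_sub]

theorem etaMat_eq_iff {u v : CoframeModel n} : etaMat u = etaMat v ↔
    cTheta0 n u = cTheta0 n v ∧ thetaVec u = thetaVec v ∧ thetaMat u = thetaMat v := by
  constructor
  · intro h
    refine ⟨?_, ?_, ?_⟩
    · have := congrFun (congrFun h (Sum.inl 0)) (Sum.inl 0)
      simpa [etaMat] using this
    · funext i
      have := congrFun (congrFun h (Sum.inr i)) (Sum.inl 0)
      simpa [etaMat] using this
    · ext i j
      have := congrFun (congrFun h (Sum.inr i)) (Sum.inr j)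
      simpa [etaMat] using this
  · rintro ⟨h0, h1, h2⟩
    simp only [etaMat, h0, h1, h2]

theorem etaMat_eq_zero_iff {u : CoframeModel n} : etaMat u = 0 ↔
    cTheta0 n u = 0 ∧ thetaVec u = 0 ∧ thetaMat u = 0 := by
  have h : etaMat (0 : CoframeModel n) = 0 := by
    ext (i | i) (j | j) <;> simp [etaMat, thetaVec, thetaMat]
  rw [← h, etaMat_eq_iff]
  have h1 : thetaVec (0 : CoframeModel n) = 0 := by ext; simp [thetaVec]
  have h2 : thetaMat (0 : CoframeModel n) = 0 := by ext; simp [thetaMat]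
  rw [map_zero, h1, h2]

theorem thetaMat_isSymm (u : CoframeModel n) : (thetaMat u).IsSymm := by
  ext i j
  exact (coframeEquiv n u).2.2.1.2 j i

/-- The coframe values with given `θ₀`, `θ`, with `Θ` the symmetric part of a given matrix and with
`ω = 0`. -/
def ofBlocks : ℝ × (Fin n → ℝ) × Matrix (Fin n) (Fin n) ℝ →ₗ[ℝ] CoframeModel n where
  toFun x := (coframeEquiv n).symm
    (x.1, x.2.1, ⟨fun i j => (x.2.2 i j + x.2.2 j i) / 2, fun i j => by ring⟩, 0)
  map_add' x y := by
    rw [← map_add]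
    congr 1
    refine Prod.ext rfl (Prod.ext rfl (Prod.ext (Subtype.ext ?_) (by simp)))
    funext i j
    simp
    ring
  map_smul' a x := by
    rw [RingHom.id_apply, ← map_smul]
    congr 1
    refine Prod.ext rfl (Prod.ext rfl (Prod.ext (Subtype.ext ?_) (by simp)))
    funext i j
    simp
    ring

@[simp]
theorem cTheta0_ofBlocks (x : ℝ × (Fin n → ℝ) × Matrix (Fin n) (Fin n) ℝ) :
    cTheta0 n (ofBlocks x) = x.1 := rfl

@[simp]
theorem thetaVec_ofBlocks (x : ℝ × (Fin n → ℝ) × Matrix (Fin n) (Fin n) ℝ) :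
    thetaVec (ofBlocks x) = x.2.1 := rfl

theorem thetaMat_ofBlocks {x : ℝ × (Fin n → ℝ) × Matrix (Fin n) (Fin n) ℝ} (hx : x.2.2.IsSymm) :
    thetaMat (ofBlocks x) = x.2.2 := by
  ext i j
  change (x.2.2 i j + x.2.2 j i) / 2 = _
  rw [hx.apply i j]
  ring

theorem etaMat_ofBlocks (u : CoframeModel n) :
    etaMat (ofBlocks (cTheta0 n u, thetaVec u, thetaMat u)) = etaMat u :=
  etaMat_eq_iff.2 ⟨by simp, by simp, thetaMat_ofBlocks (thetaMat_isSymm u)⟩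

/-- The blocks of an infinitesimal congruence `η ↦ -(A η + η Aᵗ)`. -/
theorem blocks_of_etaMat_eq {u X : CoframeModel n}
    {A : Matrix (Fin 1 ⊕ Fin n) (Fin 1 ⊕ Fin n) ℝ}
    (h : etaMat X = -(A * etaMat u + etaMat u * Aᵀ)) :
    cTheta0 n X = -(2 * A (.inl 0) (.inl 0) * cTheta0 n u)
        + (fun k => -A (.inl 0) (.inr k)) ⬝ᵥ thetaVec u ∧
    thetaVec X = -((2 * cTheta0 n u) • fun i => A (.inr i) (.inl 0)) - A.toBlocks₂₂ *ᵥ thetaVec u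
        - A (.inl 0) (.inl 0) • thetaVec u + thetaMat u *ᵥ (fun k => -A (.inl 0) (.inr k)) ∧
    thetaMat X = -(vecMulVec (fun i => A (.inr i) (.inl 0)) (thetaVec u)
        + vecMulVec (thetaVec u) (fun i => A (.inr i) (.inl 0))
        + (A.toBlocks₂₂ * thetaMat u + thetaMat u * A.toBlocks₂₂ᵀ)) := by
  refine ⟨?_, ?_, ?_⟩
  · have h' := congrFun (congrFun h (Sum.inl 0)) (Sum.inl 0)
    simp only [etaMat, Matrix.neg_apply, Matrix.add_apply, Matrix.mul_apply,
      Fintype.sum_sum_type, Finset.univ_unique, Finset.sum_singleton, Fin.default_eq_zero,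
      fromBlocks_apply₁₁, fromBlocks_apply₁₂, fromBlocks_apply₂₁, of_apply, transpose_apply] at h'
    simp only [dotProduct, neg_mul, Finset.sum_neg_distrib]
    have hc : ∑ x, thetaVec u x * A (.inl 0) (.inr x) = ∑ x, A (.inl 0) (.inr x) * thetaVec u x :=
      Finset.sum_congr rfl fun _ _ => mul_comm _ _
    rw [hc] at h'
    linear_combination h' / 2
  · funext i
    have h' := congrFun (congrFun h (Sum.inr i)) (Sum.inl 0)
    simp only [etaMat, Matrix.neg_apply, Matrix.add_apply, Matrix.mul_apply,
      Fintype.sum_sum_type, Finset.univ_unique, Finset.sum_singleton, Fin.default_eq_zero,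
      fromBlocks_apply₁₁, fromBlocks_apply₂₁, fromBlocks_apply₂₂, of_apply,
      transpose_apply] at h'
    simp only [Pi.add_apply, Pi.sub_apply, Pi.neg_apply, Pi.smul_apply, smul_eq_mul, mulVec,
      dotProduct, mul_neg, Finset.sum_neg_distrib, toBlocks₂₂, of_apply]
    linear_combination h'
  · ext i j
    have h' := congrFun (congrFun h (Sum.inr i)) (Sum.inr j)
    simp only [etaMat, Matrix.neg_apply, Matrix.add_apply, Matrix.mul_apply,
      Fintype.sum_sum_type, Finset.univ_unique, Finset.sum_singleton, Fin.default_eq_zero,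
      fromBlocks_apply₁₂, fromBlocks_apply₂₁, fromBlocks_apply₂₂, of_apply,
      transpose_apply] at h'
    simp only [Matrix.neg_apply, Matrix.add_apply, vecMulVec_apply, Matrix.mul_apply,
      transpose_apply, toBlocks₂₂, of_apply]
    linear_combination h'

/-- A linear transformation `h` of the coframes that preserves the filtration
`{θ₀} ⊆ {θ₀, θ} ⊆ {θ₀, θ, Θ}` and intertwines sufficiently many infinitesimal congruences of the
matrix `η` acts on `η` by a congruence, up to a factor, and hence rescales `det η`. -/
theorem exists_detEta_eq_mul (hn : 0 < n) (h : CoframeModel n ≃L[ℝ] CoframeModel n)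
    (h0 : ∀ u, cTheta0 n (h u) = 0 ↔ cTheta0 n u = 0)
    (h1 : ∀ u, (cTheta0 n (h u) = 0 ∧ thetaVec (h u) = 0) ↔ (cTheta0 n u = 0 ∧ thetaVec u = 0))
    (h2 : ∀ u, etaMat u = 0 → etaMat (h u) = 0)
    (hE : ∀ y : Fin n → ℝ, ∃ A A' : Matrix (Fin 1 ⊕ Fin n) (Fin 1 ⊕ Fin n) ℝ,
      (∀ k, A' (.inl 0) (.inr k) = -y k) ∧ ∀ u, ∃ X,
        etaMat X = -(A * etaMat u + etaMat u * Aᵀ) ∧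
        etaMat (h X) = -(A' * etaMat (h u) + etaMat (h u) * A'ᵀ)) :
    ∃ k : ℝ, ∀ u, detEta (h u) = k * detEta u := by
  have hη : ∀ u v, etaMat u = etaMat v → etaMat (h u) = etaMat (h v) := by
    intro u v huv
    rw [← sub_eq_zero, ← etaMat_sub, ← map_sub]
    exact h2 _ (by rw [etaMat_sub, huv, sub_self])
  set a : ℝ := cTheta0 n (h (ofBlocks (1, 0, 0))) with hadef
  set b : Fin n → ℝ := thetaVec (h (ofBlocks (1, 0, 0))) with hbdef
  set c : Matrix (Fin n) (Fin n) ℝ := thetaMat (h (ofBlocks (1, 0, 0))) with hcdef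
  let Bl : (Fin n → ℝ) →ₗ[ℝ] (Fin n → ℝ) :=
    { toFun := fun v => thetaVec (h (ofBlocks (0, v, 0)))
      map_add' := by
        intro v w
        have : ((0 : ℝ), v + w, (0 : Matrix (Fin n) (Fin n) ℝ)) = (0, v, 0) + (0, w, 0) := by simp
        rw [this, map_add, map_add]
        ext i; simp [thetaVec]
      map_smul' := by
        intro s v
        have : ((0 : ℝ), s • v, (0 : Matrix (Fin n) (Fin n) ℝ)) = s • (0, v, 0) := by simp
        rw [this, map_smul, map_smul]
        ext i; simp [thetaVec] }
  let C : (Fin n → ℝ) →ₗ[ℝ] Matrix (Fin n) (Fin n) ℝ :=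
    { toFun := fun v => thetaMat (h (ofBlocks (0, v, 0)))
      map_add' := by
        intro v w
        have : ((0 : ℝ), v + w, (0 : Matrix (Fin n) (Fin n) ℝ)) = (0, v, 0) + (0, w, 0) := by simp
        rw [this, map_add, map_add]
        ext i j; simp [thetaMat]
      map_smul' := by
        intro s v
        have : ((0 : ℝ), s • v, (0 : Matrix (Fin n) (Fin n) ℝ)) = s • (0, v, 0) := by simp
        rw [this, map_smul, map_smul]
        ext i j; simp [thetaMat] }
  let K : Matrix (Fin n) (Fin n) ℝ →ₗ[ℝ] Matrix (Fin n) (Fin n) ℝ :=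
    { toFun := fun S => thetaMat (h (ofBlocks (0, 0, S)))
      map_add' := by
        intro v w
        have : ((0 : ℝ), (0 : Fin n → ℝ), v + w) = (0, 0, v) + (0, 0, w) := by simp
        rw [this, map_add, map_add]
        ext i j; simp [thetaMat]
      map_smul' := by
        intro s v
        have : ((0 : ℝ), (0 : Fin n → ℝ), s • v) = s • (0, 0, v) := by simp
        rw [this, map_smul, map_smul]
        ext i j; simp [thetaMat] }
  set B : Matrix (Fin n) (Fin n) ℝ := LinearMap.toMatrix' Bl with hBdef
  have hBv : ∀ v, B *ᵥ v = thetaVec (h (ofBlocks (0, v, 0))) := fun v =>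
    LinearMap.toMatrix'_mulVec Bl v
  -- the components of `h` on the three graded pieces
  have e1 : ∀ t : ℝ, h (ofBlocks (t, 0, 0)) = t • h (ofBlocks ((1 : ℝ), (0 : Fin n → ℝ), 0)) := by
    intro t
    have : (t, (0 : Fin n → ℝ), (0 : Matrix (Fin n) (Fin n) ℝ)) = t • (1, 0, 0) := by simp
    rw [this, map_smul, map_smul]
  have e2 : ∀ (v : Fin n → ℝ), cTheta0 n (h (ofBlocks (0, v, 0))) = 0 := fun v =>
    (h0 _).2 (by simp)
  have e3 : ∀ S : Matrix (Fin n) (Fin n) ℝ, cTheta0 n (h (ofBlocks (0, 0, S))) = 0 ∧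
      thetaVec (h (ofBlocks (0, 0, S))) = 0 := fun S => (h1 _).2 (by simp)
  have hsplit : ∀ (t : ℝ) (v : Fin n → ℝ) (S : Matrix (Fin n) (Fin n) ℝ),
      h (ofBlocks (t, v, S)) = t • h (ofBlocks (1, 0, 0)) + h (ofBlocks (0, v, 0))
        + h (ofBlocks (0, 0, S)) := by
    intro t v S
    rw [← e1, ← map_add, ← map_add, ← map_add, ← map_add]
    simp
  have hc0 : ∀ t v S, cTheta0 n (h (ofBlocks (t, v, S))) = a * t := by
    intro t v S
    rw [hsplit, map_add, map_add, map_smul, e2, (e3 S).1]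
    simp [hadef, mul_comm]
  have hc1 : ∀ t v S, thetaVec (h (ofBlocks (t, v, S))) = t • b + B *ᵥ v := by
    intro t v S
    have h3 := (e3 S).2
    rw [hsplit, hBv]
    funext i
    have h3i := congrFun h3 i
    simp only [thetaVec, Pi.zero_apply] at h3i
    simp [thetaVec, hbdef, h3i]
  have hc2 : ∀ t v S, thetaMat (h (ofBlocks (t, v, S))) = t • c + C v + K S := by
    intro t v S
    rw [hsplit]
    ext i j
    simp [thetaMat, hcdef, C, K]
  have ha : a ≠ 0 := fun h => by simpa using (h0 (ofBlocks (1, 0, 0))).1 h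
  have hB : ∀ v, B *ᵥ v = 0 → v = 0 := by
    intro v hv
    have := (h1 (ofBlocks (0, v, 0))).1 ⟨e2 v, (hBv v).symm.trans hv⟩
    simpa using this.2
  obtain ⟨hK, hC, hcc⟩ := congruence_of_intertwining (b := b) (c := c) (C := C) (K := K) ha hn hB (by
    intro y
    obtain ⟨A, A', hy, hA⟩ := hE y
    refine ⟨A (.inl 0) (.inl 0), A' (.inl 0) (.inl 0), fun k => -A (.inl 0) (.inr k),
      fun i => A (.inr i) (.inl 0), fun i => A' (.inr i) (.inl 0), A.toBlocks₂₂, A'.toBlocks₂₂, ?_⟩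
    have hy' : (fun k => -A' (.inl 0) (.inr k)) = y := by funext k; simp [hy]
    intro t v S hS
    obtain ⟨X, hX, hX'⟩ := hA (ofBlocks (t, v, S))
    obtain ⟨p0, p1, p2⟩ := blocks_of_etaMat_eq hX
    obtain ⟨q0, q1, q2⟩ := blocks_of_etaMat_eq hX'
    have hh := hη _ _ (etaMat_ofBlocks X)
    rw [etaMat_eq_iff, hc0, hc1, hc2] at hh
    rw [hc0, hc1, hc2, hy'] at q1
    rw [hc0, hc1, hy'] at q0
    rw [hc1, hc2] at q2
    rw [cTheta0_ofBlocks, thetaVec_ofBlocks] at p0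
    rw [cTheta0_ofBlocks, thetaVec_ofBlocks, thetaMat_ofBlocks hS] at p1
    rw [thetaVec_ofBlocks, thetaMat_ofBlocks hS] at p2
    have r0 := hh.1.trans q0
    have r1 := hh.2.1.trans q1
    have r2 := hh.2.2.trans q2
    rw [p0] at r0
    rw [p0, p1] at r1
    rw [p0, p1, p2] at r2
    exact ⟨r0, r1, r2⟩)
  let M : Matrix (Fin 1 ⊕ Fin n) (Fin 1 ⊕ Fin n) ℝ :=
    fromBlocks (of fun _ _ => a) 0 (of fun i _ => b i / 2) B
  refine ⟨a⁻¹ ^ Fintype.card (Fin 1 ⊕ Fin n) * (M.det * M.det), fun u => ?_⟩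
  have hMu : etaMat (h u) = a⁻¹ • (M * etaMat u * Mᵀ) := by
    obtain ⟨p0, p1, p2⟩ := etaMat_eq_iff.1 (hη _ _ (etaMat_ofBlocks u))
    rw [hc0] at p0
    rw [hc1] at p1
    rw [hc2, hC, hK _ (thetaMat_isSymm u), hcc] at p2
    rw [etaMat, etaMat, ← p0, ← p1, ← p2, fromBlocks_transpose, fromBlocks_multiply,
      fromBlocks_multiply, fromBlocks_smul]
    congr 1
    · ext i j
      simp [Matrix.mul_apply]
      field_simp
    · ext i j
      simp only [Matrix.mul_apply, mulVec, dotProduct, of_apply, Pi.add_apply, Pi.smul_apply,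
        smul_eq_mul, Matrix.smul_apply, Matrix.add_apply, transpose_apply, Matrix.zero_apply,
        zero_mul, Finset.sum_const_zero, add_zero, Finset.univ_unique, Finset.sum_singleton]
      have hs : ∑ x, a * thetaVec u x * B j x = a * ∑ x, B j x * thetaVec u x := by
        rw [Finset.mul_sum]
        exact Finset.sum_congr rfl fun _ _ => by ring
      rw [hs]
      field_simp
    · ext i j
      simp only [Matrix.mul_apply, mulVec, dotProduct, of_apply, Pi.add_apply, Pi.smul_apply,
        smul_eq_mul, Matrix.smul_apply, Matrix.add_apply, transpose_apply, Matrix.zero_apply,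
        mul_zero, Finset.sum_const_zero, add_zero, Finset.univ_unique, Finset.sum_singleton]
      field_simp
    · ext i j
      simp only [Matrix.mul_apply, mulVec, dotProduct, of_apply,
        smul_eq_mul, Matrix.smul_apply, Matrix.add_apply, transpose_apply, vecMulVec_apply,
        Finset.univ_unique, Finset.sum_singleton]
      have hs : ∑ x, (b i / 2 * thetaVec u x + ∑ y, B i y * thetaMat u y x) * B j x
          = b i / 2 * ∑ x, B j x * thetaVec u x
            + ∑ x, (∑ y, B i y * thetaMat u y x) * B j x := by
        rw [Finset.mul_sum, ← Finset.sum_add_distrib]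
        exact Finset.sum_congr rfl fun _ _ => by ring
      rw [hs]
      field_simp
      ring
  rw [detEta_eq_det_etaMat, detEta_eq_det_etaMat, hMu, det_smul, det_mul, det_mul, det_transpose]
  ring

end EtaMatrix

/-! ### Variation of the determinant along the leaves -/

section DetVariation

open Matrix

theorem contDiff_det {m : Type*} [Fintype m] [DecidableEq m] :
    ContDiff ℝ ∞ fun η : m → m → ℝ => (Matrix.of η).det := by
  simp only [Matrix.det_apply, Matrix.of_apply]
  fun_prop

/-- The derivative of the determinant along an infinitesimal congruence `-(A η + η Aᵗ)` is a
multiple of the determinant; the factor depends on `A` only. -/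
theorem exists_fderiv_det_congruence {m : Type*} [Fintype m] [DecidableEq m] (A : Matrix m m ℝ) :
    ∃ κ : ℝ, ∀ η : m → m → ℝ,
      fderiv ℝ (fun η : m → m → ℝ => (Matrix.of η).det) η
        (-(A * Matrix.of η + Matrix.of η * Aᵀ) : Matrix m m ℝ) = κ * (Matrix.of η).det := by
  -- the curve `(1 - s A) η (1 - s A)ᵗ` has velocity `-(A η + η Aᵗ)` at `s = 0`
  refine ⟨deriv (fun s : ℝ => ((1 - s • A).det * (1 - s • A).det)) 0, fun η => ?_⟩
  set D : m → m → ℝ := (-(A * Matrix.of η + Matrix.of η * Aᵀ) : Matrix m m ℝ) with hD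
  set Q : m → m → ℝ := (A * Matrix.of η * Aᵀ : Matrix m m ℝ) with hQ
  let c : ℝ → m → m → ℝ := fun s => η + s • D + (s ^ 2) • Q
  have hc : HasDerivAt c D 0 := by
    have h1 : HasDerivAt (fun s : ℝ => s • D) D 0 := by
      simpa using (hasDerivAt_id (0 : ℝ)).smul_const D
    have h2 : HasDerivAt (fun s : ℝ => (s ^ 2) • Q) 0 0 := by
      simpa using (hasDerivAt_pow 2 (0 : ℝ)).smul_const Q
    have h3 := (h1.const_add η).add h2
    rw [add_zero] at h3
    exact h3
  have hc0 : c 0 = η := by simp [c]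
  have hdet : HasFDerivAt (fun η : m → m → ℝ => (Matrix.of η).det)
      (fderiv ℝ (fun η : m → m → ℝ => (Matrix.of η).det) η) (c 0) := by
    rw [hc0]
    exact (contDiff_det.differentiable (by simp)).differentiableAt.hasFDerivAt
  have h1 := hdet.comp_hasDerivAt (0 : ℝ) hc
  have h2 : (fun s => (Matrix.of (c s)).det) =
      fun s => ((1 - s • A).det * (1 - s • A).det) * (Matrix.of η).det := by
    funext s
    have : Matrix.of (c s) = (1 - s • A) * Matrix.of η * (1 - s • A)ᵀ := by
      have hcs : Matrix.of (c s) = Matrix.of η + s • (-(A * Matrix.of η + Matrix.of η * Aᵀ))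
        + (s ^ 2) • (A * Matrix.of η * Aᵀ) := rfl
      rw [hcs, transpose_sub, transpose_one, transpose_smul]
      simp only [sub_mul, mul_sub, one_mul, mul_one, smul_mul_assoc, mul_smul_comm]
      module
    rw [this, det_mul, det_mul, det_transpose]
    ring
  have h3 : DifferentiableAt ℝ (fun s : ℝ => ((1 - s • A).det * (1 - s • A).det)) 0 := by
    have h4 : DifferentiableAt ℝ (fun s : ℝ => (1 - s • A).det) 0 := by
      simp only [Matrix.det_apply, Matrix.sub_apply, Matrix.smul_apply]
      fun_prop
    exact h4.mul h4
  have h5 := (h3.hasDerivAt.mul_const (Matrix.of η).det)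
  rw [← h2] at h5
  exact h1.unique h5

variable {n : ℕ}

/-- `etaMat` as a continuous linear map, with values in functions, which unlike matrices carry a
canonical norm. -/
def etaCLM (n : ℕ) : CoframeModel n →L[ℝ] (Fin 1 ⊕ Fin n → Fin 1 ⊕ Fin n → ℝ) :=
  LinearMap.toContinuousLinearMap
    { toFun := fun u => etaMat u
      map_add' := etaMat_add
      map_smul' := etaMat_smul }

theorem detEta_eq_comp : (detEta : CoframeModel n → ℝ) =
    (fun η : Fin 1 ⊕ Fin n → Fin 1 ⊕ Fin n → ℝ => (Matrix.of η).det) ∘ etaCLM n := rfl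

theorem differentiable_detEta : Differentiable ℝ (detEta : CoframeModel n → ℝ) := by
  rw [detEta_eq_comp]
  exact (contDiff_det.differentiable (by simp)).comp (etaCLM n).differentiable

theorem exists_fderiv_detEta (A : Matrix (Fin 1 ⊕ Fin n) (Fin 1 ⊕ Fin n) ℝ) :
    ∃ κ : ℝ, ∀ u X : CoframeModel n, etaMat X = -(A * etaMat u + etaMat u * Aᵀ) →
      fderiv ℝ detEta u X = κ * detEta u := by
  obtain ⟨κ, hκ⟩ := exists_fderiv_det_congruence A
  refine ⟨κ, fun u X h => ?_⟩
  have h1 : HasFDerivAt detEta _ u :=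
    ((contDiff_det.differentiable (by simp)).differentiableAt (x := etaCLM n u)).hasFDerivAt.comp u
      (etaCLM n).hasFDerivAt
  rw [h1.fderiv]
  refine Eq.trans ?_ (hκ (etaMat u))
  exact congrArg _ h

end DetVariation

section LeafVariation

open Matrix

variable {n : ℕ} {V : Type*} [NormedAddCommGroup V] [NormedSpace ℝ V]
  {G : Type*} [NormedAddCommGroup G] [NormedSpace ℝ G]
  {B : Type*} [NormedAddCommGroup B] [NormedSpace ℝ B]
  {C : Type*} [NormedAddCommGroup C] [NormedSpace ℝ C]

theorem coordForm_model (φ : VForm V V G) (x : V) : coordForm x φ = φ := by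
  funext y
  change (φ y).comp (mfderiv 𝓘(ℝ, V) 𝓘(ℝ, V) id y) = φ y
  rw [mfderiv_id]
  rfl

theorem vextD_model (φ : V → V →L[ℝ] G) (x v w : V) :
    vextD (E := V) (M := V) φ x v w = fderiv ℝ φ x v w - fderiv ℝ φ x w v := by
  have h : (coordForm (E := V) (M := V) x φ : V → V →L[ℝ] G) = φ := coordForm_model φ x
  exact congrArg (fun ψ : V → V →L[ℝ] G => fderiv ℝ ψ x v w - fderiv ℝ ψ x w v) h

/-- Let `c` be a coframe valued form on the product `B × C` whose `η`-part vanishes on the second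
factor and changes along it by infinitesimal congruences. Then `det η`, restricted to the first
factor, changes by a factor only. -/
theorem eventually_detEta_eq_mul {c : VForm (B × C) (B × C) (CoframeModel n)} {p₀ : B × C}
    (hs : ∀ᶠ p in 𝓝 p₀, SmoothFormAt c p)
    (hv : ∀ᶠ p in 𝓝 p₀, ∀ w : C, etaMat (c p ((0, w) : B × C)) = 0)
    (hd : ∀ᶠ p in 𝓝 p₀, ∀ w : C, ∃ A : Matrix (Fin 1 ⊕ Fin n) (Fin 1 ⊕ Fin n) ℝ,
      ∀ v : B × C, etaMat (vextD c p ((0, w) : B × C) v)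
        = -(A * etaMat (c p v) + etaMat (c p v) * Aᵀ))
    {v₀ : B} (hv₀ : detEta (c p₀ ((v₀, 0) : B × C)) ≠ 0) :
    ∀ᶠ y in 𝓝 p₀.2, ∃ k : ℝ, ∀ v : B,
      detEta (c (p₀.1, y) ((v, 0) : B × C)) = k * detEta (c p₀ ((v, 0) : B × C)) := by
  obtain ⟨x₀, y₀⟩ := p₀
  let c' : B × C → (B × C →L[ℝ] CoframeModel n) := c
  have hdiff : ∀ p, SmoothFormAt c p → DifferentiableAt ℝ c' p := by
    intro p hp
    have := ContDiffAt.differentiableAt hp (by simp)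
    rwa [coordForm_model] at this
  let f : B → C → ℝ := fun v y => detEta (c' (x₀, y) (v, 0))
  have hcont : ContinuousAt (fun y : C => (x₀, y)) y₀ := by fun_prop
  have key : ∀ᶠ y in 𝓝 y₀, ∀ w : C, ∃ κ : ℝ, ∀ v : B, DifferentiableAt ℝ (f v) y ∧
      fderiv ℝ (f v) y w = κ * f v y := by
    have hall := hcont.eventually ((hs.and hd).and hv.eventually_nhds)
    filter_upwards [hall] with y hy w
    obtain ⟨⟨hs', hd'⟩, hv'⟩ := hy
    obtain ⟨A, hA⟩ := hd' w
    obtain ⟨κ, hκ⟩ := exists_fderiv_detEta A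
    refine ⟨κ, fun v => ?_⟩
    have hc := (hdiff _ hs').hasFDerivAt
    have h1 : HasFDerivAt (fun q : B × C => c' q (v, 0))
        ((fderiv ℝ c' (x₀, y)).flip (v, 0)) (x₀, y) := by
      simpa using hc.clm_apply (hasFDerivAt_const ((v, 0) : B × C) (x₀, y))
    have h2 : HasFDerivAt (fun y : C => c' (x₀, y) (v, 0))
        (((fderiv ℝ c' (x₀, y)).flip (v, 0)).comp (ContinuousLinearMap.inr ℝ B C)) y :=
      HasFDerivAt.comp (g := fun q : B × C => c' q (v, 0)) y h1 (hasFDerivAt_prodMk_right x₀ y)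
    have h3 : HasFDerivAt (f v) _ y :=
      HasFDerivAt.comp (g := detEta) y (differentiable_detEta _).hasFDerivAt h2
    refine ⟨h3.differentiableAt, ?_⟩
    rw [h3.fderiv]
    refine hκ _ (fderiv ℝ c' (x₀, y) (0, w) (v, 0)) ?_
    -- the `η`-part of `c` vanishes on the second factor, hence so do its derivatives
    have h4 : etaMat (fderiv ℝ c' (x₀, y) (v, 0) (0, w)) = 0 := by
      have h5 : HasFDerivAt (fun q : B × C => etaCLM n (c' q (0, w)))
          ((etaCLM n).comp ((fderiv ℝ c' (x₀, y)).flip (0, w))) (x₀, y) := by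
        have := hc.clm_apply (hasFDerivAt_const ((0, w) : B × C) (x₀, y))
        simpa using (etaCLM n).hasFDerivAt.comp (x₀, y) this
      have h6 : (fun q : B × C => etaCLM n (c' q (0, w))) =ᶠ[𝓝 (x₀, y)] fun _ => 0 := by
        filter_upwards [hv'] with q hq
        exact hq w
      have h7 := h5.unique ((hasFDerivAt_const _ _).congr_of_eventuallyEq h6)
      exact congrArg (fun l => l (v, 0)) h7
    have h8 := hA (v, 0)
    have h9 : etaMat (fderiv ℝ c' (x₀, y) (0, w) (v, 0) - fderiv ℝ c' (x₀, y) (v, 0) (0, w)) =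
        -(A * etaMat (c' (x₀, y) (v, 0)) + etaMat (c' (x₀, y) (v, 0)) * Aᵀ) := by
      rw [← vextD_model]
      exact h8
    rwa [etaMat_sub, h4, sub_zero] at h9
  -- the logarithmic derivative `κ` does not depend on `v`, so the quotients `f v / f v₀` are constant
  -- on a ball on which `f v₀` does not vanish
  have hne : ∀ᶠ y in 𝓝 y₀, f v₀ y ≠ 0 := by
    obtain ⟨κ, hκ⟩ := key.self_of_nhds 0
    exact (hκ v₀).1.continuousAt.eventually_ne hv₀
  obtain ⟨r, hr, hball⟩ := Metric.eventually_nhds_iff_ball.1 (key.and hne)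
  filter_upwards [Metric.ball_mem_nhds y₀ hr] with y hy
  refine ⟨f v₀ y / f v₀ y₀, fun v => ?_⟩
  have hy₀ := Metric.mem_ball_self (x := y₀) hr
  have hquot : f v y / f v₀ y = f v y₀ / f v₀ y₀ := by
    have hD : ∀ y' ∈ Metric.ball y₀ r,
        HasFDerivAt (fun y => f v y / f v₀ y) (0 : C →L[ℝ] ℝ) y' := by
      intro y' hy'
      obtain ⟨hk, hn⟩ := hball y' hy'
      obtain ⟨_, h0⟩ := hk 0
      have h1 : HasFDerivAt (fun y => f v y * (f v₀ y)⁻¹) _ y' := (h0 v).1.hasFDerivAt.mul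
        ((hasDerivAt_inv hn).comp_hasFDerivAt y' (h0 v₀).1.hasFDerivAt)
      simp only [div_eq_mul_inv]
      refine h1.congr_fderiv (ContinuousLinearMap.ext fun w => ?_)
      obtain ⟨κ, hκ⟩ := hk w
      simp only [_root_.add_apply, _root_.smul_apply,
        smul_eq_mul, (hκ v).2, (hκ v₀).2, _root_.zero_apply]
      field_simp
      ring
    exact Metric.isOpen_ball.is_const_of_fderiv_eq_zero (convex_ball y₀ r).isPreconnected
      (fun y' hy' => (hD y' hy').differentiableAt.differentiableWithinAt)
      (fun y' hy' => (hD y' hy').fderiv) hy hy₀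
  have hn := (hball y hy).2
  have hn₀ := (hball y₀ hy₀).2
  change f v y = _ * f v y₀
  field_simp at hquot ⊢
  linarith

end LeafVariation

/-! ### The torsion of the reduced bundle -/

section Ideals

variable {V : Type*} [TopologicalSpace V] [AddCommGroup V] [Module ℝ V]
  {S : Set (V →L[ℝ] ℝ)}

theorem isQuadraticIn_wedgeAt {a t : V →L[ℝ] ℝ} (ha : a ∈ Submodule.span ℝ S) (ht : t ∈ S) :
    IsQuadraticIn S (wedgeAt a t) := by
  induction ha using Submodule.span_induction with
  | mem s hs => exact Submodule.subset_span ⟨s, hs, t, ht, rfl⟩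
  | zero =>
    have : wedgeAt (0 : V →L[ℝ] ℝ) t = 0 := by ext v w; simp [wedgeAt]
    rw [this]
    exact Submodule.zero_mem _
  | add a b _ _ ha hb =>
    have : wedgeAt (a + b) t = wedgeAt a t + wedgeAt b t := by
      ext v w; simp [wedgeAt]; ring
    rw [this]
    exact Submodule.add_mem _ ha hb
  | smul r a _ ha =>
    have : wedgeAt (r • a) t = r • wedgeAt a t := by
      ext v w; simp [wedgeAt]; ring
    rw [this]
    exact Submodule.smul_mem _ r ha

theorem inIdeal_wedgeAt {a s : V →L[ℝ] ℝ} (hs : s ∈ S) : InIdeal S (wedgeAt a s) :=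
  Submodule.subset_span ⟨a, s, hs, rfl⟩

theorem IsQuadraticIn.apply_eq_zero {Ω : V → V → ℝ} (h : IsQuadraticIn S Ω) {v : V}
    (hv : ∀ s ∈ S, s v = 0) (w : V) : Ω v w = 0 := by
  induction h using Submodule.span_induction with
  | mem η hη =>
    obtain ⟨s, hs, t, ht, rfl⟩ := hη
    simp [wedgeAt, hv s hs, hv t ht]
  | zero => rfl
  | add a b _ _ ha hb => simp [ha, hb]
  | smul r a _ ha => simp [ha]

theorem wedgeAt_swap (a b : V →L[ℝ] ℝ) (v w : V) : wedgeAt a b v w = -wedgeAt b a v w := by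
  simp only [wedgeAt]
  ring

theorem sum_wedgeAt_sub_ite {n : ℕ} (p t : Fin n → V →L[ℝ] ℝ) (a b : Fin n) (x y : V →L[ℝ] ℝ)
    (v w : V) :
    ∑ k, wedgeAt (p k - (1 / 2 : ℝ) • ((if a = k then x else 0) + (if b = k then y else 0)))
      (t k) v w = ∑ k, wedgeAt (p k) (t k) v w
        - 1 / 2 * (wedgeAt x (t a) v w + wedgeAt y (t b) v w) := by
  have h : ∀ k, wedgeAt (p k - (1 / 2 : ℝ) • ((if a = k then x else 0) + (if b = k then y else 0)))
      (t k) v w = wedgeAt (p k) (t k) v w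
        - 1 / 2 * ((if a = k then wedgeAt x (t k) v w else 0)
          + (if b = k then wedgeAt y (t k) v w else 0)) := by
    intro k
    split_ifs <;> simp [wedgeAt] <;> ring
  rw [Finset.sum_congr rfl fun k _ => h k, Finset.sum_sub_distrib, ← Finset.mul_sum,
    Finset.sum_add_distrib]
  simp

variable {n : ℕ} {u : V →L[ℝ] CoframeModel n}

theorem cTheta0_comp_mem_gen1 : (cTheta0 n).comp u ∈ gen1 u := Or.inl rfl

theorem cTheta_comp_mem_gen1 (k : Fin n) : (cTheta k).comp u ∈ gen1 u := Or.inr ⟨k, rfl⟩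

theorem gen1_subset_gen2 : gen1 u ⊆ gen2 u := Set.subset_union_left

theorem mem_annih {S : Set (V →L[ℝ] ℝ)} {v : V} : v ∈ annih S ↔ ∀ s ∈ S, s v = 0 := by
  simp [annih]

theorem mem_annih_gen0 {v : V} : v ∈ annih (gen0 u) ↔ cTheta0 n (u v) = 0 := by
  simp [mem_annih, gen0]

theorem mem_annih_gen1 {v : V} :
    v ∈ annih (gen1 u) ↔ cTheta0 n (u v) = 0 ∧ thetaVec (u v) = 0 := by
  rw [mem_annih]
  constructor
  · intro h
    exact ⟨h _ cTheta0_comp_mem_gen1, funext fun k => h _ (cTheta_comp_mem_gen1 k)⟩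
  · rintro ⟨h0, h1⟩ s (hs | ⟨k, rfl⟩)
    · rw [gen0, Set.mem_singleton_iff] at hs
      rw [hs]
      exact h0
    · exact congrFun h1 k

theorem mem_annih_gen2 {v : V} : v ∈ annih (gen2 u) ↔ etaMat (u v) = 0 := by
  rw [etaMat_eq_zero_iff, ← and_assoc, ← mem_annih_gen1, mem_annih, mem_annih]
  constructor
  · intro h
    refine ⟨fun s hs => h s (gen1_subset_gen2 hs), ?_⟩
    ext i j
    exact h _ (Or.inr ⟨(i, j), rfl⟩)
  · rintro ⟨h1, h2⟩ s (hs | ⟨k, rfl⟩)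
    · exact h1 s hs
    · exact congrFun (congrFun h2 k.1) k.2

end Ideals

section Torsion

variable {n : ℕ}
  {EZ : Type*} [NormedAddCommGroup EZ] [NormedSpace ℝ EZ]
  {Z : Type*} [TopologicalSpace Z] [ChartedSpace EZ Z]
  {EP : Type*} [NormedAddCommGroup EP] [NormedSpace ℝ EP]
  {P : Type*} [TopologicalSpace P] [ChartedSpace EP P]
  {EF : Type*} [NormedAddCommGroup EF] [NormedSpace ℝ EF]
  {F : Type*} [TopologicalSpace F] [ChartedSpace EF F]
  {ι : P → CoframeBundle n EZ Z} {j : F → P}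

/-- The torsion `T` of the reduced bundle: the part of `-ε ∧ θ₀ - ∑ πᵏ ∧ θ_k` that is left when the
terms `½ (δ_ik β_j + δ_jk β_i)` are subtracted from `πᵏ_ij`. -/
def torsion (ϖ : PseudoConnection (EP := EP) ι) (j : F → P) (a b : Fin n) : TwoForm EF F :=
  fun f =>
    - wedgeAt (pullForm (E := EF) j (ϖ.ε a b) f) ((cTheta0 n).comp (taut (EP := EF) (ι ∘ j) f))
    - ∑ k, wedgeAt (pullForm (E := EF) j (ϖ.π k a b) f
      - (1 / 2 : ℝ) • ((if a = k then pullForm (E := EF) j (ϖ.β b) f else 0)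
        + (if b = k then pullForm (E := EF) j (ϖ.β a) f else 0)))
        ((cTheta k).comp (taut (EP := EF) (ι ∘ j) f))

theorem torsion_symm (ϖ : PseudoConnection (EP := EP) ι) (j : F → P) (a b : Fin n) :
    torsion (EF := EF) ϖ j a b = torsion ϖ j b a := by
  funext f
  simp only [torsion]
  rw [ϖ.ε_symm a b]
  congr 1
  refine Finset.sum_congr rfl fun k _ => ?_
  rw [ϖ.π_symm k a b, add_comm]

theorem isQuadraticIn_torsion {ϖ : PseudoConnection (EP := EP) ι}
    (hred : SatisfiesReductionConditions (EF := EF) ϖ j) (a b : Fin n) (f : F) :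
    IsQuadraticIn (gen2 (taut (EP := EF) (ι ∘ j) f)) (torsion ϖ j a b f) := by
  simp only [torsion]
  refine Submodule.sub_mem _ (Submodule.neg_mem _ (isQuadraticIn_wedgeAt (hred.ε_congr a b f)
    (gen1_subset_gen2 cTheta0_comp_mem_gen1))) (Submodule.sum_mem _ fun k _ =>
    isQuadraticIn_wedgeAt (hred.π_congr k a b f) (gen1_subset_gen2 (cTheta_comp_mem_gen1 k)))

theorem inIdeal_torsion (ϖ : PseudoConnection (EP := EP) ι) (j : F → P) (a b : Fin n) (f : F) :
    InIdeal (gen1 (taut (EP := EF) (ι ∘ j) f)) (torsion ϖ j a b f) := by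
  simp only [torsion]
  exact Submodule.sub_mem _ (Submodule.neg_mem _ (inIdeal_wedgeAt cTheta0_comp_mem_gen1))
    (Submodule.sum_mem _ fun k _ => inIdeal_wedgeAt (cTheta_comp_mem_gen1 k))

theorem neg_wedge_apply {E M : Type*} [NormedAddCommGroup E] [NormedSpace ℝ E]
    [TopologicalSpace M] [ChartedSpace E M] (φ ψ : OneForm E M) (x : M)
    (v w : TangentSpace 𝓘(ℝ, E) x) : (-φ ⩓ ψ) x v w = -wedgeAt (φ x) (ψ x) v w := by
  simp only [wedge, wedgeAt, Pi.neg_apply, _root_.neg_apply]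
  ring

/-- The structure equations pull back to the reduced bundle. -/
theorem reducedStructureEquations_torsion [IsManifold 𝓘(ℝ, EZ) ∞ Z] [IsManifold 𝓘(ℝ, EP) ∞ P]
    [IsManifold 𝓘(ℝ, EF) ∞ F] {ϖ : PseudoConnection (EP := EP) ι}
    (hι : ContMDiff 𝓘(ℝ, EP) (coframeI n EZ) ∞ ι) (hj : ContMDiff 𝓘(ℝ, EF) 𝓘(ℝ, EP) ∞ j)
    (hred : SatisfiesReductionConditions (EF := EF) ϖ j) :
    ReducedStructureEquations (ι ∘ j) (pullForm j ϖ.ρ) (fun a b => pullForm j (ϖ.α a b))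
      (fun a => pullForm j (ϖ.β a)) (fun a => pullForm j (ϖ.μ a))
      (fun a b => pullForm j (ϖ.γ a b)) (torsion (EF := EF) ϖ j) := by
  have hc : taut (EP := EF) (ι ∘ j) = pullForm j (taut (EP := EP) ι) := by
    funext f
    exact (pullForm_taut
      ((contMDiffAt_coframeBundle_iff.1 (hι (j f))).1.mdifferentiableAt (by simp))
      ((hj f).mdifferentiableAt (by simp))).symm
  have hd : ∀ (l : CoframeModel n →L[ℝ] ℝ) (f : F) (v w : TangentSpace 𝓘(ℝ, EF) f),
      extD ((pullForm j (taut (EP := EP) ι)).comp l) f v w =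
        extD ((taut (EP := EP) ι).comp l) (j f) (mfderiv 𝓘(ℝ, EF) 𝓘(ℝ, EP) j f v)
          (mfderiv 𝓘(ℝ, EF) 𝓘(ℝ, EP) j f w) := fun l f v w =>
    extD_pullForm (hj f) (SmoothFormAt.clm_comp l (smoothFormAt_taut (hι (j f)))) v w
  refine ⟨?_, ?_, ?_, ?_⟩
  · rw [hc]
    funext f v w
    rw [hd, ϖ.d_theta0]
    simp only [Pi.sub_apply, Finset.sum_apply]
    rfl
  · intro i
    rw [hc]
    funext f v w
    rw [hd, ϖ.d_theta i]
    simp only [Pi.sub_apply, Finset.sum_apply]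
    rfl
  · intro a b
    have hT := congrFun (hred.T0_eq_zero a b)
    funext f v w
    have hT' := congrFun (congrFun (hT f) v) w
    rw [hc] at hT' ⊢
    rw [Pi.add_apply, Pi.add_apply, Pi.add_apply, hd, ϖ.d_THETA a b]
    simp only [torsion, Pi.sub_apply, Pi.add_apply, Pi.neg_apply (wedgeAt _ _), Finset.sum_apply] at hT' ⊢
    rw [hc]
    rw [neg_wedge_apply, sum_wedgeAt_sub_ite (t := fun k => (cTheta k).comp _)]
    have hsw := wedgeAt_swap (pullForm (E := EF) j (ϖ.β b) f)
      ((cTheta a).comp (pullForm j (taut (EP := EP) ι) f)) v w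
    have key : ∀ {e p s r s' r' t A B C : ℝ}, t = 0 → C = -B →
        -e - p - (s - 1 / 2 * r) + (s' - 1 / 2 * r') + t =
          -(1 / 2 * (A - B)) - (s - 1 / 2 * r) + (s' - 1 / 2 * r')
            + (-e - (p - 1 / 2 * (C + A))) := by
      intro e p s r s' r' t A B C h1 h2
      rw [h1, h2]
      ring
    exact key hT' hsw
  · intro i
    rw [hc]
    funext f v w
    rw [hd, ϖ.d_omega i]
    simp only [Pi.sub_apply, Pi.add_apply, Finset.sum_apply]
    rfl

/-- Along a vector `V` on which `θ₀, θ, Θ` vanish, the matrix `η` changes by an infinitesimal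
congruence: the torsion is quadratic, so it does not contribute. -/
theorem exists_etaMat_vextD_eq {ι : F → CoframeBundle n EZ Z} {ρ : OneForm EF F}
    {α : Fin n → Fin n → OneForm EF F} {β μ : Fin n → OneForm EF F}
    {γ : Fin n → Fin n → OneForm EF F} {T : Fin n → Fin n → TwoForm EF F}
    (hR : ReducedStructureEquations ι ρ α β μ γ T) {f : F} (hs : SmoothFormAt (taut (EP := EF) ι) f)
    (hT : ∀ a b, IsQuadraticIn (gen2 (taut (EP := EF) ι f)) (T a b f))
    {v : TangentSpace 𝓘(ℝ, EF) f} (hv : etaMat (taut (EP := EF) ι f v) = 0) :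
    ∃ A : Matrix (Fin 1 ⊕ Fin n) (Fin 1 ⊕ Fin n) ℝ,
      (∀ k, A (.inl 0) (.inr k) = -cOmega k (taut (EP := EF) ι f v)) ∧
      ∀ w : TangentSpace 𝓘(ℝ, EF) f, etaMat (vextD (taut (EP := EF) ι) f v w) =
        -(A * etaMat (taut (EP := EF) ι f w) + etaMat (taut (EP := EF) ι f w) * A.transpose) := by
  refine ⟨Matrix.fromBlocks (Matrix.of fun _ _ => ρ f v / 2)
    (Matrix.of fun _ k => -cOmega k (taut (EP := EF) ι f v)) (Matrix.of fun i _ => β i f v / 2)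
    (Matrix.of fun i j => α i j f v - if i = j then ρ f v / 2 else 0), fun k => rfl, fun w => ?_⟩
  have hT' : ∀ a b, T a b f v w = 0 := fun a b =>
    (hT a b).apply_eq_zero (mem_annih.1 (mem_annih_gen2.2 hv)) w
  obtain ⟨z0, z1, z2⟩ := etaMat_eq_zero_iff.1 hv
  have z1' : ∀ i, cTheta i (taut (EP := EF) ι f v) = 0 := congrFun z1
  have z2' : ∀ i j, cTHETA i j (taut (EP := EF) ι f v) = 0 := fun i j => congrFun (congrFun z2 i) j
  have e0 := congrFun (congrFun (congrFun hR.d_theta0 f) v) w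
  have e1 := fun i => congrFun (congrFun (congrFun (hR.d_theta i) f) v) w
  have e2 := fun a b => congrFun (congrFun (congrFun (hR.d_THETA a b) f) v) w
  simp only [extD_comp _ hs, Pi.sub_apply, Pi.add_apply, Pi.neg_apply, Pi.smul_apply,
    Finset.sum_apply, wedge, VForm.comp, ContinuousLinearMap.comp_apply, z0, z1', z2', hT',
    _root_.neg_apply, mul_zero, zero_mul, sub_zero, zero_sub, smul_eq_mul] at e0 e1 e2
  have es : ∀ i j, cTHETA i j (taut (EP := EF) ι f w) = cTHETA j i (taut (EP := EF) ι f w) :=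
    fun i j => (coframeEquiv n (taut (EP := EF) ι f w)).2.2.1.2 i j
  ext (i | i) (j | j) <;>
  simp only [etaMat, thetaVec, thetaMat, Matrix.neg_apply, Matrix.add_apply, Matrix.mul_apply,
      Fintype.sum_sum_type, Finset.univ_unique, Finset.sum_singleton, Matrix.fromBlocks_apply₁₁,
      Matrix.fromBlocks_apply₁₂, Matrix.fromBlocks_apply₂₁, Matrix.fromBlocks_apply₂₂,
      Matrix.of_apply, Matrix.transpose_apply, e0, e1, e2, sub_mul, mul_sub, ite_mul, mul_ite,
      Finset.sum_sub_distrib, zero_mul, mul_zero, Finset.sum_ite_eq, Finset.mem_univ, if_true,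
      neg_mul, mul_neg, Finset.sum_neg_distrib]
  · simp only [mul_comm (cTheta _ _)]
    ring
  · simp only [mul_comm (cTheta _ _), es _ j, mul_comm (cTHETA _ _ _)]
    ring
  · simp only [mul_comm (cTheta _ _), mul_comm (cTHETA _ _ _)]
    ring
  · simp only [mul_comm (cTheta _ _), es _ j, mul_comm (cTHETA _ _ _)]
    ring

end Torsion

/-! ### Exterior derivatives of vector valued forms -/

section VectorForms

variable {E : Type*} [NormedAddCommGroup E] [NormedSpace ℝ E]
  {M : Type*} [TopologicalSpace M] [ChartedSpace E M]
  {E' : Type*} [NormedAddCommGroup E'] [NormedSpace ℝ E']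
  {M' : Type*} [TopologicalSpace M'] [ChartedSpace E' M']
  {G : Type*} [NormedAddCommGroup G] [NormedSpace ℝ G]
  {G' : Type*} [NormedAddCommGroup G'] [NormedSpace ℝ G']

theorem vextD_clm_comp (l : G →L[ℝ] G') {φ : VForm E M G} {x : M} (h : SmoothFormAt φ x)
    (v w : TangentSpace 𝓘(ℝ, E) x) : vextD (φ.comp l) x v w = l (vextD φ x v w) := by
  simp only [vextD, map_sub]
  exact congrArg₂ (· - ·) (fderiv_coordForm_comp l h v w) (fderiv_coordForm_comp l h w v)

theorem vextD_pullForm [IsManifold 𝓘(ℝ, E) ∞ M] [IsManifold 𝓘(ℝ, E') ∞ M']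
    {g : M → M'} {x : M} (hg : ContMDiffAt 𝓘(ℝ, E) 𝓘(ℝ, E') ∞ g x) {φ : VForm E' M' G}
    (hφ : SmoothFormAt φ (g x)) (v w : TangentSpace 𝓘(ℝ, E) x) :
    vextD (pullForm (E := E) g φ) x v w =
      vextD φ (g x) (mfderiv 𝓘(ℝ, E) 𝓘(ℝ, E') g x v) (mfderiv 𝓘(ℝ, E) 𝓘(ℝ, E') g x w) := by
  refine (SeparatingDual.eq_iff_forall_dual_eq (R := ℝ)).2 fun l => ?_
  have h1 := extD_comp (l : G →L[ℝ] ℝ) (SmoothFormAt.pullForm hg hφ) v w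
  have h2 := extD_pullForm hg (SmoothFormAt.clm_comp (l : G →L[ℝ] ℝ) hφ) v w
  have h3 := extD_comp (l : G →L[ℝ] ℝ) hφ (mfderiv 𝓘(ℝ, E) 𝓘(ℝ, E') g x v)
    (mfderiv 𝓘(ℝ, E) 𝓘(ℝ, E') g x w)
  exact h1.symm.trans (h2.trans h3)

end VectorForms

/-! ### Coframes over the same point -/

section Fibres

variable {n : ℕ}
  {EY : Type*} [NormedAddCommGroup EY] [NormedSpace ℝ EY]
  {EZ : Type*} [NormedAddCommGroup EZ] [NormedSpace ℝ EZ]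
  {EX : Type*} [NormedAddCommGroup EX] [NormedSpace ℝ EX]
  {Y : Type*} [TopologicalSpace Y] [ChartedSpace EY Y]
  {Z : Type*} [TopologicalSpace Z] [ChartedSpace EZ Z]
  {X : Type*} [TopologicalSpace X] [ChartedSpace EX X]
  {𝒢 : LegendrianPathGeometry n (EY := EY) (EZ := EZ) (EX := EX) Y Z X}
  {EF : Type*} [NormedAddCommGroup EF] [NormedSpace ℝ EF]
  {F : Type*} [TopologicalSpace F] [ChartedSpace EF F]

theorem exists_isAdaptedAt {u : CoframeBundle n EZ Z} (hu : u ∈ adaptedCoframes 𝒢) :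
    ∃ c : VForm EZ Z (CoframeModel n), IsAdaptedAt 𝒢 c u.1 ∧ c u.1 = u.2 := by
  obtain ⟨c, hc, hcu⟩ := hu
  exact ⟨c, hc.self_of_nhds.2, hcu⟩

theorem bijective_of_mem_adaptedCoframes {u : CoframeBundle n EZ Z}
    (hu : u ∈ adaptedCoframes 𝒢) : Function.Bijective u.2 := by
  obtain ⟨c, hc, hcu⟩ := exists_isAdaptedAt hu
  rw [← hcu]
  exact hc.bijective

theorem cTheta0_eq_zero_iff {u : CoframeBundle n EZ Z} (hu : u ∈ adaptedCoframes 𝒢)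
    (v : TangentSpace 𝓘(ℝ, EZ) u.1) : cTheta0 n (u.2 v) = 0 ↔
      mfderiv 𝓘(ℝ, EZ) 𝓘(ℝ, EY) 𝒢.p u.1 v ∈ 𝒢.D (𝒢.p u.1) := by
  obtain ⟨c, hc, hcu⟩ := exists_isAdaptedAt hu
  rw [← hcu, ← mem_annih_gen0, hc.contact_form]
  rfl

theorem thetaVec_eq_zero_iff {u : CoframeBundle n EZ Z} (hu : u ∈ adaptedCoframes 𝒢)
    (v : TangentSpace 𝓘(ℝ, EZ) u.1) : (cTheta0 n (u.2 v) = 0 ∧ thetaVec (u.2 v) = 0) ↔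
      mfderiv 𝓘(ℝ, EZ) 𝓘(ℝ, EY) 𝒢.p u.1 v ∈ 𝒢.L u.1 := by
  obtain ⟨c, hc, hcu⟩ := exists_isAdaptedAt hu
  rw [← hcu, ← mem_annih_gen1, hc.canonical_system]
  rfl

theorem etaMat_eq_zero_iff_mfderiv {u : CoframeBundle n EZ Z} (hu : u ∈ adaptedCoframes 𝒢)
    (v : TangentSpace 𝓘(ℝ, EZ) u.1) : etaMat (u.2 v) = 0 ↔
      mfderiv 𝓘(ℝ, EZ) 𝓘(ℝ, EX) 𝒢.τ u.1 v = 0 := by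
  obtain ⟨c, hc, hcu⟩ := exists_isAdaptedAt hu
  rw [← hcu, ← mem_annih_gen2, hc.frobenius_system]
  rfl

/-- The coframe values with `θ₀, θ, Θ` zero and with given `ω`. -/
def ofOmega (y : Fin n → ℝ) : CoframeModel n := (coframeEquiv n).symm (0, 0, 0, y)

theorem etaMat_ofOmega (y : Fin n → ℝ) : etaMat (ofOmega y) = 0 :=
  etaMat_eq_zero_iff.2 ⟨rfl, rfl, rfl⟩

theorem cOmega_ofOmega (y : Fin n → ℝ) (k : Fin n) : cOmega k (ofOmega y) = y k := rfl

/-- A manifold `F` of coframes of `Z`, mapped to the coframe bundle by `κ`, whose coframes are adapted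
to `𝒢`, whose matrix `η` varies by infinitesimal congruences along the leaves, and on which the changes
of coframe over a point extend to symmetries. -/
structure CoframeReduction [IsManifold 𝓘(ℝ, EZ) ∞ Z]
    (𝒢 : LegendrianPathGeometry n (EY := EY) (EZ := EZ) (EX := EX) Y Z X)
    (κ : F → CoframeBundle n EZ Z) : Prop where
  contMDiff : ContMDiff 𝓘(ℝ, EF) (coframeI n EZ) ∞ κ
  mem : ∀ f, κ f ∈ adaptedCoframes 𝒢
  submersion : Manifold.IsSubmersion 𝓘(ℝ, EF) 𝓘(ℝ, EZ) ∞ fun f => (κ f).1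
  surjective : Function.Surjective fun f => (κ f).1
  /-- Along the vectors `v` on which `θ₀, θ, Θ` vanish, the matrix `η` changes by an infinitesimal
  congruence, with a matrix whose first row contains `-ω(v)`. -/
  variation : ∀ (f : F) (v : TangentSpace 𝓘(ℝ, EF) f), etaMat (taut (EP := EF) κ f v) = 0 →
    ∃ A : Matrix (Fin 1 ⊕ Fin n) (Fin 1 ⊕ Fin n) ℝ,
      (∀ k, A (.inl 0) (.inr k) = -cOmega k (taut (EP := EF) κ f v)) ∧
      ∀ w : TangentSpace 𝓘(ℝ, EF) f, etaMat (vextD (taut (EP := EF) κ) f v w) =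
        -(A * etaMat (taut (EP := EF) κ f w) + etaMat (taut (EP := EF) κ f w) * A.transpose)
  /-- Coframes over the same point differ by a linear transformation that extends to a smooth
  symmetry of `F`. -/
  symmetry : ∀ f f' : F, (κ f).1 = (κ f').1 →
    ∃ (h : CoframeModel n ≃L[ℝ] CoframeModel n) (R : F → F),
      ContMDiff 𝓘(ℝ, EF) 𝓘(ℝ, EF) ∞ R ∧ R f = f' ∧
      ∀ f, κ (R f) = ⟨(κ f).1, (h : CoframeModel n →L[ℝ] CoframeModel n).comp (κ f).2⟩

namespace CoframeReduction

variable {κ : F → CoframeBundle n EZ Z} [IsManifold 𝓘(ℝ, EZ) ∞ Z]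

theorem contMDiffAt_fst (hF : CoframeReduction (EF := EF) 𝒢 κ) (f : F) :
    ContMDiffAt 𝓘(ℝ, EF) 𝓘(ℝ, EZ) ∞ (fun f => (κ f).1) f :=
  (contMDiffAt_coframeBundle_iff.1 (hF.contMDiff f)).1

variable [IsManifold 𝓘(ℝ, EF) ∞ F]

theorem smoothFormAt_taut (hF : CoframeReduction (EF := EF) 𝒢 κ) (f : F) :
    SmoothFormAt (taut (EP := EF) κ) f :=
  LegPath.smoothFormAt_taut (hF.contMDiff f)

theorem surjective_taut (hF : CoframeReduction (EF := EF) 𝒢 κ) (f : F) :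
    Function.Surjective (taut (EP := EF) κ f) :=
  (bijective_of_mem_adaptedCoframes (hF.mem f)).2.comp
    (surjective_mfderiv_of_isSubmersionAt (hF.submersion.isSubmersionAt f))

/-- A linear transformation `h` of the coframes that extends to a smooth symmetry `R` of `F`
rescales `det η`. -/
theorem exists_detEta_eq_mul_of_symmetry (hF : CoframeReduction (EF := EF) 𝒢 κ) (hn : 0 < n) (f : F)
    {R : F → F} (hRs : ContMDiff 𝓘(ℝ, EF) 𝓘(ℝ, EF) ∞ R)
    {h : CoframeModel n ≃L[ℝ] CoframeModel n}
    (hh : ∀ f, κ (R f) = ⟨(κ f).1, (h : CoframeModel n →L[ℝ] CoframeModel n).comp (κ f).2⟩) :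
    ∃ k : ℝ, ∀ u, detEta (h u) = k * detEta u := by
  have hmem' : (⟨(κ f).1, (h : CoframeModel n →L[ℝ] CoframeModel n).comp (κ f).2⟩ :
      CoframeBundle n EZ Z) ∈ adaptedCoframes 𝒢 := hh f ▸ hF.mem (R f)
  have hbij := bijective_of_mem_adaptedCoframes (hF.mem f)
  have hη : ∀ u, etaMat (h u) = 0 ↔ etaMat u = 0 := by
    intro u
    obtain ⟨v, rfl⟩ := hbij.2 u
    exact (etaMat_eq_zero_iff_mfderiv hmem' v).trans (etaMat_eq_zero_iff_mfderiv (hF.mem f) v).symm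
  -- the symmetry `R` transforms the tautological form by `h`
  have hpull : ∀ f, pullForm (E := EF) R (taut (EP := EF) κ) f
      = ((taut (EP := EF) κ).comp (h : CoframeModel n →L[ℝ] CoframeModel n)) f := by
    intro f
    have hπd : MDifferentiableAt 𝓘(ℝ, EF) 𝓘(ℝ, EZ) (fun f => (κ f).1) (R f) :=
      (hF.contMDiffAt_fst (R f)).mdifferentiableAt (by simp)
    rw [pullForm_taut hπd ((hRs f).mdifferentiableAt (by simp))]
    have : κ ∘ R = fun f => (⟨(κ f).1,
        (h : CoframeModel n →L[ℝ] CoframeModel n).comp (κ f).2⟩ : CoframeBundle n EZ Z) :=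
      funext hh
    rw [this]
    rfl
  have hsm := hF.smoothFormAt_taut
  have htaut := hF.surjective_taut f
  refine exists_detEta_eq_mul hn h ?_ ?_ (fun u hu => (hη u).2 hu) fun y => ?_
  · intro u
    obtain ⟨v, rfl⟩ := hbij.2 u
    exact (cTheta0_eq_zero_iff hmem' v).trans (cTheta0_eq_zero_iff (hF.mem f) v).symm
  · intro u
    obtain ⟨v, rfl⟩ := hbij.2 u
    exact (thetaVec_eq_zero_iff hmem' v).trans (thetaVec_eq_zero_iff (hF.mem f) v).symm
  -- `R` takes `v` to a vector with `η = 0` and `ω = y`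
  obtain ⟨v, hv⟩ := htaut (h.symm (ofOmega y))
  let dR : TangentSpace 𝓘(ℝ, EF) f →L[ℝ] TangentSpace 𝓘(ℝ, EF) (R f) :=
    mfderiv 𝓘(ℝ, EF) 𝓘(ℝ, EF) R f
  have hdR : ∀ w : TangentSpace 𝓘(ℝ, EF) f,
      taut (EP := EF) κ (R f) (dR w) = h (taut (EP := EF) κ f w) := fun w =>
    congrArg (fun l : EF →L[ℝ] CoframeModel n => l w) (hpull f)
  have hv' : taut (EP := EF) κ (R f) (dR v) = ofOmega y := by
    rw [hdR, hv]
    exact h.apply_symm_apply _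
  have hv0 : etaMat (taut (EP := EF) κ f v) = 0 := by
    rw [hv, ← hη, h.apply_symm_apply]
    exact etaMat_ofOmega y
  obtain ⟨A, -, hA⟩ := hF.variation f v hv0
  obtain ⟨A', hA0', hA'⟩ := hF.variation (R f) (dR v) (by rw [hv']; exact etaMat_ofOmega y)
  refine ⟨A, A', fun k => ?_, fun u => ?_⟩
  · rw [hA0' k, hv', cOmega_ofOmega]
  · obtain ⟨w, rfl⟩ := htaut u
    refine ⟨vextD (taut (EP := EF) κ) f v w, hA w, ?_⟩
    have h1 : h (vextD (taut (EP := EF) κ) f v w) =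
        vextD (taut (EP := EF) κ) (R f) (dR v) (dR w) := by
      have h2 := vextD_clm_comp (h : CoframeModel n →L[ℝ] CoframeModel n) (hsm f) v w
      have h3 := vextD_pullForm (hRs f) (hsm (R f)) v w
      rw [show pullForm (E := EF) R (taut (EP := EF) κ) = _ from funext hpull] at h3
      exact h2.symm.trans h3
    rw [h1, hA' (dR w), hdR]

end CoframeReduction

end Fibres

/-! ### The determinant on the space of leaves -/

section Leaves

variable {n : ℕ}
  {EY : Type*} [NormedAddCommGroup EY] [NormedSpace ℝ EY]
  {EZ : Type*} [NormedAddCommGroup EZ] [NormedSpace ℝ EZ]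
  {EX : Type*} [NormedAddCommGroup EX] [NormedSpace ℝ EX]
  {Y : Type*} [TopologicalSpace Y] [ChartedSpace EY Y]
  {Z : Type*} [TopologicalSpace Z] [ChartedSpace EZ Z]
  {X : Type*} [TopologicalSpace X] [ChartedSpace EX X]
  {𝒢 : LegendrianPathGeometry n (EY := EY) (EZ := EZ) (EX := EX) Y Z X}
  {EF : Type*} [NormedAddCommGroup EF] [NormedSpace ℝ EF]
  {F : Type*} [TopologicalSpace F] [ChartedSpace EF F]

/-- The function `det η` of a coframe `u` adapted to `𝒢`, as a function on the tangent space of the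
space of leaves: a tangent vector `x` of the space of leaves is lifted to `Z` arbitrarily. The value is
independent of the lift, because `η` vanishes exactly on the tangent vectors of the leaf. It is junk for
`x` outside of the image of the differential of `τ`, which is everything as `τ` is a submersion. -/
def leafDet (𝒢 : LegendrianPathGeometry n (EY := EY) (EZ := EZ) (EX := EX) Y Z X)
    (u : CoframeBundle n EZ Z) (x : EX) : ℝ :=
  detEta (u.2 (Function.invFun (mfderiv 𝓘(ℝ, EZ) 𝓘(ℝ, EX) 𝒢.τ u.1) x))

theorem etaMat_eq_of_mfderiv_eq {u : CoframeBundle n EZ Z} (hu : u ∈ adaptedCoframes 𝒢)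
    {v w : TangentSpace 𝓘(ℝ, EZ) u.1} (h : mfderiv 𝓘(ℝ, EZ) 𝓘(ℝ, EX) 𝒢.τ u.1 v =
      mfderiv 𝓘(ℝ, EZ) 𝓘(ℝ, EX) 𝒢.τ u.1 w) : etaMat (u.2 v) = etaMat (u.2 w) := by
  rw [← sub_eq_zero, ← etaMat_sub, ← map_sub, etaMat_eq_zero_iff_mfderiv hu, map_sub, h, sub_self]

theorem leafDet_mfderiv {u : CoframeBundle n EZ Z} (hu : u ∈ adaptedCoframes 𝒢)
    (v : TangentSpace 𝓘(ℝ, EZ) u.1) :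
    leafDet 𝒢 u (mfderiv 𝓘(ℝ, EZ) 𝓘(ℝ, EX) 𝒢.τ u.1 v) = detEta (u.2 v) := by
  exact congrArg Matrix.det (etaMat_eq_of_mfderiv_eq hu (Function.invFun_eq ⟨v, rfl⟩))

theorem exists_detEta_ne_zero (n : ℕ) : ∃ u : CoframeModel n, detEta u ≠ 0 := by
  refine ⟨ofBlocks (1 / 2, 0, 1), ?_⟩
  have : etaMat (ofBlocks (1 / 2, 0, 1) : CoframeModel n) = 1 := by
    rw [etaMat, thetaVec_ofBlocks, cTheta0_ofBlocks,
      thetaMat_ofBlocks (Matrix.isSymm_one (n := Fin n) (α := ℝ))]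
    rw [← Matrix.fromBlocks_one]
    congr 1
    ext i j
    rw [Subsingleton.elim i j]
    simp
  rw [detEta_eq_det_etaMat, this, Matrix.det_one]
  exact one_ne_zero

theorem exists_leafDet_ne_zero {u : CoframeBundle n EZ Z} (hu : u ∈ adaptedCoframes 𝒢) :
    ∃ x, leafDet 𝒢 u x ≠ 0 := by
  obtain ⟨a, ha⟩ := exists_detEta_ne_zero n
  obtain ⟨v, rfl⟩ := (bijective_of_mem_adaptedCoframes hu).2 a
  exact ⟨_, (leafDet_mfderiv hu v).symm ▸ ha⟩

/-- The functions `leafDet` of two coframes, possibly over different points of a leaf, agree up to a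
nonzero factor. -/
def LeafDetProp (𝒢 : LegendrianPathGeometry n (EY := EY) (EZ := EZ) (EX := EX) Y Z X)
    (u u' : CoframeBundle n EZ Z) : Prop :=
  ∃ k : ℝ, k ≠ 0 ∧ ∀ x, leafDet 𝒢 u' x = k * leafDet 𝒢 u x

theorem LeafDetProp.symm {u u' : CoframeBundle n EZ Z} (h : LeafDetProp 𝒢 u u') :
    LeafDetProp 𝒢 u' u := by
  obtain ⟨k, hk, h⟩ := h
  exact ⟨k⁻¹, inv_ne_zero hk, fun x => by rw [h]; field_simp⟩

theorem LeafDetProp.trans {u u' u'' : CoframeBundle n EZ Z} (h : LeafDetProp 𝒢 u u')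
    (h' : LeafDetProp 𝒢 u' u'') : LeafDetProp 𝒢 u u'' := by
  obtain ⟨k, hk, h⟩ := h
  obtain ⟨k', hk', h'⟩ := h'
  exact ⟨k' * k, mul_ne_zero hk' hk, fun x => by rw [h', h, mul_assoc]⟩

theorem leafDetProp_of_eq_mul {u u' : CoframeBundle n EZ Z} (hu' : u' ∈ adaptedCoframes 𝒢) {k : ℝ}
    (h : ∀ x, leafDet 𝒢 u' x = k * leafDet 𝒢 u x) : LeafDetProp 𝒢 u u' := by
  refine ⟨k, ?_, h⟩
  rintro rfl
  obtain ⟨x, hx⟩ := exists_leafDet_ne_zero hu'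
  exact hx (by rw [h, zero_mul])

theorem surjective_mfderiv_τ [IsManifold 𝓘(ℝ, EZ) ∞ Z] [IsManifold 𝓘(ℝ, EX) ∞ X]
    (z : Z) : Function.Surjective (mfderiv 𝓘(ℝ, EZ) 𝓘(ℝ, EX) 𝒢.τ z) :=
  surjective_mfderiv_of_isSubmersionAt (𝒢.τ_submersion.isSubmersionAt z)

namespace CoframeReduction

variable {κ : F → CoframeBundle n EZ Z} [IsManifold 𝓘(ℝ, EZ) ∞ Z]

theorem mfderiv_leaf (hF : CoframeReduction (EF := EF) 𝒢 κ) (f : F)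
    (w : TangentSpace 𝓘(ℝ, EF) f) :
    mfderiv 𝓘(ℝ, EF) 𝓘(ℝ, EX) (fun f => 𝒢.τ (κ f).1) f w =
      mfderiv 𝓘(ℝ, EZ) 𝓘(ℝ, EX) 𝒢.τ (κ f).1
        (mfderiv 𝓘(ℝ, EF) 𝓘(ℝ, EZ) (fun f => (κ f).1) f w) := by
  have h : mfderiv 𝓘(ℝ, EF) 𝓘(ℝ, EX) (fun f => 𝒢.τ (κ f).1) f =
      (mfderiv 𝓘(ℝ, EZ) 𝓘(ℝ, EX) 𝒢.τ (κ f).1).comp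
        (mfderiv 𝓘(ℝ, EF) 𝓘(ℝ, EZ) (fun f => (κ f).1) f) :=
    mfderiv_comp f ((𝒢.τ_submersion.isSubmersionAt _).contMDiffAt.mdifferentiableAt (by simp))
      ((hF.contMDiffAt_fst f).mdifferentiableAt (by simp))
  rw [h]
  rfl

theorem contMDiffAt_leaf (hF : CoframeReduction (EF := EF) 𝒢 κ) (f : F) :
    ContMDiffAt 𝓘(ℝ, EF) 𝓘(ℝ, EX) ∞ (fun f => 𝒢.τ (κ f).1) f :=
  (𝒢.τ_submersion.isSubmersionAt _).contMDiffAt.comp f (hF.contMDiffAt_fst f)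

theorem leafDet_mfderiv_leaf (hF : CoframeReduction (EF := EF) 𝒢 κ) (f : F)
    (w : TangentSpace 𝓘(ℝ, EF) f) :
    leafDet 𝒢 (κ f) (mfderiv 𝓘(ℝ, EF) 𝓘(ℝ, EX) (fun f => 𝒢.τ (κ f).1) f w) =
      detEta (taut (EP := EF) κ f w) := by
  rw [hF.mfderiv_leaf]
  exact leafDet_mfderiv (hF.mem f) _

theorem etaMat_taut_eq_zero_iff (hF : CoframeReduction (EF := EF) 𝒢 κ) (f : F)
    (w : TangentSpace 𝓘(ℝ, EF) f) : etaMat (taut (EP := EF) κ f w) = 0 ↔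
      mfderiv 𝓘(ℝ, EF) 𝓘(ℝ, EX) (fun f => 𝒢.τ (κ f).1) f w = 0 := by
  rw [hF.mfderiv_leaf]
  exact etaMat_eq_zero_iff_mfderiv (hF.mem f) _

variable [IsManifold 𝓘(ℝ, EF) ∞ F]

theorem leafDetProp_of_fst_eq (hF : CoframeReduction (EF := EF) 𝒢 κ) (hn : 0 < n) {f f' : F}
    (h : (κ f).1 = (κ f').1) : LeafDetProp 𝒢 (κ f) (κ f') := by
  obtain ⟨l, R, hR, rfl, hl⟩ := hF.symmetry f f' h
  obtain ⟨k, hk⟩ := hF.exists_detEta_eq_mul_of_symmetry hn f hR hl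
  refine leafDetProp_of_eq_mul (hF.mem _) (k := k) fun x => ?_
  rw [hl f]
  exact hk _

variable [IsManifold 𝓘(ℝ, EX) ∞ X]

theorem surjective_mfderiv_leaf (hF : CoframeReduction (EF := EF) 𝒢 κ) (f : F) :
    Function.Surjective (mfderiv 𝓘(ℝ, EF) 𝓘(ℝ, EX) (fun f => 𝒢.τ (κ f).1) f) := by
  have h := (surjective_mfderiv_τ (𝒢 := 𝒢) (κ f).1).comp
    (surjective_mfderiv_of_isSubmersionAt (g := fun f => (κ f).1) (hF.submersion.isSubmersionAt f))
  intro x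
  obtain ⟨w, hw⟩ := h x
  exact ⟨w, (hF.mfderiv_leaf f w).trans hw⟩

/-- The determinant is locally constant, up to a factor, along the leaves. -/
theorem eventually_leafDetProp (hF : CoframeReduction (EF := EF) 𝒢 κ) (f₀ : F) :
    ∀ᶠ z in 𝓝 (κ f₀).1, 𝒢.τ z = 𝒢.τ (κ f₀).1 →
      ∃ f, (κ f).1 = z ∧ LeafDetProp 𝒢 (κ f₀) (κ f) := by
  obtain ⟨σ, hσ, hσ0⟩ := exists_local_section (hF.submersion.isSubmersionAt f₀)
  obtain ⟨C, _, _, ⟨S⟩⟩ := exists_submersionCoords (𝒢.τ_submersion.isSubmersionAt (κ f₀).1)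
  set z₀ : Z := (κ f₀).1 with hz₀
  set p₀ : EX × C := S.Ψ z₀ with hp₀
  let φ : EX × C → F := fun p => σ (S.Φ p)
  have hΦp₀ : S.Φ p₀ = z₀ := S.Φ_Ψ.self_of_nhds
  have hp₀1 : p₀.1 = S.κ (𝒢.τ z₀) := S.Ψ_fst.self_of_nhds
  have hΦc : ContinuousAt S.Φ p₀ := S.contMDiffAt_Φ.self_of_nhds.continuousAt
  have hσ' : ∀ᶠ p in 𝓝 p₀, ContMDiffAt 𝓘(ℝ, EZ) 𝓘(ℝ, EF) ∞ σ (S.Φ p) ∧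
      (κ (σ (S.Φ p))).1 = S.Φ p := hΦc.eventually (by rwa [hΦp₀])
  have hφ : ∀ᶠ p in 𝓝 p₀, ContMDiffAt 𝓘(ℝ, EX × C) 𝓘(ℝ, EF) ∞ φ p := by
    filter_upwards [S.contMDiffAt_Φ, hσ'] with p h1 h2
    exact h2.1.comp p h1
  have hκ' : ∀ᶠ p in 𝓝 p₀, ContMDiffAt 𝓘(ℝ, EX) 𝓘(ℝ, EX) ∞ S.κ' p.1 := by
    have h1 := S.contMDiffAt_κ'
    rw [← hp₀1] at h1
    exact continuousAt_fst.eventually h1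
  have hG : ∀ᶠ p in 𝓝 p₀, 𝒢.τ (κ (φ p)).1 = S.κ' p.1 := by
    filter_upwards [S.g_Φ, hσ'] with p h1 h2
    rw [← h1, ← h2.2]
  have hJ : ∀ᶠ p in 𝓝 p₀, ∀ v : EX × C,
      (mfderiv 𝓘(ℝ, EF) 𝓘(ℝ, EX) (fun f => 𝒢.τ (κ f).1) (φ p)
        (mfderiv 𝓘(ℝ, EX × C) 𝓘(ℝ, EF) φ p v) : EX) =
      mfderiv 𝓘(ℝ, EX) 𝓘(ℝ, EX) S.κ' p.1 v.1 := by
    filter_upwards [hφ, hκ', hG.eventually_nhds] with p h1 h2 h3 v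
    have d1 : mfderiv 𝓘(ℝ, EX × C) 𝓘(ℝ, EX) (fun q => 𝒢.τ (κ (φ q)).1) p =
        (mfderiv 𝓘(ℝ, EF) 𝓘(ℝ, EX) (fun f => 𝒢.τ (κ f).1) (φ p)).comp
          (mfderiv 𝓘(ℝ, EX × C) 𝓘(ℝ, EF) φ p) :=
      mfderiv_comp p ((hF.contMDiffAt_leaf (φ p)).mdifferentiableAt (by simp))
        (h1.mdifferentiableAt (by simp))
    have d2 : mfderiv 𝓘(ℝ, EX × C) 𝓘(ℝ, EX) (fun q : EX × C => S.κ' q.1) p =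
        (mfderiv 𝓘(ℝ, EX) 𝓘(ℝ, EX) S.κ' p.1).comp
          (mfderiv 𝓘(ℝ, EX × C) 𝓘(ℝ, EX) Prod.fst p) :=
      mfderiv_comp p (h2.mdifferentiableAt (by simp))
        (contDiff_fst.contMDiff.contMDiffAt.mdifferentiableAt (n := ∞) (by simp))
    have d3 : mfderiv 𝓘(ℝ, EX × C) 𝓘(ℝ, EX) (fun q => 𝒢.τ (κ (φ q)).1) p =
        mfderiv 𝓘(ℝ, EX × C) 𝓘(ℝ, EX) (fun q : EX × C => S.κ' q.1) p :=
      Filter.EventuallyEq.mfderiv_eq h3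
    have d4 : mfderiv 𝓘(ℝ, EX × C) 𝓘(ℝ, EX) (Prod.fst : EX × C → EX) p =
        ContinuousLinearMap.fst ℝ EX C := by
      rw [mfderiv_eq_fderiv]
      exact fderiv_fst
    have d5 : (mfderiv 𝓘(ℝ, EX × C) 𝓘(ℝ, EX) (Prod.fst : EX × C → EX) p v : EX) = v.1 :=
      congrArg (fun l : EX × C →L[ℝ] EX => l v) d4
    have d6 := congrArg (fun l : EX × C →L[ℝ] EX => l v) (d1.symm.trans (d3.trans d2))
    exact d6.trans (congrArg (mfderiv 𝓘(ℝ, EX) 𝓘(ℝ, EX) S.κ' p.1 : EX →L[ℝ] EX) d5)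
  let c : VForm (EX × C) (EX × C) (CoframeModel n) := pullForm φ (taut (EP := EF) κ)
  have hL : ∀ᶠ p in 𝓝 p₀, ∀ v : EX × C, detEta (c p v) =
      leafDet 𝒢 (κ (φ p)) (mfderiv 𝓘(ℝ, EX) 𝓘(ℝ, EX) S.κ' p.1 v.1) := by
    filter_upwards [hJ] with p h v
    rw [← h v]
    exact (hF.leafDet_mfderiv_leaf (φ p) _).symm
  have hsurj : Function.Surjective (mfderiv 𝓘(ℝ, EX) 𝓘(ℝ, EX) S.κ' p₀.1) := by
    intro x
    have h1 := S.contMDiffAt_κ'.self_of_nhds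
    have h2 := mfderiv_mfderiv_of_section (h1.mdifferentiableAt (by simp))
      (S.contMDiffAt_κ.self_of_nhds.mdifferentiableAt (by simp)) S.κ'_κ x
    rw [hp₀1]
    exact ⟨_, h2⟩
  have hφp₀ : φ p₀ = f₀ := by
    change σ (S.Φ p₀) = f₀
    rw [hΦp₀, hσ0]
  obtain ⟨x₀, hx₀⟩ := exists_leafDet_ne_zero (hF.mem f₀)
  obtain ⟨v₀, rfl⟩ := hsurj x₀
  have key := eventually_detEta_eq_mul (c := c) (p₀ := p₀) (v₀ := v₀)
    (by
      filter_upwards [hφ] with p h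
      exact SmoothFormAt.pullForm h (hF.smoothFormAt_taut _))
    (by
      filter_upwards [hJ] with p h w
      refine (hF.etaMat_taut_eq_zero_iff (φ p) _).2 ?_
      exact (h (0, w)).trans (map_zero _))
    (by
      filter_upwards [hJ, hφ] with p h h' w
      obtain ⟨A, -, hA⟩ := hF.variation (φ p)
        (mfderiv 𝓘(ℝ, EX × C) 𝓘(ℝ, EF) φ p ((0, w) : EX × C))
        ((hF.etaMat_taut_eq_zero_iff (φ p) _).2 ((h (0, w)).trans (map_zero _)))
      refine ⟨A, fun v => ?_⟩
      have h1 := vextD_pullForm h' (hF.smoothFormAt_taut (φ p)) ((0, w) : EX × C) v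
      exact (congrArg etaMat h1).trans (hA _))
    (by
      have h1 := hL.self_of_nhds (v₀, 0)
      rw [hφp₀] at h1
      rw [h1]
      exact hx₀)
  have key' := (continuousAt_snd.comp S.continuousAt_Ψ).eventually key
  have hΨ := S.continuousAt_Ψ.eventually (hL.and hσ')
  filter_upwards [key', hΨ, S.Φ_Ψ, S.Ψ_fst] with z h1 h2 h3 h4 hz
  obtain ⟨k, hk⟩ := h1
  obtain ⟨h2, -, h5⟩ := h2
  have h6 : S.Ψ z = (p₀.1, (S.Ψ z).2) := Prod.ext (by rw [h4, hz, hp₀1]) rfl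
  refine ⟨σ z, ?_, leafDetProp_of_eq_mul (hF.mem _) (k := k) fun x => ?_⟩
  · rwa [h3] at h5
  · obtain ⟨v, rfl⟩ := hsurj x
    let c' : EX × C → (EX × C →L[ℝ] CoframeModel n) := c
    let dκ' : EX → (EX →L[ℝ] EX) := fun e => mfderiv 𝓘(ℝ, EX) 𝓘(ℝ, EX) S.κ' e
    have h7 : detEta (c' (p₀.1, (S.Ψ z).2) (v, 0)) = k * detEta (c' p₀ (v, 0)) := hk v
    have h8 : detEta (c' (S.Ψ z) (v, 0)) = leafDet 𝒢 (κ (φ (S.Ψ z))) (dκ' (S.Ψ z).1 v) :=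
      h2 (v, 0)
    have h9 : detEta (c' p₀ (v, 0)) = leafDet 𝒢 (κ (φ p₀)) (dκ' p₀.1 v) :=
      hL.self_of_nhds (v, 0)
    have h10 : φ (S.Ψ z) = σ z := congrArg σ h3
    rw [← h6, h8, h9, h10, hφp₀, h4, hz, ← hp₀1] at h7
    exact h7

/-- Up to a factor, the determinant depends only on the leaf. -/
theorem leafDetProp_of_leaf_eq (hF : CoframeReduction (EF := EF) 𝒢 κ) (hn : 0 < n) {f f' : F}
    (h : 𝒢.τ (κ f).1 = 𝒢.τ (κ f').1) : LeafDetProp 𝒢 (κ f) (κ f') := by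
  refine (𝒢.leaf_connected (𝒢.τ (κ f).1)).isPreconnected.induction₂
    (fun z z' => ∀ f f', (κ f).1 = z → (κ f').1 = z' → LeafDetProp 𝒢 (κ f) (κ f'))
    ?_ ?_ ?_ (x := (κ f).1) (y := (κ f').1) rfl h.symm f f' rfl rfl
  · intro z hz
    obtain ⟨f₀, rfl⟩ := hF.surjective z
    filter_upwards [self_mem_nhdsWithin, nhdsWithin_le_nhds (hF.eventually_leafDetProp f₀)]
      with z' hz' h' f₁ f₂ h₁ h₂
    obtain ⟨f₃, h₃, h₄⟩ := h' (hz'.trans hz.symm)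
    exact ((hF.leafDetProp_of_fst_eq hn h₁).trans h₄).trans
      (hF.leafDetProp_of_fst_eq hn (h₃.trans h₂.symm))
  · intro z z' z'' _ _ _ h₁ h₂ f₁ f₃ e₁ e₃
    obtain ⟨f₂, e₂⟩ := hF.surjective z'
    exact (h₁ f₁ f₂ e₁ e₂).trans (h₂ f₂ f₃ e₂ e₃)
  · intro z z' _ _ h₁ f₁ f₂ e₁ e₂
    exact (h₁ f₂ f₁ e₂ e₁).symm

/-- Smooth local sections of `F → X`. -/
theorem exists_leaf_section (hF : CoframeReduction (EF := EF) 𝒢 κ) (f₀ : F) : ∃ s : X → F,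
    (∀ᶠ x in 𝓝 (𝒢.τ (κ f₀).1), ContMDiffAt 𝓘(ℝ, EX) 𝓘(ℝ, EF) ∞ s x ∧ 𝒢.τ (κ (s x)).1 = x) ∧
      s (𝒢.τ (κ f₀).1) = f₀ := by
  obtain ⟨σ, hσ, hσ0⟩ := exists_local_section (hF.submersion.isSubmersionAt f₀)
  obtain ⟨s, hs, hs0⟩ := exists_local_section (𝒢.τ_submersion.isSubmersionAt (κ f₀).1)
  refine ⟨fun x => σ (s x), ?_, ?_⟩
  · have h := hs.self_of_nhds.1.continuousAt.eventually (by rw [hs0]; exact hσ)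
    filter_upwards [hs, h] with x h1 h2
    exact ⟨h2.1.comp x h1.1, by rw [h2.2, h1.2]⟩
  · exact (congrArg σ hs0).trans hσ0

end CoframeReduction

end Leaves

/-! ### Symmetric multilinear forms and their diagonals -/

section Polarization

variable {E : Type*} [NormedAddCommGroup E] [NormedSpace ℝ E]

/-- A symmetric multilinear form is determined by its diagonal. -/
theorem eq_of_diagonal_eq {k : ℕ} {q q' : ContinuousMultilinearMap ℝ (fun _ : Fin k => E) ℝ}
    (hq : ∀ (s : Equiv.Perm (Fin k)) (v : Fin k → E), q (fun i => v (s i)) = q v)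
    (hq' : ∀ (s : Equiv.Perm (Fin k)) (v : Fin k → E), q' (fun i => v (s i)) = q' v)
    (h : ∀ x, q (fun _ => x) = q' fun _ => x) : q = q' := by
  ext v
  have h1 := q.iteratedFDeriv_comp_diagonal 0 v
  have h2 := q'.iteratedFDeriv_comp_diagonal 0 v
  rw [funext h, h2] at h1
  simp only [hq, hq', Finset.sum_const, Finset.card_univ, nsmul_eq_mul] at h1
  exact (mul_left_cancel₀ (Nat.cast_ne_zero.2 Fintype.card_ne_zero) h1).symm

/-- The determinant of the matrix whose `a`-th row is the `a`-th row of `etaMat (v a)`, the rows being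
indexed by `Fin (n + 1)`. -/
def rowDet (n : ℕ) : ContinuousMultilinearMap ℝ (fun _ : Fin (n + 1) => CoframeModel n) ℝ :=
  let e : Fin (n + 1) ≃ Fin 1 ⊕ Fin n := (finSumFinEquiv.trans (finCongr (add_comm 1 n))).symm
  { toMultilinearMap := Matrix.detRowAlternating.toMultilinearMap.compLinearMap fun a =>
      ((LinearMap.funLeft ℝ ℝ e).comp (LinearMap.proj (e a))).comp (etaCLM n).toLinearMap
    cont := by
      change Continuous fun v : Fin (n + 1) → CoframeModel n =>
        Matrix.det (Matrix.of fun a b => etaCLM n (v a) (e a) (e b))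
      refine Continuous.matrix_det (continuous_pi fun a => continuous_pi fun b => ?_)
      have h1 : Continuous fun v : Fin (n + 1) → CoframeModel n => etaCLM n (v a) :=
        (etaCLM n).continuous.comp (continuous_apply a)
      exact (continuous_apply (e b)).comp ((continuous_apply (e a)).comp h1) }

theorem rowDet_diagonal {n : ℕ} (u : CoframeModel n) : rowDet n (fun _ => u) = detEta u := by
  rw [detEta_eq_det_etaMat]
  exact Matrix.det_submatrix_equiv_self _ _

/-- The symmetric multilinear form whose diagonal is `detEta`, as the symmetrization of `rowDet`. -/
def polarDet (n : ℕ) : ContinuousMultilinearMap ℝ (fun _ : Fin (n + 1) => CoframeModel n) ℝ :=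
  (Fintype.card (Equiv.Perm (Fin (n + 1))) : ℝ)⁻¹ •
    ∑ s : Equiv.Perm (Fin (n + 1)), (rowDet n).domDomCongr s

theorem polarDet_apply {n : ℕ} (v : Fin (n + 1) → CoframeModel n) : polarDet n v =
    (Fintype.card (Equiv.Perm (Fin (n + 1))) : ℝ)⁻¹ *
      ∑ s : Equiv.Perm (Fin (n + 1)), rowDet n fun i => v (s i) := by
  simp [polarDet]

theorem polarDet_diagonal {n : ℕ} (u : CoframeModel n) : polarDet n (fun _ => u) = detEta u := by
  rw [polarDet_apply]
  simp only [rowDet_diagonal, Finset.sum_const, Finset.card_univ, nsmul_eq_mul]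
  exact inv_mul_cancel_left₀ (Nat.cast_ne_zero.2 Fintype.card_ne_zero) _

theorem polarDet_perm {n : ℕ} (s : Equiv.Perm (Fin (n + 1))) (v : Fin (n + 1) → CoframeModel n) :
    polarDet n (fun i => v (s i)) = polarDet n v := by
  rw [polarDet_apply, polarDet_apply]
  congr 1
  exact Fintype.sum_equiv (Equiv.mulLeft s) _ _ fun t => rfl

end Polarization

/-! ### The conformal class -/

section Conformal

variable {n : ℕ}
  {EY : Type*} [NormedAddCommGroup EY] [NormedSpace ℝ EY]
  {EZ : Type*} [NormedAddCommGroup EZ] [NormedSpace ℝ EZ]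
  {EX : Type*} [NormedAddCommGroup EX] [NormedSpace ℝ EX]
  {Y : Type*} [TopologicalSpace Y] [ChartedSpace EY Y]
  {Z : Type*} [TopologicalSpace Z] [ChartedSpace EZ Z]
  {X : Type*} [TopologicalSpace X] [ChartedSpace EX X]
  {𝒢 : LegendrianPathGeometry n (EY := EY) (EZ := EZ) (EX := EX) Y Z X}
  {EF : Type*} [NormedAddCommGroup EF] [NormedSpace ℝ EF]
  {F : Type*} [TopologicalSpace F] [ChartedSpace EF F]
  {κ : F → CoframeBundle n EZ Z}

/-- `q` is the symmetric multilinear form on the tangent space of the space of leaves whose diagonal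
is the function `det η` of the coframe `u`. -/
def IsLeafForm (𝒢 : LegendrianPathGeometry n (EY := EY) (EZ := EZ) (EX := EX) Y Z X)
    (u : CoframeBundle n EZ Z)
    (q : ContinuousMultilinearMap ℝ (fun _ : Fin (n + 1) => EX) ℝ) : Prop :=
  (∀ (s : Equiv.Perm (Fin (n + 1))) (v : Fin (n + 1) → EX), q (fun i => v (s i)) = q v) ∧
    ∀ x, q (fun _ => x) = leafDet 𝒢 u x

/-- The line of multilinear forms at a point `x` of the space of leaves that the coframes of `F` over
the leaf `x` determine. -/
def leafLine (𝒢 : LegendrianPathGeometry n (EY := EY) (EZ := EZ) (EX := EX) Y Z X)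
    (κ : F → CoframeBundle n EZ Z) (x : X) :
    Submodule ℝ (ContinuousMultilinearMap ℝ (fun _ : Fin (n + 1) => EX) ℝ) :=
  Submodule.span ℝ {q | ∃ f : F, 𝒢.τ (κ f).1 = x ∧ IsLeafForm 𝒢 (κ f) q}

namespace CoframeReduction

variable [IsManifold 𝓘(ℝ, EZ) ∞ Z]

theorem isLeafForm_ne_zero (hF : CoframeReduction (EF := EF) 𝒢 κ) {f : F}
    {q : ContinuousMultilinearMap ℝ (fun _ : Fin (n + 1) => EX) ℝ} (hq : IsLeafForm 𝒢 (κ f) q) :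
    q ≠ 0 := by
  rintro rfl
  obtain ⟨x, hx⟩ := exists_leafDet_ne_zero (hF.mem f)
  exact hx (hq.2 x).symm

variable [IsManifold 𝓘(ℝ, EX) ∞ X] [IsManifold 𝓘(ℝ, EF) ∞ F]

theorem leafLine_eq_span (hF : CoframeReduction (EF := EF) 𝒢 κ) (hn : 0 < n) {f : F} {x : X}
    (hx : 𝒢.τ (κ f).1 = x) {q : ContinuousMultilinearMap ℝ (fun _ : Fin (n + 1) => EX) ℝ}
    (hq : IsLeafForm 𝒢 (κ f) q) : leafLine 𝒢 κ x = Submodule.span ℝ {q} := by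
  refine le_antisymm (Submodule.span_le.2 ?_)
    (Submodule.span_mono (Set.singleton_subset_iff.2 ⟨f, hx, hq⟩))
  rintro q' ⟨f', hx', hq'⟩
  obtain ⟨k, -, hk⟩ := hF.leafDetProp_of_leaf_eq hn (hx.trans hx'.symm)
  refine Submodule.mem_span_singleton.2 ⟨k, eq_of_diagonal_eq (fun s v => ?_) hq'.1 fun y => ?_⟩
  · simp only [_root_.smul_apply, hq.1 s v]
  · simp only [_root_.smul_apply, hq.2, hq'.2, hk, smul_eq_mul]

/-- A local section `s` of `F → X` gives a smooth field of multilinear forms. -/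
theorem exists_smooth_isLeafForm (hF : CoframeReduction (EF := EF) 𝒢 κ) (f₀ : F) :
    ∃ (q : MultiForm (n + 1) EX X) (s : X → F), s (𝒢.τ (κ f₀).1) = f₀ ∧
      ∀ᶠ x in 𝓝 (𝒢.τ (κ f₀).1), SmoothMultiFormAt q x ∧ 𝒢.τ (κ (s x)).1 = x ∧
        IsLeafForm 𝒢 (κ (s x)) (q x) := by
  obtain ⟨s, hs, hs0⟩ := hF.exists_leaf_section f₀
  refine ⟨fun x => (polarDet n).compContinuousLinearMap fun _ =>
    pullForm (E := EX) s (taut (EP := EF) κ) x, s, hs0, ?_⟩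
  filter_upwards [hs, hs.eventually_nhds] with x hx hx'
  refine ⟨?_, hx.2, fun t v => polarDet_perm t fun i =>
    pullForm (E := EX) s (taut (EP := EF) κ) x (v i), fun y => ?_⟩
  · have h1 : SmoothFormAt (pullForm (E := EX) s (taut (EP := EF) κ)) x :=
      SmoothFormAt.pullForm hx.1 (hF.smoothFormAt_taut _)
    have h2 : ContDiff ℝ ∞ fun A : EX →L[ℝ] CoframeModel n =>
        (ContinuousMultilinearMap.compContinuousLinearMapContinuousMultilinear ℝ
          (fun _ : Fin (n + 1) => EX) (fun _ => CoframeModel n) ℝ (fun _ => A)) (polarDet n) := by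
      have h3 : ContDiff ℝ ∞ fun A : Fin (n + 1) → EX →L[ℝ] CoframeModel n =>
          ContinuousMultilinearMap.compContinuousLinearMapContinuousMultilinear ℝ
            (fun _ : Fin (n + 1) => EX) (fun _ => CoframeModel n) ℝ A :=
        ContinuousMultilinearMap.contDiff _
      have h4 : ContDiff ℝ ∞ fun (A : EX →L[ℝ] CoframeModel n) (_ : Fin (n + 1)) => A :=
        contDiff_pi.2 fun _ => contDiff_id
      exact (h3.comp h4).clm_apply contDiff_const
    exact h2.contDiffAt.comp _ h1
  · refine (polarDet_diagonal _).trans ?_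
    have h3 : 𝒢.τ (κ (s x)).1 = x := hx.2
    have h4 := mfderiv_mfderiv_of_section (g := fun f => 𝒢.τ (κ f).1) (s := s) (y := x)
      ((hF.contMDiffAt_leaf (s x)).mdifferentiableAt (by simp))
      (hx.1.mdifferentiableAt (by simp)) (hx'.mono fun _ h => h.2) y
    have h5 := hF.leafDet_mfderiv_leaf (s x) (mfderiv 𝓘(ℝ, EX) 𝓘(ℝ, EF) s x y)
    exact h5.symm.trans (congrArg (leafDet 𝒢 (κ (s x))) h4)

/-- The determinant of the tautological form is the pull-back of the elements of a unique conformal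
class on the space of leaves. -/
theorem existsUnique_conformalClass (hF : CoframeReduction (EF := EF) 𝒢 κ) (hn : 0 < n) :
    ∃! ℓ : ∀ x : X, Submodule ℝ
        (ContinuousMultilinearMap ℝ (fun _ : Fin (n + 1) => TangentSpace 𝓘(ℝ, EX) x) ℝ),
      IsConformalClass (n + 1) ℓ ∧
      ∀ f : F, ∃ q ∈ ℓ (𝒢.τ (κ f).1), ∀ w : TangentSpace 𝓘(ℝ, EF) f,
        q (fun _ => mfderiv 𝓘(ℝ, EF) 𝓘(ℝ, EX) (fun f' => 𝒢.τ (κ f').1) f w)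
          = detEta (taut (EP := EF) κ f w) := by
  have hover : ∀ x : X, ∃ f : F, 𝒢.τ (κ f).1 = x := by
    intro x
    obtain ⟨z, hz⟩ := (𝒢.leaf_connected x).nonempty
    obtain ⟨f, rfl⟩ := hF.surjective z
    exact ⟨f, hz⟩
  have hform : ∀ f, ∃ q, IsLeafForm 𝒢 (κ f) q := by
    intro f
    obtain ⟨q, s, hs, hq⟩ := hF.exists_smooth_isLeafForm f
    have := hq.self_of_nhds.2.2
    rw [hs] at this
    exact ⟨_, this⟩
  refine ⟨leafLine 𝒢 κ, ⟨fun x₀ => ?_, fun f => ?_⟩, ?_⟩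
  · obtain ⟨f₀, rfl⟩ := hover x₀
    obtain ⟨q, s, -, hq⟩ := hF.exists_smooth_isLeafForm f₀
    refine ⟨q, ?_⟩
    filter_upwards [hq] with x h
    exact ⟨h.1, hF.isLeafForm_ne_zero h.2.2, h.2.2.1, hF.leafLine_eq_span hn h.2.1 h.2.2⟩
  · obtain ⟨q, hq⟩ := hform f
    have hmem : q ∈ leafLine 𝒢 κ (𝒢.τ (κ f).1) := Submodule.subset_span ⟨f, rfl, hq⟩
    exact ⟨q, hmem,
      fun w => (hq.2 _).trans (hF.leafDet_mfderiv_leaf f w)⟩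
  · rintro ℓ' ⟨hc, hdet⟩
    funext x
    obtain ⟨f, rfl⟩ := hover x
    obtain ⟨q, hq⟩ := hform f
    obtain ⟨q', hq', hdiag⟩ := hdet f
    obtain ⟨r, hr⟩ := hc (𝒢.τ (κ f).1)
    obtain ⟨-, -, hsymm, hspan⟩ := hr.self_of_nhds
    let r' : ContinuousMultilinearMap ℝ (fun _ : Fin (n + 1) => EX) ℝ := r (𝒢.τ (κ f).1)
    let q'' : ContinuousMultilinearMap ℝ (fun _ : Fin (n + 1) => EX) ℝ := q'
    have hmem : q'' ∈ Submodule.span ℝ {r'} :=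
      (congrArg (fun S : Submodule ℝ (ContinuousMultilinearMap ℝ (fun _ : Fin (n + 1) => EX) ℝ) =>
        q'' ∈ S) hspan).mp hq'
    obtain ⟨a, ha⟩ := Submodule.mem_span_singleton.1 hmem
    have heq : a • r' = q := by
      refine eq_of_diagonal_eq (E := EX) (fun t v => ?_) hq.1 fun y => ?_
      · exact congrArg (a * ·) (hsymm t v)
      · obtain ⟨w, rfl⟩ := hF.surjective_mfderiv_leaf f y
        rw [ha]
        exact (hdiag w).trans ((hq.2 _).trans (hF.leafDet_mfderiv_leaf f w)).symm
    have ha0 : a ≠ 0 := by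
      rintro rfl
      exact hF.isLeafForm_ne_zero hq (heq.symm.trans (zero_smul _ _))
    have hsp := Submodule.span_singleton_smul_eq (IsUnit.mk0 a ha0) r'
    rw [heq] at hsp
    exact hspan.trans (hsp.symm.trans (hF.leafLine_eq_span hn rfl hq).symm)

end CoframeReduction

end Conformal

/-! ### The reduction -/

section Reduction

variable {n : ℕ}
  {EY : Type*} [NormedAddCommGroup EY] [NormedSpace ℝ EY]
  {EZ : Type*} [NormedAddCommGroup EZ] [NormedSpace ℝ EZ]
  {EX : Type*} [NormedAddCommGroup EX] [NormedSpace ℝ EX]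
  {Y : Type*} [TopologicalSpace Y] [ChartedSpace EY Y]
  {Z : Type*} [TopologicalSpace Z] [ChartedSpace EZ Z] [IsManifold 𝓘(ℝ, EZ) ∞ Z]
  {X : Type*} [TopologicalSpace X] [ChartedSpace EX X]
  {𝒢 : LegendrianPathGeometry n (EY := EY) (EZ := EZ) (EX := EX) Y Z X}
  {EP : Type*} [NormedAddCommGroup EP] [NormedSpace ℝ EP]
  {P : Type*} [TopologicalSpace P] [ChartedSpace EP P] [IsManifold 𝓘(ℝ, EP) ∞ P]
  {EF : Type*} [NormedAddCommGroup EF] [NormedSpace ℝ EF]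
  {F : Type*} [TopologicalSpace F] [ChartedSpace EF F] [IsManifold 𝓘(ℝ, EF) ∞ F]
  {ι : P → CoframeBundle n EZ Z} {j : F → P}

/-- The reduction of the bundle of adapted coframes has the properties that the determinant argument
needs. -/
theorem coframeReduction_comp (hι : IsAdaptedBundle (EP := EP) 𝒢 ι)
    {ϖ : PseudoConnection (EP := EP) ι} (hj : IsReduction (EP := EP) (EF := EF) ι j)
    (hred : SatisfiesReductionConditions (EF := EF) ϖ j) :
    CoframeReduction (EF := EF) 𝒢 (ι ∘ j) where
  contMDiff := hι.embedding.contMDiff.comp hj.embedding.contMDiff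
  mem f := hι.range_eq ▸ Set.mem_range_self (j f)
  submersion := hj.submersion
  surjective := hj.surjective
  variation f v hv := exists_etaMat_vextD_eq
    (reducedStructureEquations_torsion hι.embedding.contMDiff hj.embedding.contMDiff hred)
    (smoothFormAt_taut ((hι.embedding.contMDiff.comp hj.embedding.contMDiff) f))
    (fun a b => isQuadraticIn_torsion hred a b f) hv
  symmetry f f' hf := by
    obtain ⟨H, hH, hH'⟩ := hj.orbits
    obtain ⟨h, hh, hf'⟩ := hH' f f' hf
    -- `h` acts on all of `F`, since the fibres are unions of orbits; `R` is smooth because its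
    -- composition with the embedding `ι ∘ j` is
    choose R hR using fun f => hH f h hh
    have hcomp : ContMDiff 𝓘(ℝ, EF) (coframeI n EZ) ∞ (ι ∘ j ∘ R) := by
      rw [show ι ∘ j ∘ R = _ from funext hR]
      exact fun f => contMDiffAt_coframeBundle_comp
        ((hι.embedding.contMDiff.comp hj.embedding.contMDiff) f) _
    have hcont : Continuous R := by
      rw [hj.embedding.isEmbedding.continuous_iff, hι.embedding.isEmbedding.continuous_iff]
      exact hcomp.continuous
    refine ⟨h, R, ?_, ?_, hR⟩
    · refine (ContMDiff.iff_comp_isImmersion hj.embedding.isImmersion).2 ⟨hcont, ?_⟩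
      exact (ContMDiff.iff_comp_isImmersion hι.embedding.isImmersion).2
        ⟨hj.embedding.contMDiff.continuous.comp hcont, hcomp⟩
    · exact hj.embedding.isEmbedding.injective
        (hι.embedding.isEmbedding.injective ((hR f).trans hf'.symm))

end Reduction

end LegPath

end

open LegPath in
theorem proposition2 (n : ℕ) (hn : 2 ≤ n)
    {EY : Type*} [NormedAddCommGroup EY] [NormedSpace ℝ EY] [FiniteDimensional ℝ EY]
    {EZ : Type*} [NormedAddCommGroup EZ] [NormedSpace ℝ EZ] [FiniteDimensional ℝ EZ]
    {EX : Type*} [NormedAddCommGroup EX] [NormedSpace ℝ EX] [FiniteDimensional ℝ EX]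
    {EP : Type*} [NormedAddCommGroup EP] [NormedSpace ℝ EP] [FiniteDimensional ℝ EP]
    {EF : Type*} [NormedAddCommGroup EF] [NormedSpace ℝ EF] [FiniteDimensional ℝ EF]
    {Y : Type*} [TopologicalSpace Y] [ChartedSpace EY Y] [IsManifold 𝓘(ℝ, EY) ∞ Y]
    {Z : Type*} [TopologicalSpace Z] [ChartedSpace EZ Z] [IsManifold 𝓘(ℝ, EZ) ∞ Z]
    {X : Type*} [TopologicalSpace X] [ChartedSpace EX X] [IsManifold 𝓘(ℝ, EX) ∞ X]
    {F₁ : Type*} [TopologicalSpace F₁] [ChartedSpace EP F₁] [IsManifold 𝓘(ℝ, EP) ∞ F₁]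
    {F : Type*} [TopologicalSpace F] [ChartedSpace EF F] [IsManifold 𝓘(ℝ, EF) ∞ F]
    (𝒢 : LegendrianPathGeometry n (EY := EY) (EZ := EZ) (EX := EX) Y Z X)
    (ι : F₁ → CoframeBundle n EZ Z) (hι : IsAdaptedBundle (EP := EP) 𝒢 ι)
    (ϖ : PseudoConnection (EP := EP) ι)
    (j : F → F₁) (hj : IsReduction (EP := EP) (EF := EF) ι j)
    (hred : SatisfiesReductionConditions (EF := EF) ϖ j) :
    (∃! ℓ : ∀ x : X, Submodule ℝ
        (ContinuousMultilinearMap ℝ (fun _ : Fin (n + 1) => TangentSpace 𝓘(ℝ, EX) x) ℝ),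
      IsConformalClass (n + 1) ℓ ∧
      ∀ f : F, ∃ q ∈ ℓ (𝒢.τ (ι (j f)).1), ∀ w : TangentSpace 𝓘(ℝ, EF) f,
        q (fun _ => mfderiv 𝓘(ℝ, EF) 𝓘(ℝ, EX) (fun f' => 𝒢.τ (ι (j f')).1) f w)
          = detEta (taut (EP := EF) (ι ∘ j) f w)) ∧
    ∃ T : Fin n → Fin n → TwoForm EF F,
      ReducedStructureEquations (ι ∘ j) (pullForm j ϖ.ρ) (fun a b => pullForm j (ϖ.α a b))
        (fun a => pullForm j (ϖ.β a)) (fun a => pullForm j (ϖ.μ a))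
        (fun a b => pullForm j (ϖ.γ a b)) T ∧
      (∀ a b, T a b = T b a) ∧
      ∀ a b, ∀ f : F, IsQuadraticIn (gen2 (taut (EP := EF) (ι ∘ j) f)) (T a b f) ∧
        InIdeal (gen1 (taut (EP := EF) (ι ∘ j) f)) (T a b f) := by
  have hF := coframeReduction_comp hι hj hred
  exact ⟨hF.existsUnique_conformalClass (by omega), torsion ϖ j,
    reducedStructureEquations_torsion hι.embedding.contMDiff hj.embedding.contMDiff hred,
    torsion_symm ϖ j, fun a b f => ⟨isQuadraticIn_torsion hred a b f, inIdeal_torsion ϖ j a b f⟩⟩
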